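/- Let $d\ge 1$. An environment is a family $\omega=(\omega_x)_{x\in\mathbb Z^d}$ of probability vectors $\omega_x=(\omega_{x,z})_{z\in\mathbb Z^d}$ on $\mathbb Z^d$; write $\pi_{x,y}(\omega)=\omega_{x,y-x}$. The space $\Omega$ of environments carries the product $\sigma$-field and the product topology (with coordinatewise convergence of probability vectors), and the shifts $T_z$ are given by $\pi_{x,y}(T_z\omega)=\pi_{x+z,y+z}(\omega)$. For fixed $\omega$, $P_0^\omega$ (expectation $E_0^\omega$) is the law of the Markov chain $(X_n)_{n\ge 0}$ on $\mathbb Z^d$ with $X_0=0$ and transition probabilities $\pi_{x,y}(\omega)$. Let $\mathbb P$ (expectation $\mathbb E$) be an i.i.d. product measure on $\Omega$, i.e. the vectors $\omega_x$ are i.i.d. under $\mathbb P$, and let $P_0(d\omega,dx_{0,\infty})=\mathbb P(d\omega)P_0^\omega(dx_{0,\infty})$ be the averaged measure, with expectation $E_0$. Let $|\cdot|$ be the Euclidean norm and $D(\omega)=E_0^\omega[X_1]$. Assume that for some $\hat u\in\mathbb Z^d$: (i) (transience) $P_0\{X_n\cdot\hat u\to\infty\}=1$; (ii) (bounded steps)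 there is a finite constant $\mathbb M>0$ such that $\mathbb P\{\pi_{0,z}=0\}=1$ whenever $|z|>\mathbb M$; (iii) (regeneration moment) $E_0[\tau_1^{p_0}]<\infty$ for the real number $p_0$, where $\tau_1$ is the first time $k\ge 1$ with $\sup_{n<k}X_n\cdot\hat u<X_k\cdot\hat u=\inf_{n\ge k}X_n\cdot\hat u$ ($\tau_1=\infty$ if there is no such $k$). Let $\mathbb P_n(A)=P_0\{T_{X_n}\omega\in A\}$ be the law of the environment seen from the walk at time $n$, and let $\mathbb P_\infty$ (expectation $\mathbb E_\infty$) be the invariant measure of the environment process obtained from $\mathbb P$, that is, a probability measure on $\Omega$ which is the weak limit of $n_j^{-1}\sum_{m=1}^{n_j}\mathbb P_m$ along some strictly increasing sequence of natural numbers $n_j$. Suppose that for some real $\bar\alpha<1/2$, as $n\to\infty$, $$\mathbb E\bigl[\,|E_0^\omega(X_n)-E_0(X_n)|^2\,\bigr]=O(n^{2\bar\alpha}).$$ Let $\alpha\in(\bar\alpha,1)$ and assume that $p_0>\dfrac{5d}{\alpha-\bar\alpha}$. Then, as $n\to\infty$, $$\mathbb E_\infty\bigl[\,|E_0^\omega(X_n)-n\,\mathbb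 E_\infty(D)|^2\,\bigr]=O(n^{2\alpha}).$$ -/

import Mathlib

open MeasureTheory ProbabilityTheory Filter Topology BoundedContinuousFunction
open scoped ENNReal

namespace RWRE

/-- The lattice `ℤ^d`. -/
abbrev Site (d : ℕ) := Fin d → ℤ

/-- The simplex of probability vectors on `ℤ^d`, with the σ-algebra and the topology of
coordinatewise evaluation. -/
abbrev JumpLaw (d : ℕ) := {p : Site d → ℝ // (∀ z, 0 ≤ p z) ∧ HasSum p 1}

/-- Environments `ω = (ω_x)_{x ∈ ℤ^d}`, with the product σ-algebra and the product topology. -/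
abbrev Env (d : ℕ) := Site d → JumpLaw d

/-- Infinite paths `(x_n)_{n ≥ 0}` in `ℤ^d`. -/
abbrev Path (d : ℕ) := ℕ → Site d

/-- The inclusion of `ℤ^d` into Euclidean space `ℝ^d`. -/
noncomputable def toE {d : ℕ} (x : Site d) : EuclideanSpace ℝ (Fin d) :=
  WithLp.toLp 2 fun i => (x i : ℝ)

/-- The transition probability `π_{x,y}(ω) = ω_{x,y-x}`. -/
def transProb {d : ℕ} (ω : Env d) (x y : Site d) : ℝ := (ω x).1 (y - x)

/-- The shift `T_z`, with `π_{x,y}(T_z ω) = π_{x+z,y+z}(ω)`. -/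
def shift {d : ℕ} (z : Site d) (ω : Env d) : Env d := fun x => ω (x + z)

theorem transProb_shift {d : ℕ} (z : Site d) (ω : Env d) (x y : Site d) :
    transProb (shift z ω) x y = transProb ω (x + z) (y + z) := by
  simp [transProb, shift]

/-- The law of the next position of the walk, given that it is at `x` in the environment `ω`. -/
noncomputable def stepLaw {d : ℕ} (ω : Env d) (x : Site d) : Measure (Site d) :=
  Measure.sum fun y => ENNReal.ofReal (transProb ω x y) • Measure.dirac y

instance {d : ℕ} (ω : Env d) (x : Site d) : IsProbabilityMeasure (stepLaw ω x) where
  measure_univ := by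
    have h : HasSum (transProb ω x) 1 := (Equiv.subRight x).hasSum_iff.mpr (ω x).2.2
    rw [stepLaw, Measure.sum_apply _ MeasurableSet.univ]
    simp only [Measure.smul_apply, measure_univ, smul_eq_mul, mul_one]
    rw [← ENNReal.ofReal_tsum_of_nonneg (f := transProb ω x) (fun y => (ω x).2.1 _) h.summable, h.tsum_eq,
      ENNReal.ofReal_one]

/-- The Markov chain with transition probabilities `π_{x,y}(ω)`: given the path up to time `n`,
the position at time `n + 1` has law `stepLaw ω x_n`. -/
noncomputable def nextKernel {d : ℕ} (ω : Env d) (n : ℕ) :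
    Kernel ((i : Finset.Iic n) → Site d) (Site d) where
  toFun h := stepLaw ω (h ⟨n, Finset.mem_Iic.mpr le_rfl⟩)
  measurable' := measurable_of_countable _

instance {d : ℕ} (ω : Env d) (n : ℕ) : IsMarkovKernel (nextKernel ω n) where
  isProbabilityMeasure h :=
    inferInstanceAs (IsProbabilityMeasure (stepLaw ω (h ⟨n, Finset.mem_Iic.mpr le_rfl⟩)))

/-- The quenched path measure `P_z^ω` (Ionescu-Tulcea construction). -/
noncomputable def quenched {d : ℕ} (z : Site d) (ω : Env d) : Measure (Path d) :=
  Kernel.traj (X := fun _ => Site d) (nextKernel ω) 0 (fun _ => z)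

instance {d : ℕ} (z : Site d) (ω : Env d) : IsProbabilityMeasure (quenched z ω) :=
  inferInstanceAs (IsProbabilityMeasure
    (Kernel.traj (X := fun _ => Site d) (nextKernel ω) 0 (fun _ => z)))

theorem measurable_stepLaw {d : ℕ} (x : Site d) {s : Set (Site d)} :
    Measurable fun ω : Env d => stepLaw ω x s := by
  simp only [stepLaw, Measure.sum_apply _ (MeasurableSet.of_discrete (s := s)),
    Measure.smul_apply, smul_eq_mul]
  refine Measurable.tsum fun y => ?_
  refine Measurable.mul_const (ENNReal.measurable_ofReal.comp ?_) _
  exact (measurable_pi_apply (y - x)).comp (measurable_subtype_coe.comp (measurable_pi_apply x))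

theorem measurable_partialTraj {d : ℕ} (z : Site d) (n : ℕ)
    (s : Set ((i : Finset.Iic n) → Site d)) :
    Measurable fun ω : Env d =>
      Kernel.partialTraj (X := fun _ => Site d) (nextKernel ω) 0 n (fun _ => z) s := by
  induction n with
  | zero => simp only [Kernel.partialTraj_self]; exact measurable_const
  | succ n ih =>
    simp only [Kernel.partialTraj_succ_eq_comp (X := fun _ => Site d) (Nat.zero_le n),
      Kernel.comp_apply' _ _ _ (MeasurableSet.of_discrete (s := s)), lintegral_countable']
    refine Measurable.tsum fun h => Measurable.mul ?_ (ih _)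
    have hη (ω : Env d) := Kernel.IsMarkovKernel.map (nextKernel ω n)
      (MeasurableEquiv.piSingleton (X := fun _ => Site d) n).measurable
    have key (ω : Env d) : Kernel.partialTraj (X := fun _ => Site d) (nextKernel ω) n (n + 1) h s
        = stepLaw ω (h ⟨n, Finset.mem_Iic.mpr le_rfl⟩)
          (MeasurableEquiv.piSingleton (X := fun _ => Site d) n ⁻¹'
            (Prod.mk h ⁻¹' (IicProdIoc (X := fun _ => Site d) n (n + 1) ⁻¹' s))) := by
      rw [Kernel.partialTraj_succ_self,
        Kernel.map_apply' _ (by fun_prop) _ .of_discrete,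
        Kernel.id_prod_apply' _ _ .of_discrete,
        Kernel.map_apply' _ (MeasurableEquiv.measurable _) _ .of_discrete]
      rfl
    simp only [key]
    exact measurable_stepLaw _

theorem measurable_quenched {d : ℕ} (z : Site d) :
    Measurable (quenched z : Env d → Measure (Path d)) := by
  refine Measurable.measure_of_isPiSystem_of_isProbabilityMeasure
    (generateFrom_measurableCylinders (α := fun _ : ℕ => Site d)).symm
    isPiSystem_measurableCylinders fun t ht => ?_
  obtain ⟨N, S, mS, rfl⟩ : ∃ N S, MeasurableSet S ∧ t = cylinder (Finset.Iic N) S := by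
    simpa [measurableCylinders_nat] using ht
  have key (ω : Env d) : quenched z ω (cylinder (Finset.Iic N) S)
      = Kernel.partialTraj (X := fun _ => Site d) (nextKernel ω) 0 N (fun _ => z) S := by
    rw [← Kernel.traj_map_frestrictLe_apply,
      Measure.map_apply (Preorder.measurable_frestrictLe N) mS]
    rfl
  simp only [key]
  exact measurable_partialTraj z N S

/-- The quenched path measures as a kernel `ω ↦ P_z^ω`. -/
noncomputable def quenchedKernel {d : ℕ} (z : Site d) : Kernel (Env d) (Path d) where
  toFun := quenched z
  measurable' := measurable_quenched z

instance {d : ℕ} (z : Site d) : IsMarkovKernel (quenchedKernel z) where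
  isProbabilityMeasure ω := inferInstanceAs (IsProbabilityMeasure (quenched z ω))

/-- The joint averaged measure `P_z(dω, dx) = ℙ(dω) P_z^ω(dx)` on environments and paths. -/
noncomputable def averaged {d : ℕ} (P : Measure (Env d)) (z : Site d) :
    Measure (Env d × Path d) :=
  P ⊗ₘ quenchedKernel z

/-- The i.i.d. product measure on environments whose one-site marginal is `μ`. -/
noncomputable def iidEnv {d : ℕ} (μ : Measure (JumpLaw d)) [IsProbabilityMeasure μ] :
    Measure (Env d) :=
  Measure.infinitePi fun _ : Site d => μ

/-- The quenched mean `E_0^ω(X_n)`. -/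
noncomputable def quenchedMean {d : ℕ} (ω : Env d) (n : ℕ) : EuclideanSpace ℝ (Fin d) :=
  ∫ x, toE (x n) ∂(quenched 0 ω)

/-- The averaged mean `E_0(X_n)`. -/
noncomputable def averagedMean {d : ℕ} (P : Measure (Env d)) (n : ℕ) :
    EuclideanSpace ℝ (Fin d) :=
  ∫ q, toE (q.2 n) ∂(averaged P 0)

/-- The drift `D(ω) = E_0^ω(X_1)`. -/
noncomputable def drift {d : ℕ} (ω : Env d) : EuclideanSpace ℝ (Fin d) := quenchedMean ω 1

/-- Transience in direction `u`: `P_0{X_n · u → ∞} = 1`. -/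
def Transient {d : ℕ} (P : Measure (Env d)) (u : Site d) : Prop :=
  ∀ᵐ q ∂(averaged P 0), Tendsto (fun n => q.2 n ⬝ᵥ u) atTop atTop

/-- Bounded steps: for some finite constant `M > 0`, `ℙ{π_{0,z} = 0} = 1` whenever `|z| > M`. -/
def BoundedSteps {d : ℕ} (P : Measure (Env d)) : Prop :=
  ∃ M : ℝ, 0 < M ∧ ∀ z : Site d, M < ‖toE z‖ → ∀ᵐ ω ∂P, transProb ω 0 z = 0

/-- `k` is a regeneration time of `x` in direction `u`:
`sup_{n < k} x_n · u < x_k · u = inf_{n ≥ k} x_n · u`. -/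
def IsRegeneration {d : ℕ} (u : Site d) (x : Path d) (k : ℕ) : Prop :=
  (∀ n < k, x n ⬝ᵥ u < x k ⬝ᵥ u) ∧ ∀ n, k ≤ n → x k ⬝ᵥ u ≤ x n ⬝ᵥ u

/-- The first regeneration time `τ_1`, the least `k ≥ 1` that is a regeneration time
(`∞` if there is none). -/
noncomputable def tau {d : ℕ} (u : Site d) (x : Path d) : ℕ∞ :=
  ⨅ (k : ℕ) (_ : 1 ≤ k ∧ IsRegeneration u x k), (k : ℕ∞)

/-- `E_0(τ_1^p) < ∞`. -/
def RegenerationMoment {d : ℕ} (P : Measure (Env d)) (u : Site d) (p : ℝ) : Prop :=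
  ∫⁻ q, (tau u q.2 : ℝ≥0∞) ^ p ∂(averaged P 0) < ∞

/-- The law `ℙ_n(A) = P_0{T_{X_n} ω ∈ A}` of the environment seen from the walk at time `n`. -/
noncomputable def envLaw {d : ℕ} (P : Measure (Env d)) (n : ℕ) : Measure (Env d) :=
  (averaged P 0).map fun q => shift (q.2 n) q.1

theorem measurable_shift_path {d : ℕ} (n : ℕ) :
    Measurable fun q : Env d × Path d => shift (q.2 n) q.1 := by
  have h : Measurable fun q : Env d × Site d => shift q.2 q.1 :=
    measurable_from_prod_countable_left fun z =>
      measurable_pi_lambda _ fun x => measurable_pi_apply (x + z)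
  exact h.comp (measurable_fst.prodMk ((measurable_pi_apply n).comp measurable_snd))

/-- `Q` is the limit, in the sense of weak convergence of probability measures, of
`n_j^{-1} ∑_{m=1}^{n_j} ℙ_m` along some subsequence `n_j → ∞`. -/
def IsCesaroLimit {d : ℕ} (P Q : Measure (Env d)) : Prop :=
  ∃ N : ℕ → ℕ, StrictMono N ∧ ∀ F : Env d →ᵇ ℝ,
    Tendsto (fun j => (N j : ℝ)⁻¹ * ∑ m ∈ Finset.Icc 1 (N j), ∫ ω, F ω ∂(envLaw P m))
      atTop (𝓝 (∫ ω, F ω ∂Q))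

end RWRE

open RWRE

/-! Write v for the mean drift under the limit law, K for `levelBound u R`, and V_n for the mean of
|E_0^ω(X_n) - n v|² under ℙ. The hypothesis controls V_n, and the task is to carry this control over
to ℙ_∞. The environment seen from the walk resembles ℙ only at sites well ahead of the walk in
direction u, so the walk is first allowed to run into that region.

Regeneration times supply the estimates. At a record time the past is independent of a future that
does not backtrack (`annealed_inter_future`). Hence a time window of length s contains no
regeneration with probability at most an integrated tail b = O(s^(1-p₀)) of τ_1
(`annealed_noRegen_le`, `regenTailSum_le`). Since steps are bounded, a regeneration in a window
prevents the walk from ending it Ks or more below its running maximum, prevents a walk starting at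
the window from ever falling more than Ks below its start, and forces a gain of one level. So on
levels at least Ks the law of the environment seen from the walk is within b of ℙ
(`lintegral_envLaw_le`), and this survives the weak limit.

Now let the walk run r = qs steps with q = 2Ks. The deviation at 0 is the mean deviation at X_r up
to O(r) (`norm_sq_deviation_zero_le`). Except with probability qb, X_r has level at least q, and it
lies in a box of O(r^d) sites. From such a site the deviation is dominated by a function of the
environment at levels at least Ks, obtained by killing the walk when it leaves them (`localBound`);
the mean of this function is O(V_n + n² b), first under ℙ and then under ℙ_∞. A union bound over the
box (`integral_norm_sq_sub_le`) gives the bound C(s⁴ + s^(2d)(V_n + n² s^(2-p₀))). If ᾱ ≥ 0, the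
choice s ≈ n^((α-ᾱ)/(2d)) makes this O(n^(2α)) (`rate_bound`).

To compare V_n with the hypothesis one needs E_0(X_n) - n v = O(1). Up to a bounded error, the mean
displacement over [n, n+k] can be measured from the first regeneration at or after n, from which the
path is distributed as a walk conditioned not to backtrack, whatever n is. So the averaged mean is
approximately additive, and its slope is v because the mean drifts telescope.

If ᾱ < 0, the variance tends to 0. This forces the local drift to be almost surely constant;
constancy passes to ℙ_∞, where the left side is then zero (`integral_eq_zero_of_tendsto`). -/

namespace RWRE

/-! ### Cylinders and the quenched path measure -/

/-- The paths that agree with `a` up to time `n`. -/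
def cyl {d : ℕ} (n : ℕ) (a : Path d) : Set (Path d) := {x | ∀ i ≤ n, x i = a i}

theorem measurableSet_cyl {d : ℕ} (n : ℕ) (a : Path d) : MeasurableSet (cyl n a) := by
  simp only [cyl, Set.ofPred_forall]
  exact MeasurableSet.iInter fun i => MeasurableSet.iInter fun _ =>
    measurableSet_eq_fun (measurable_pi_apply i) measurable_const

/-- The history of a path up to time `n`. -/
def past {d : ℕ} (n : ℕ) (x : Path d) : (i : Finset.Iic n) → Site d :=
  Preorder.frestrictLe (π := fun _ => Site d) n x

theorem measurable_past {d : ℕ} (n : ℕ) : Measurable (past (d := d) n) :=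
  Preorder.measurable_frestrictLe n

/-- A path with prescribed history. -/
def extend {d : ℕ} (n : ℕ) (h : (i : Finset.Iic n) → Site d) : Path d :=
  fun i => h ⟨min i n, Finset.mem_Iic.mpr (min_le_right _ _)⟩

theorem past_preimage_singleton {d : ℕ} (n : ℕ) (h : (i : Finset.Iic n) → Site d) :
    past n ⁻¹' {h} = cyl n (extend n h) := by
  ext x
  simp only [Set.mem_preimage, Set.mem_singleton_iff, cyl, Set.mem_ofPred_eq, extend]
  constructor
  · rintro rfl i hi
    simp [past, hi]
  · intro hx
    funext ⟨i, hi⟩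
    have hi' := Finset.mem_Iic.mp hi
    simpa [past, hi'] using hx i hi'

theorem past_preimage_singleton_past {d : ℕ} (n : ℕ) (a : Path d) :
    past n ⁻¹' {past n a} = cyl n a := by
  ext x
  simp only [Set.mem_preimage, Set.mem_singleton_iff, cyl, Set.mem_ofPred_eq, past]
  constructor
  · intro h i hi
    exact congrFun h ⟨i, Finset.mem_Iic.mpr hi⟩
  · intro hx
    funext ⟨i, hi⟩
    exact hx i (Finset.mem_Iic.mp hi)

theorem measure_eq_tsum_past {d : ℕ} (ν : Measure (Path d)) (n : ℕ) {A : Set (Path d)}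
    (hA : MeasurableSet A) : ν A = ∑' h, ν (A ∩ past n ⁻¹' {h}) := by
  have : A = ⋃ h, A ∩ past n ⁻¹' {h} := by
    ext x; simp
  conv_lhs => rw [this]
  refine measure_iUnion (fun h h' hh => ?_)
    fun h => hA.inter (measurable_past n (measurableSet_singleton h))
  refine Set.disjoint_left.mpr ?_
  rintro x ⟨_, hx⟩ ⟨_, hx'⟩
  exact hh (hx.symm.trans hx')

/-- Finite measures on path space are determined by the long cylinders. -/
theorem ext_of_cyl {d : ℕ} {ν₁ ν₂ : Measure (Path d)} [IsFiniteMeasure ν₁] (N : ℕ)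
    (h : ∀ n, N ≤ n → ∀ a, ν₁ (cyl n a) = ν₂ (cyl n a)) : ν₁ = ν₂ := by
  have key : ∀ n, N ≤ n → ∀ S : Set ((i : Finset.Iic n) → Site d),
      ν₁ (past n ⁻¹' S) = ν₂ (past n ⁻¹' S) := by
    intro n hn S
    have mS : MeasurableSet (past n ⁻¹' S) := measurable_past n (.of_discrete (s := S))
    rw [measure_eq_tsum_past ν₁ n mS, measure_eq_tsum_past ν₂ n mS]
    refine tsum_congr fun h' => ?_
    by_cases hS : h' ∈ S
    · have : past n ⁻¹' S ∩ past n ⁻¹' {h'} = cyl n (extend n h') := by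
        rw [← Set.preimage_inter, Set.inter_eq_right.mpr (by simpa using hS),
          past_preimage_singleton]
      rw [this, h n hn]
    · have : past n ⁻¹' S ∩ past n ⁻¹' {h'} = ∅ := by
        rw [← Set.preimage_inter, Set.inter_singleton_eq_empty.mpr hS, Set.preimage_empty]
      rw [this]; simp
  refine ext_of_generate_finite _ (generateFrom_measurableCylinders (α := fun _ : ℕ => Site d)).symm
    isPiSystem_measurableCylinders (fun t ht => ?_) (key N le_rfl Set.univ)
  obtain ⟨n, S, mS, rfl⟩ : ∃ n S, MeasurableSet S ∧ t = cylinder (Finset.Iic n) S := by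
    simpa [measurableCylinders_nat] using ht
  have : (cylinder (Finset.Iic n) S : Set (Path d)) = past (max n N) ⁻¹'
      ((Preorder.frestrictLe₂ (π := fun _ => Site d) (le_max_left n N)) ⁻¹' S) := by
    rfl
  rw [this]
  exact key _ (le_max_right _ _) _

/-- The transition probability as an extended nonnegative real. -/
noncomputable def jump {d : ℕ} (ω : Env d) (x y : Site d) : ℝ≥0∞ :=
  ENNReal.ofReal (transProb ω x y)

theorem stepLaw_singleton {d : ℕ} (ω : Env d) (x y : Site d) : stepLaw ω x {y} = jump ω x y := by
  rw [stepLaw, Measure.sum_apply _ (measurableSet_singleton y), tsum_eq_single y]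
  · simp [jump]
  · intro b hb
    simp [hb]

/-- The probability of the first `n` steps of the path `a` in the environment `ω`. -/
noncomputable def pathWeight {d : ℕ} (ω : Env d) (n : ℕ) (a : Path d) : ℝ≥0∞ :=
  ∏ i ∈ Finset.range n, jump ω (a i) (a (i + 1))

theorem quenched_cyl_eq_partialTraj {d : ℕ} (z : Site d) (ω : Env d) (n : ℕ) (a : Path d) :
    quenched z ω (cyl n a) = Kernel.partialTraj (X := fun _ => Site d) (nextKernel ω) 0 n
      (fun _ => z) {past n a} := by
  rw [← Kernel.traj_map_frestrictLe_apply, Measure.map_apply (Preorder.measurable_frestrictLe n)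
    (measurableSet_singleton _), ← past_preimage_singleton_past]
  rfl

theorem quenched_cyl_succ {d : ℕ} (z : Site d) (ω : Env d) (n : ℕ) (a : Path d) :
    quenched z ω (cyl (n + 1) a) = quenched z ω (cyl n a) * jump ω (a n) (a (n + 1)) := by
  rw [quenched_cyl_eq_partialTraj, quenched_cyl_eq_partialTraj,
    Kernel.partialTraj_succ_eq_comp (X := fun _ => Site d) (Nat.zero_le n),
    Kernel.comp_apply' _ _ _ (measurableSet_singleton _), lintegral_countable']
  have hη := Kernel.IsMarkovKernel.map (nextKernel ω n)
      (MeasurableEquiv.piSingleton (X := fun _ => Site d) n).measurable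
  have key (h : (i : Finset.Iic n) → Site d) (s) :
      Kernel.partialTraj (X := fun _ => Site d) (nextKernel ω) n (n + 1) h s
        = stepLaw ω (h ⟨n, Finset.mem_Iic.mpr le_rfl⟩)
          (MeasurableEquiv.piSingleton (X := fun _ => Site d) n ⁻¹'
            (Prod.mk h ⁻¹' (IicProdIoc (X := fun _ => Site d) n (n + 1) ⁻¹' s))) := by
    rw [Kernel.partialTraj_succ_self,
      Kernel.map_apply' _ (by fun_prop) _ .of_discrete,
      Kernel.id_prod_apply' _ _ .of_discrete,
      Kernel.map_apply' _ (MeasurableEquiv.measurable _) _ .of_discrete]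
    rfl
  have mem (h : (i : Finset.Iic n) → Site d) (y : Site d) :
      y ∈ (MeasurableEquiv.piSingleton (X := fun _ => Site d) n ⁻¹'
            (Prod.mk h ⁻¹' (IicProdIoc (X := fun _ => Site d) n (n + 1) ⁻¹' {past (n + 1) a}))) ↔
      h = past n a ∧ y = a (n + 1) := by
    simp only [Set.mem_preimage, Set.mem_singleton_iff]
    constructor
    · intro e
      constructor
      · funext ⟨i, hi⟩
        have hi' := Finset.mem_Iic.mp hi
        have := congrFun e ⟨i, Finset.mem_Iic.mpr (by omega)⟩
        simpa [IicProdIoc, hi', past] using this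
      · have := congrFun e ⟨n + 1, Finset.mem_Iic.mpr le_rfl⟩
        simpa [IicProdIoc, past, MeasurableEquiv.piSingleton] using this
    · rintro ⟨rfl, rfl⟩
      funext ⟨i, hi⟩
      have hi' := Finset.mem_Iic.mp hi
      by_cases h' : i ≤ n
      · simp [IicProdIoc, h', past]
      · obtain rfl : i = n + 1 := by omega
        simp [IicProdIoc, past, MeasurableEquiv.piSingleton]
  rw [tsum_eq_single (past n a)]
  · rw [key, mul_comm]
    congr 1
    have : (MeasurableEquiv.piSingleton (X := fun _ => Site d) n ⁻¹'
            (Prod.mk (past n a) ⁻¹' (IicProdIoc (X := fun _ => Site d) n (n + 1) ⁻¹'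
              {past (n + 1) a}))) = {a (n + 1)} := by
      ext y; rw [mem]; simp
    rw [this, stepLaw_singleton]
    rfl
  · intro h hh
    rw [key]
    have : (MeasurableEquiv.piSingleton (X := fun _ => Site d) n ⁻¹'
            (Prod.mk h ⁻¹' (IicProdIoc (X := fun _ => Site d) n (n + 1) ⁻¹'
              {past (n + 1) a}))) = ∅ := by
      ext y; rw [mem]; simp [hh]
    rw [this]; simp

open Classical in
theorem quenched_cyl {d : ℕ} (z : Site d) (ω : Env d) (n : ℕ) (a : Path d) :
    quenched z ω (cyl n a) = if a 0 = z then pathWeight ω n a else 0 := by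
  induction n with
  | zero =>
    rw [quenched_cyl_eq_partialTraj, Kernel.partialTraj_self, Kernel.id_apply,
      Measure.dirac_apply' _ (measurableSet_singleton _)]
    have : ((fun _ => z : (i : Finset.Iic 0) → Site d) ∈ ({past 0 a} : Set _)) ↔ a 0 = z := by
      constructor
      · intro h
        exact (congrFun h ⟨0, by simp⟩).symm
      · rintro rfl
        funext ⟨i, hi⟩
        obtain rfl : i = 0 := by simpa using hi
        rfl
    by_cases h : a 0 = z
    · rw [Set.indicator_of_mem (this.mpr h)]; simp [h, pathWeight]
    · rw [Set.indicator_of_notMem (fun h' => h (this.mp h'))]; simp [h]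
  | succ n ih =>
    rw [quenched_cyl_succ, ih, pathWeight, pathWeight, Finset.prod_range_succ]
    split_ifs <;> simp

/-- The path that starts at `z` and continues with `x`. -/
def cons {d : ℕ} (z : Site d) (x : Path d) : Path d
  | 0 => z
  | n + 1 => x n

theorem measurable_cons {d : ℕ} (z : Site d) : Measurable (cons z) :=
  measurable_pi_lambda _ fun
    | 0 => measurable_const
    | n + 1 => measurable_pi_apply n

/-- First-step decomposition of the quenched measure, if the jumps at `z` lie in `B`. -/
theorem quenched_first_step {d : ℕ} (z : Site d) (ω : Env d) (B : Finset (Site d))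
    (hB : ∀ y, y ∉ B → (ω z).1 y = 0) :
    quenched z ω = ∑ y ∈ B, ENNReal.ofReal ((ω z).1 y) •
      (quenched (z + y) ω).map (cons z) := by
  classical
  -- Only cylinders of length at least 1 are tested, so that each of them prescribes the first step.
  refine ext_of_cyl 1 fun n hn a => ?_
  obtain ⟨n, rfl⟩ : ∃ k, n = k + 1 := ⟨n - 1, by omega⟩
  rw [quenched_cyl, Measure.finsetSum_apply]
  have hpre : ∀ y, ((quenched (z + y) ω).map (cons z)) (cyl (n + 1) a)
      = if a 0 = z ∧ a 1 = z + y then pathWeight ω n (fun i => a (i + 1)) else 0 := by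
    intro y
    rw [Measure.map_apply (measurable_cons z) (measurableSet_cyl _ _)]
    by_cases h0 : a 0 = z
    · have : cons z ⁻¹' cyl (n + 1) a = cyl n (fun i => a (i + 1)) := by
        ext x
        simp only [cyl, Set.mem_preimage, Set.mem_ofPred_eq]
        constructor
        · intro h i hi
          exact h (i + 1) (by omega)
        · rintro h (_ | i) hi
          · exact h0.symm
          · exact h i (by omega)
      rw [this, quenched_cyl]
      simp [h0]
    · have : cons z ⁻¹' cyl (n + 1) a = ∅ := by
        ext x
        simp only [cyl, Set.mem_preimage, Set.mem_ofPred_eq, Set.mem_empty_iff_false, iff_false]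
        intro h
        exact h0 (h 0 (by omega)).symm
      rw [this]; simp [h0]
  simp only [Measure.smul_apply, hpre, smul_eq_mul]
  by_cases h0 : a 0 = z
  · simp only [h0, true_and, if_true]
    have hw : pathWeight ω (n + 1) a = jump ω z (a 1) * pathWeight ω n (fun i => a (i + 1)) := by
      rw [pathWeight, Finset.prod_range_succ', mul_comm, h0]; rfl
    rw [hw]
    by_cases h1 : a 1 - z ∈ B
    · rw [Finset.sum_eq_single_of_mem _ h1]
      · simp [jump, transProb]
      · intro y _ hy
        rw [if_neg, mul_zero]
        rintro h
        exact hy (by rw [h]; abel)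
    · rw [Finset.sum_eq_zero]
      · simp [jump, transProb, hB _ h1]
      · intro y hy
        rw [if_neg, mul_zero]
        rintro h
        apply h1
        rw [h]; simpa using hy
  · simp [h0]

end RWRE

namespace RWRE

/-! ### Independence and stationarity of the environment -/

/-- The jump law that stays put. -/
noncomputable def stayLaw (d : ℕ) : JumpLaw d := by
  classical
  exact ⟨fun z => if z = 0 then 1 else 0, fun z => by dsimp only; split_ifs <;> norm_num, hasSum_ite_eq 0 1⟩

instance {d : ℕ} (μ : Measure (JumpLaw d)) [IsProbabilityMeasure μ] :
    IsProbabilityMeasure (iidEnv μ) :=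
  inferInstanceAs (IsProbabilityMeasure (Measure.infinitePi fun _ : Site d => μ))

/-- Overwriting the coordinates outside `S` by a fixed jump law does not change `f`, and what
results is visibly a function of the coordinates in `S`. -/
theorem measurable_of_dependsOn {d : ℕ} {f : Env d → ℝ≥0∞} {S : Set (Site d)} (hf : Measurable f)
    (hS : DependsOn f S) :
    Measurable[⨆ x ∈ S, MeasurableSpace.comap (fun ω : Env d => ω x) inferInstance] f := by
  classical
  have : f = f ∘ fun ω x => if x ∈ S then ω x else stayLaw d := by
    funext ω
    exact hS fun x hx => by simp [hx]
  rw [this]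
  refine hf.comp ?_
  refine @measurable_pi_lambda _ _ _ (_) _ _ fun x => ?_
  by_cases hx : x ∈ S
  · simp only [hx, if_true]
    refine Measurable.mono ?_ (le_iSup₂ (f := fun x (_ : x ∈ S) =>
      MeasurableSpace.comap (fun ω : Env d => ω x) inferInstance) x hx) le_rfl
    exact comap_measurable _
  · simp only [hx, if_false]
    exact @measurable_const _ _ _ (_) _

theorem lintegral_mul_of_dependsOn {d : ℕ} (μ : Measure (JumpLaw d)) [IsProbabilityMeasure μ]
    {f g : Env d → ℝ≥0∞} {S T : Set (Site d)} (hf : Measurable f) (hg : Measurable g)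
    (hS : DependsOn f S) (hT : DependsOn g T) (hST : Disjoint S T) :
    ∫⁻ ω, f ω * g ω ∂(iidEnv μ) = (∫⁻ ω, f ω ∂(iidEnv μ)) * ∫⁻ ω, g ω ∂(iidEnv μ) := by
  have hle : ∀ x : Site d, MeasurableSpace.comap (fun ω : Env d => ω x) inferInstance
      ≤ (inferInstance : MeasurableSpace (Env d)) :=
    fun x => (measurable_pi_apply x).comap_le
  have hind : iIndepFun (fun (x : Site d) (ω : Env d) => ω x) (iidEnv μ) :=
    iIndepFun_infinitePi (P := fun _ : Site d => μ) (X := fun _ p => p) fun _ => measurable_id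
  exact lintegral_mul_eq_lintegral_mul_lintegral_of_independent_measurableSpace
    (iSup₂_le fun x _ => hle x) (iSup₂_le fun x _ => hle x)
    (indep_iSup_of_disjoint hle hind.iIndep hST)
    (measurable_of_dependsOn hf hS) (measurable_of_dependsOn hg hT)

theorem measurable_shift {d : ℕ} (z : Site d) : Measurable (shift z : Env d → Env d) :=
  measurable_pi_lambda _ fun x => measurable_pi_apply (x + z)

theorem measurePreserving_shift {d : ℕ} (μ : Measure (JumpLaw d)) [IsProbabilityMeasure μ]
    (z : Site d) : MeasurePreserving (shift z) (iidEnv μ) (iidEnv μ) :=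
  ⟨measurable_shift z,
    Measure.map_infinitePi_infinitePi_of_inj (P := fun _ : Site d => μ) (add_left_injective z)⟩

theorem jump_shift {d : ℕ} (z : Site d) (ω : Env d) (x y : Site d) :
    jump (shift z ω) x y = jump ω (x + z) (y + z) := by
  rw [jump, transProb_shift, jump]

theorem measurable_jump {d : ℕ} (x y : Site d) : Measurable fun ω : Env d => jump ω x y := by
  refine ENNReal.measurable_ofReal.comp ?_
  exact (measurable_pi_apply (y - x)).comp (measurable_subtype_coe.comp (measurable_pi_apply x))

theorem measurable_pathWeight {d : ℕ} (n : ℕ) (a : Path d) :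
    Measurable fun ω : Env d => pathWeight ω n a :=
  Finset.measurable_fun_prod _ fun i _ => measurable_jump (a i) (a (i + 1))

theorem dependsOn_pathWeight {d : ℕ} (n : ℕ) (a : Path d) :
    DependsOn (fun ω : Env d => pathWeight ω n a) {y | ∃ i < n, a i = y} := by
  intro ω ω' h
  refine Finset.prod_congr rfl fun i hi => ?_
  rw [jump, jump, transProb, transProb, h (a i) ⟨i, Finset.mem_range.mp hi, rfl⟩]

/-! ### The averaged law of the path -/

/-- The law of the path under the averaged measure. -/
noncomputable def annealed {d : ℕ} (μ : Measure (JumpLaw d)) [IsProbabilityMeasure μ] :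
    Measure (Path d) := (averaged (iidEnv μ) 0).snd

instance {d : ℕ} (P : Measure (Env d)) [IsProbabilityMeasure P] (z : Site d) :
    IsProbabilityMeasure (averaged P z) :=
  inferInstanceAs (IsProbabilityMeasure (P ⊗ₘ quenchedKernel z))

instance {d : ℕ} (μ : Measure (JumpLaw d)) [IsProbabilityMeasure μ] :
    IsProbabilityMeasure (annealed μ) :=
  inferInstanceAs (IsProbabilityMeasure (averaged (iidEnv μ) 0).snd)

variable {d : ℕ} (μ : Measure (JumpLaw d)) [IsProbabilityMeasure μ]

theorem annealed_apply {s : Set (Path d)} (hs : MeasurableSet s) :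
    annealed μ s = ∫⁻ ω, quenched 0 ω s ∂(iidEnv μ) := by
  rw [annealed, averaged, Measure.snd_compProd, Measure.bind_apply hs
    (Kernel.aemeasurable _)]
  rfl

open Classical in
theorem annealed_cyl (n : ℕ) (a : Path d) : annealed μ (cyl n a)
    = if a 0 = 0 then ∫⁻ ω, pathWeight ω n a ∂(iidEnv μ) else 0 := by
  rw [annealed_apply μ (measurableSet_cyl n a)]
  simp only [quenched_cyl]
  split_ifs <;> simp

/-- The path after time `k`, seen from its position at time `k`. -/
def future {d : ℕ} (k : ℕ) (x : Path d) : Path d := fun j => x (k + j) - x k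

theorem measurable_future (k : ℕ) : Measurable (future (d := d) k) :=
  measurable_pi_lambda _ fun j => (measurable_pi_apply (k + j)).sub (measurable_pi_apply k)

/-- Independence of the steps before and after a time at which the walk enters new territory,
for cylinders. -/
theorem annealed_cyl_inter_future_cyl (u : Site d) (k l : ℕ) (a b : Path d)
    (ha : ∀ i < k, a i ⬝ᵥ u < a k ⬝ᵥ u) (hb : ∀ i ≤ l, 0 ≤ b i ⬝ᵥ u) :
    annealed μ (cyl k a ∩ future k ⁻¹' cyl l b)
      = annealed μ (cyl k a) * annealed μ (cyl l b) := by
  classical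
  by_cases ha0 : a 0 = 0; swap
  · have : annealed μ (cyl k a) = 0 := by rw [annealed_cyl, if_neg ha0]
    rw [this, zero_mul]
    exact measure_mono_null Set.inter_subset_left this
  by_cases hb0 : b 0 = 0; swap
  · have : annealed μ (cyl l b) = 0 := by rw [annealed_cyl, if_neg hb0]
    rw [this, mul_zero]
    convert measure_empty (μ := annealed μ)
    ext x
    simp only [Set.mem_inter_iff, Set.mem_preimage, cyl, Set.mem_ofPred_eq,
      Set.mem_empty_iff_false, iff_false, not_and]
    intro _ h
    apply hb0
    rw [← h 0 (Nat.zero_le _)]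
    simp [future]
  -- The concatenation of `a` up to time `k` with `b` translated to start at `a k`; the event is
  -- exactly its cylinder.
  set c : Path d := fun i => if i ≤ k then a i else a k + b (i - k) with hc
  have hck : ∀ j, c (k + j) = a k + b j := by
    intro j
    rcases Nat.eq_zero_or_pos j with rfl | hj
    · simp [hc, hb0]
    · simp only [hc]
      rw [if_neg (by omega), Nat.add_sub_cancel_left]
  have hci : ∀ i ≤ k, c i = a i := fun i hi => by simp [hc, hi]
  have hset : cyl k a ∩ future k ⁻¹' cyl l b = cyl (k + l) c := by
    ext x
    simp only [Set.mem_inter_iff, Set.mem_preimage, cyl, Set.mem_ofPred_eq]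
    constructor
    · rintro ⟨h1, h2⟩ i hi
      by_cases h : i ≤ k
      · rw [h1 i h, hci i h]
      · obtain ⟨j, rfl⟩ : ∃ j, i = k + j := ⟨i - k, by omega⟩
        rw [hck, ← h2 j (by omega), ← h1 k le_rfl, future]
        abel
    · intro h
      have h1 : ∀ i ≤ k, x i = a i := fun i hi => by rw [h i (by omega), hci i hi]
      refine ⟨h1, fun j hj => ?_⟩
      rw [future, h1 k le_rfl, h (k + j) (by omega), hck]
      abel
  have hw : ∀ ω : Env d, pathWeight ω (k + l) c
      = pathWeight ω k a * pathWeight (shift (a k) ω) l b := by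
    intro ω
    rw [pathWeight, Finset.prod_range_add]
    congr 1
    · refine Finset.prod_congr rfl fun i hi => ?_
      have := Finset.mem_range.mp hi
      rw [hci i (by omega), hci (i + 1) (by omega)]
    · refine Finset.prod_congr rfl fun i hi => ?_
      rw [jump_shift, hck, add_assoc, hck, add_comm (b i), add_comm (b (i + 1))]
  have hc0 : c 0 = 0 := by rw [hci 0 (Nat.zero_le _), ha0]
  rw [hset, annealed_cyl, annealed_cyl, annealed_cyl, if_pos hc0, if_pos ha0, if_pos hb0]
  simp only [hw]
  -- The first `k` steps read the environment at `a 0, …, a (k - 1)`, all strictly below the level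
  -- of `a k`; the later steps read it at or above that level. The site `a k` itself belongs to the
  -- second group.
  refine (lintegral_mul_of_dependsOn μ (measurable_pathWeight k a)
    ((measurable_pathWeight l b).comp (measurable_shift (a k)))
    (S := {y | y ⬝ᵥ u < a k ⬝ᵥ u}) (T := {y | a k ⬝ᵥ u ≤ y ⬝ᵥ u}) ?_ ?_ ?_).trans ?_
  rotate_right
  · congr 1
    exact (measurePreserving_shift μ (a k)).lintegral_comp (measurable_pathWeight l b)
  · refine (dependsOn_pathWeight k a).mono ?_
    rintro y ⟨i, hi, rfl⟩
    exact ha i hi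
  · intro ω ω' h
    refine dependsOn_pathWeight l b ?_
    rintro y ⟨i, hi, rfl⟩
    refine h (b i + a k) ?_
    have := hb i hi.le
    simp only [Set.mem_ofPred_eq, add_dotProduct]
    linarith
  · refine Set.disjoint_left.mpr fun y h1 h2 => ?_
    simp only [Set.mem_ofPred_eq] at h1 h2
    linarith

/-- The paths that stay in `G` up to time `n`. -/
def stayUpTo {d : ℕ} (G : Set (Site d)) (n : ℕ) : Set (Path d) := {x | ∀ i ≤ n, x i ∈ G}

/-- The paths that stay in `G` forever. -/
def stay {d : ℕ} (G : Set (Site d)) : Set (Path d) := {x | ∀ i, x i ∈ G}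

theorem measurableSet_stayUpTo (G : Set (Site d)) (n : ℕ) : MeasurableSet (stayUpTo G n) := by
  have : stayUpTo G n = ⋂ i, ⋂ _ : i ≤ n, (fun x : Path d => x i) ⁻¹' G := by
    ext x; simp [stayUpTo]
  rw [this]
  exact MeasurableSet.iInter fun i => MeasurableSet.iInter fun _ =>
    measurable_pi_apply i (.of_discrete (s := G))

theorem measurableSet_stay (G : Set (Site d)) : MeasurableSet (stay G) := by
  have : stay G = ⋂ i, (fun x : Path d => x i) ⁻¹' G := by
    ext x; simp [stay]
  rw [this]
  exact MeasurableSet.iInter fun i => measurable_pi_apply i (.of_discrete (s := G))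

/-- Staying in `G` up to time `N` is a countable union of cylinders inside `G`, and staying forever
is the decreasing limit of these events. -/
theorem restrict_stay_ext {ν₁ ν₂ : Measure (Path d)} [IsFiniteMeasure ν₁] [IsFiniteMeasure ν₂]
    (G : Set (Site d))
    (h : ∀ n a, (∀ i ≤ n, a i ∈ G) → ν₁ (cyl n a) = ν₂ (cyl n a)) :
    ν₁.restrict (stay G) = ν₂.restrict (stay G) := by
  have h1 : ∀ n N a, n ≤ N → ν₁ (cyl n a ∩ stayUpTo G N) = ν₂ (cyl n a ∩ stayUpTo G N) := by
    intro n N a hn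
    have hm := (measurableSet_cyl n a).inter (measurableSet_stayUpTo G N)
    rw [measure_eq_tsum_past ν₁ N hm, measure_eq_tsum_past ν₂ N hm]
    refine tsum_congr fun g => ?_
    rw [past_preimage_singleton]
    by_cases hg : extend N g ∈ cyl n a ∩ stayUpTo G N
    · have : cyl n a ∩ stayUpTo G N ∩ cyl N (extend N g) = cyl N (extend N g) := by
        refine Set.inter_eq_right.mpr fun x hx => ⟨fun i hi => ?_, fun i hi => ?_⟩
        · rw [hx i (hi.trans hn)]; exact hg.1 i hi
        · rw [hx i hi]; exact hg.2 i hi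
      rw [this]
      exact h N _ hg.2
    · have : cyl n a ∩ stayUpTo G N ∩ cyl N (extend N g) = ∅ := by
        refine Set.eq_empty_of_forall_notMem fun x hx => hg ⟨fun i hi => ?_, fun i hi => ?_⟩
        · rw [← hx.2 i (hi.trans hn)]; exact hx.1.1 i hi
        · rw [← hx.2 i hi]; exact hx.1.2 i hi
      rw [this]; simp
  refine ext_of_cyl 0 fun n _ a => ?_
  rw [Measure.restrict_apply (measurableSet_cyl n a), Measure.restrict_apply (measurableSet_cyl n a)]
  have hset : cyl n a ∩ stay G = ⋂ N, cyl n a ∩ stayUpTo G (n + N) := by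
    ext x
    simp only [Set.mem_inter_iff, Set.mem_iInter, stay, stayUpTo, Set.mem_ofPred_eq]
    exact ⟨fun h N => ⟨h.1, fun i _ => h.2 i⟩, fun h => ⟨(h 0).1, fun i => (h i).2 i (by omega)⟩⟩
  have hanti : Antitone fun N => cyl n a ∩ stayUpTo G (n + N) := by
    intro N N' hN x hx
    exact ⟨hx.1, fun i hi => hx.2 i (by omega)⟩
  have lim : ∀ ν : Measure (Path d), IsFiniteMeasure ν →
      Tendsto (fun N => ν (cyl n a ∩ stayUpTo G (n + N))) atTop (𝓝 (ν (cyl n a ∩ stay G))) := by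
    intro ν _
    rw [hset]
    exact tendsto_measure_iInter_atTop (fun N => ((measurableSet_cyl n a).inter
      (measurableSet_stayUpTo G _)).nullMeasurableSet) hanti ⟨0, measure_ne_top _ _⟩
  refine tendsto_nhds_unique (lim ν₁ inferInstance) ?_
  simp only [fun N => h1 n (n + N) a (by omega)]
  exact lim ν₂ inferInstance

/-- The half-space of sites at level at least `c` in direction `u`. -/
def halfSpace {d : ℕ} (u : Site d) (c : ℤ) : Set (Site d) := {y | c ≤ y ⬝ᵥ u}

/-- `k` is a time at which the path reaches a new maximal level in direction `u`. -/
def IsRecord {d : ℕ} (u : Site d) (k : ℕ) (x : Path d) : Prop := ∀ n < k, x n ⬝ᵥ u < x k ⬝ᵥ u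

/-- At a record time the past is independent of the future that does not backtrack. -/
theorem annealed_inter_future (u : Site d) (k : ℕ) {A B : Set (Path d)} (hA : MeasurableSet A)
    (hB : MeasurableSet B) (hAk : ∀ x y : Path d, (∀ i ≤ k, x i = y i) → x ∈ A → y ∈ A)
    (hrec : ∀ x ∈ A, IsRecord u k x) (hstay : B ⊆ stay (halfSpace u 0)) :
    annealed μ (A ∩ future k ⁻¹' B) = annealed μ A * annealed μ B := by
  have hmB := measurable_future k hB
  rw [measure_eq_tsum_past _ k (hA.inter hmB), measure_eq_tsum_past _ k hA, ← ENNReal.tsum_mul_right]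
  refine tsum_congr fun h => ?_
  rw [past_preimage_singleton]
  set a := extend k h
  by_cases ha : a ∈ A
  · have h1 : cyl k a ⊆ A := fun x hx => hAk a x (fun i hi => (hx i hi).symm) ha
    rw [Set.inter_eq_right.mpr h1]
    have h2 : A ∩ future k ⁻¹' B ∩ cyl k a = future k ⁻¹' B ∩ cyl k a := by
      ext x
      exact ⟨fun hx => ⟨hx.1.2, hx.2⟩, fun hx => ⟨⟨h1 hx.2, hx.1⟩, hx.2⟩⟩
    rw [h2]
    -- Given the history `a`, the future and a fresh walk agree on cylinders inside the half-space,
    -- hence on every event that stays there.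
    have key : (((annealed μ).restrict (cyl k a)).map (future k)).restrict (stay (halfSpace u 0))
        = (annealed μ (cyl k a) • annealed μ).restrict (stay (halfSpace u 0)) := by
      have : IsFiniteMeasure (annealed μ (cyl k a) • annealed μ) :=
        Measure.smul_finite _ (measure_ne_top _ _)
      refine restrict_stay_ext _ fun n b hb => ?_
      rw [Measure.map_apply (measurable_future k) (measurableSet_cyl n b),
        Measure.restrict_apply (measurable_future k (measurableSet_cyl n b)), Set.inter_comm,
        annealed_cyl_inter_future_cyl μ u k n a b (hrec a ha) hb]
      rfl
    have := congrArg (fun ν => ν B) key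
    simp only [Measure.restrict_apply hB, Set.inter_eq_left.mpr hstay,
      Measure.map_apply (measurable_future k) hB, Measure.restrict_apply hmB] at this
    rw [this]; rfl
  · have h1 : A ∩ cyl k a = ∅ :=
      Set.eq_empty_of_forall_notMem fun x hx => ha (hAk x a hx.2 hx.1)
    have h2 : A ∩ future k ⁻¹' B ∩ cyl k a = ∅ :=
      Set.eq_empty_of_forall_notMem fun x hx => ha (hAk x a hx.2 hx.1.1)
    rw [h1, h2]; simp

end RWRE

namespace RWRE

variable {d : ℕ} (μ : Measure (JumpLaw d)) [IsProbabilityMeasure μ]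

/-! ### Regeneration times -/

theorem measurable_level (u : Site d) (n : ℕ) : Measurable fun x : Path d => x n ⬝ᵥ u :=
  (measurable_of_countable fun y : Site d => y ⬝ᵥ u).comp (measurable_pi_apply n)

theorem measurableSet_isRecord (u : Site d) (k : ℕ) : MeasurableSet {x : Path d | IsRecord u k x} := by
  simp only [IsRecord, Set.ofPred_forall]
  exact MeasurableSet.iInter fun n => MeasurableSet.iInter fun _ =>
    measurableSet_lt (measurable_level u n) (measurable_level u k)

theorem measurableSet_isRegeneration (u : Site d) (k : ℕ) :
    MeasurableSet {x : Path d | IsRegeneration u x k} := by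
  have : {x : Path d | IsRegeneration u x k} = {x : Path d | IsRecord u k x} ∩
      {x | ∀ n, k ≤ n → x k ⬝ᵥ u ≤ x n ⬝ᵥ u} := rfl
  rw [this]
  refine (measurableSet_isRecord u k).inter ?_
  simp only [Set.ofPred_forall]
  exact MeasurableSet.iInter fun n => MeasurableSet.iInter fun _ =>
    measurableSet_le (measurable_level u k) (measurable_level u n)

/-- The paths without a regeneration time in `(a, b]`. -/
def noRegen {d : ℕ} (u : Site d) (a b : ℕ) : Set (Path d) :=
  {x | ∀ k, a < k → k ≤ b → ¬ IsRegeneration u x k}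

theorem measurableSet_noRegen (u : Site d) (a b : ℕ) : MeasurableSet (noRegen u a b) := by
  simp only [noRegen, Set.ofPred_forall]
  exact MeasurableSet.iInter fun n => MeasurableSet.iInter fun _ => MeasurableSet.iInter fun _ =>
    (measurableSet_isRegeneration u n).compl

theorem future_level (u : Site d) (x : Path d) (k j : ℕ) :
    future k x j ⬝ᵥ u = x (k + j) ⬝ᵥ u - x k ⬝ᵥ u := by
  rw [future, sub_dotProduct]

theorem isRegeneration_iff (u : Site d) (x : Path d) (k : ℕ) :
    IsRegeneration u x k ↔ IsRecord u k x ∧ future k x ∈ stay (halfSpace u 0) := by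
  simp only [IsRegeneration, IsRecord, stay, halfSpace, Set.mem_ofPred_eq, future_level,
    sub_nonneg]
  refine and_congr_right fun _ => ⟨fun h i => h _ (by omega), fun h n hn => ?_⟩
  have := h (n - k)
  rwa [Nat.add_sub_cancel' hn] at this

/-- A regeneration of the future at `j ≥ 1` lies strictly above the level at time `k`, which by the
record property exceeds all earlier levels. For `j = 0` it would only say that the future does not
backtrack. -/
theorem IsRegeneration.future {u : Site d} {x : Path d} {k j : ℕ} (hk : IsRecord u k x)
    (hj : 1 ≤ j)
    (h : IsRegeneration u (future k x) j) : IsRegeneration u x (k + j) := by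
  have h0 : x k ⬝ᵥ u < x (k + j) ⬝ᵥ u := by
    have := h.1 0 (by omega)
    simp only [future_level, Nat.add_zero] at this
    linarith
  constructor
  · intro n hn
    rcases lt_or_ge n k with h1 | h1
    · exact (hk n h1).trans h0
    · obtain ⟨i, rfl⟩ : ∃ i, n = k + i := ⟨n - k, by omega⟩
      have := h.1 i (by omega)
      simp only [future_level] at this
      linarith
  · intro n hn
    obtain ⟨i, rfl⟩ : ∃ i, n = k + i := ⟨n - k, by omega⟩
    have := h.2 i (by omega)
    simp only [future_level] at this
    linarith

/-- The tail `P_0(τ_1 > r)` of the first regeneration time. -/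
noncomputable def regenTail {d : ℕ} (μ : Measure (JumpLaw d)) [IsProbabilityMeasure μ]
    (u : Site d) (r : ℕ) : ℝ≥0∞ := annealed μ (noRegen u 0 r)

/-- The integrated tail of the first regeneration time. -/
noncomputable def regenTailSum {d : ℕ} (μ : Measure (JumpLaw d)) [IsProbabilityMeasure μ]
    (u : Site d) (s : ℕ) : ℝ≥0∞ := ∑' j, regenTail μ u (s + j)

theorem regenTail_le_regenTailSum (u : Site d) (s : ℕ) : regenTail μ u s ≤ regenTailSum μ u s :=
  ENNReal.le_tsum (f := fun j => regenTail μ u (s + j)) 0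

/-- At a regeneration the future does not backtrack, and its own regenerations are regenerations of
the whole path. Independence at the record time then leaves a fresh walk without regeneration up to
time `t`. -/
theorem annealed_isRegeneration_inter_noRegen_le (u : Site d) (k t : ℕ) :
    annealed μ ({x | IsRegeneration u x k} ∩ noRegen u k (k + t)) ≤ regenTail μ u t := by
  have hm := (measurableSet_stay (halfSpace u 0)).inter (measurableSet_noRegen (d := d) u 0 t)
  calc annealed μ ({x | IsRegeneration u x k} ∩ noRegen u k (k + t))
      ≤ annealed μ ({x | IsRecord u k x} ∩
          future k ⁻¹' (stay (halfSpace u 0) ∩ noRegen u 0 t)) := by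
        refine measure_mono ?_
        rintro x ⟨h1, h2⟩
        have h3 := (isRegeneration_iff u x k).mp h1
        refine ⟨h3.1, h3.2, fun j hj hjt hreg => ?_⟩
        exact h2 (k + j) (by omega) (by omega) (IsRegeneration.future h3.1 hj hreg)
    _ = annealed μ {x | IsRecord u k x} * annealed μ (stay (halfSpace u 0) ∩ noRegen u 0 t) := by
        refine annealed_inter_future μ u k (measurableSet_isRecord u k) hm ?_ (fun x hx => hx)
          Set.inter_subset_left
        intro x y hxy hx n hn
        rw [← hxy n hn.le, ← hxy k le_rfl]
        exact hx n hn
    _ ≤ 1 * annealed μ (noRegen u 0 t) :=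
        mul_le_mul' prob_le_one (measure_mono Set.inter_subset_right)
    _ = regenTail μ u t := one_mul _

/-- The probability that a time window of length `s` contains no regeneration time. -/
theorem annealed_noRegen_le (u : Site d) (a s : ℕ) :
    annealed μ (noRegen u a (a + s)) ≤ regenTailSum μ u s := by
  -- Split according to the last regeneration `a - j` in `[1, a]`: after it a stretch of length `s +
  -- j` is empty. The last set covers paths with no regeneration in `[1, a]`; it supplies the term
  -- `j = a` of the integrated tail.
  have hsub : noRegen u a (a + s) ⊆ (⋃ j ∈ Finset.range a,
      ({x : Path d | IsRegeneration u x (a - j)} ∩ noRegen u (a - j) (a - j + (s + j)))) ∪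
        noRegen u 0 (s + a) := by
    intro x hx
    by_cases h : ∃ k, (1 ≤ k ∧ k ≤ a) ∧ IsRegeneration u x k
    · left
      classical
      set k := Nat.findGreatest (fun k => 1 ≤ k ∧ IsRegeneration u x k) a with hk
      obtain ⟨k₀, ⟨hk1, hka⟩, hk0⟩ := h
      have hspec : 1 ≤ k ∧ IsRegeneration u x k :=
        Nat.findGreatest_spec (P := fun k => 1 ≤ k ∧ IsRegeneration u x k) hka ⟨hk1, hk0⟩
      have hle : k ≤ a := Nat.findGreatest_le a
      simp only [Set.mem_iUnion, Finset.mem_range]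
      refine ⟨a - k, by omega, ?_⟩
      rw [Nat.sub_sub_self hle]
      refine ⟨hspec.2, fun i hi hi' hreg => ?_⟩
      rcases le_or_gt i a with h1 | h1
      · exact Nat.findGreatest_is_greatest (P := fun k => 1 ≤ k ∧ IsRegeneration u x k) hi h1
          ⟨by omega, hreg⟩
      · exact hx i h1 (by omega) hreg
    · right
      intro k hk hk' hreg
      rcases le_or_gt k a with h1 | h1
      · exact h ⟨k, ⟨hk, h1⟩, hreg⟩
      · exact hx k h1 (by omega) hreg
  calc annealed μ (noRegen u a (a + s))
      ≤ ∑ j ∈ Finset.range a, regenTail μ u (s + j) + regenTail μ u (s + a) := by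
        refine (measure_mono hsub).trans ((measure_union_le _ _).trans (add_le_add ?_ le_rfl))
        refine (measure_biUnion_finset_le _ _).trans (Finset.sum_le_sum fun j _ => ?_)
        exact annealed_isRegeneration_inter_noRegen_le μ u (a - j) (s + j)
    _ = ∑ j ∈ Finset.range (a + 1), regenTail μ u (s + j) := (Finset.sum_range_succ _ _).symm
    _ ≤ regenTailSum μ u s := ENNReal.sum_le_tsum _

theorem lt_tau_iff (u : Site d) (x : Path d) (r : ℕ) :
    (r : ℕ∞) < tau u x ↔ x ∈ noRegen u 0 r := by
  constructor
  · intro h k hk hkr hreg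
    have : tau u x ≤ k := iInf₂_le k ⟨hk, hreg⟩
    have h2 : ((r : ℕ) : ℕ∞) < k := h.trans_le this
    have := Nat.cast_lt.mp h2
    omega
  · intro h
    have : ((r + 1 : ℕ) : ℕ∞) ≤ tau u x := by
      refine le_iInf₂ fun k hk => ?_
      by_contra hlt
      have := Nat.cast_lt.mp (not_le.mp hlt)
      exact h k hk.1 (by omega) hk.2
    exact lt_of_lt_of_le (Nat.cast_lt.mpr (Nat.lt_succ_self r)) this

/-- The sum counts the integers in [s, τ_1), so it is at most τ_1 = τ_1^(1-p) τ_1^p, and it is zero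
unless τ_1 > s, in which case τ_1^(1-p) ≤ s^(1-p). -/
theorem tsum_indicator_noRegen_le (u : Site d) (x : Path d) {p : ℝ} (hp : 1 < p) {s : ℕ}
    (hs : 1 ≤ s) :
    ∑' j, (noRegen u 0 (s + j)).indicator 1 x
      ≤ (s : ℝ≥0∞) ^ (1 - p) * (tau u x : ℝ≥0∞) ^ p := by
  have hs0 : (s : ℝ≥0∞) ≠ 0 := by exact_mod_cast (by omega : s ≠ 0)
  have hst : (s : ℝ≥0∞) ≠ ⊤ := ENNReal.natCast_ne_top s
  have hmem : ∀ r, x ∈ noRegen u 0 r ↔ (r : ℕ∞) < tau u x := fun r => (lt_tau_iff u x r).symm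
  generalize tau u x = t at hmem
  induction t with
  | top =>
    have : (s : ℝ≥0∞) ^ (1 - p) ≠ 0 := by
      intro h
      rcases ENNReal.rpow_eq_zero_iff.mp h with h | h
      · exact hs0 h.1
      · exact hst h.1
    simp [ENNReal.top_rpow_of_pos (by linarith : 0 < p), ENNReal.mul_top this]
  | coe t =>
    have hind : ∀ j, (noRegen u 0 (s + j)).indicator (1 : Path d → ℝ≥0∞) x
        = if s + j < t then 1 else 0 := by
      intro j
      by_cases h : s + j < t
      · rw [if_pos h, Set.indicator_of_mem ((hmem _).mpr (by exact_mod_cast h))]; rfl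
      · rw [if_neg h, Set.indicator_of_notMem (fun h' => h (by exact_mod_cast (hmem _).mp h'))]
    simp only [hind]
    rw [tsum_eq_sum (s := Finset.range (t - s))
      (fun j hj => if_neg (by rw [Finset.mem_range] at hj; omega))]
    rcases le_or_gt t s with h | h
    · rw [Nat.sub_eq_zero_of_le h]; simp
    · have ht0 : (t : ℝ≥0∞) ≠ 0 := by exact_mod_cast (by omega : t ≠ 0)
      have htt : (t : ℝ≥0∞) ≠ ⊤ := ENNReal.natCast_ne_top t
      calc ∑ j ∈ Finset.range (t - s), (if s + j < t then (1 : ℝ≥0∞) else 0)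
          ≤ ∑ j ∈ Finset.range (t - s), (1 : ℝ≥0∞) :=
            Finset.sum_le_sum fun j _ => by split_ifs <;> simp
        _ = ((t - s : ℕ) : ℝ≥0∞) := by simp
        _ ≤ t := by exact_mod_cast Nat.sub_le t s
        _ = (t : ℝ≥0∞) ^ (1 - p) * (t : ℝ≥0∞) ^ p := by
            rw [← ENNReal.rpow_add _ _ ht0 htt, sub_add_cancel, ENNReal.rpow_one]
        _ ≤ (s : ℝ≥0∞) ^ (1 - p) * ((t : ℕ∞) : ℝ≥0∞) ^ p := by
            refine mul_le_mul' ?_ (by simp)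
            rw [show 1 - p = -(p - 1) by ring, ENNReal.rpow_neg, ENNReal.rpow_neg]
            refine ENNReal.inv_le_inv.mpr (ENNReal.rpow_le_rpow ?_ (by linarith))
            exact_mod_cast h.le

theorem regenTailSum_le {u : Site d} {p : ℝ} (hp : 1 < p)
    (hmom : RegenerationMoment (iidEnv μ) u p) :
    ∃ C : ℝ, 0 ≤ C ∧ ∀ s : ℕ, 1 ≤ s →
      regenTailSum μ u s ≤ ENNReal.ofReal (C * (s : ℝ) ^ (1 - p)) := by
  set M := ∫⁻ q, (tau u q.2 : ℝ≥0∞) ^ p ∂(averaged (iidEnv μ) 0) with hM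
  have hMt : M ≠ ⊤ := ne_of_lt hmom
  refine ⟨M.toReal, ENNReal.toReal_nonneg, fun s hs => ?_⟩
  have hs0 : (0 : ℝ) < s := by exact_mod_cast hs
  have hst : (s : ℝ≥0∞) ^ (1 - p) = ENNReal.ofReal ((s : ℝ) ^ (1 - p)) := by
    rw [← ENNReal.ofReal_rpow_of_pos hs0, ENNReal.ofReal_natCast]
  have hmeas : ∀ j, Measurable fun q : Env d × Path d =>
      (noRegen u 0 (s + j)).indicator (1 : Path d → ℝ≥0∞) q.2 := fun j =>
    (measurable_one.indicator (measurableSet_noRegen u 0 (s + j))).comp measurable_snd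
  calc regenTailSum μ u s
      = ∑' j, ∫⁻ q, (noRegen u 0 (s + j)).indicator 1 q.2 ∂(averaged (iidEnv μ) 0) := by
        refine tsum_congr fun j => ?_
        rw [regenTail, annealed, Measure.snd_apply (measurableSet_noRegen u 0 (s + j)),
          ← lintegral_indicator_one (measurable_snd (measurableSet_noRegen u 0 (s + j)))]
        rfl
    _ = ∫⁻ q, ∑' j, (noRegen u 0 (s + j)).indicator 1 q.2 ∂(averaged (iidEnv μ) 0) :=
        (lintegral_tsum fun j => (hmeas j).aemeasurable).symm
    _ ≤ ∫⁻ q, (s : ℝ≥0∞) ^ (1 - p) * (tau u q.2 : ℝ≥0∞) ^ p ∂(averaged (iidEnv μ) 0) :=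
        lintegral_mono fun q => tsum_indicator_noRegen_le u q.2 hp hs
    _ = (s : ℝ≥0∞) ^ (1 - p) * M := by
        rw [lintegral_const_mul' _ _ (by rw [hst]; exact ENNReal.ofReal_ne_top)]
    _ = ENNReal.ofReal (M.toReal * (s : ℝ) ^ (1 - p)) := by
        rw [hst, ENNReal.ofReal_mul ENNReal.toReal_nonneg, ENNReal.ofReal_toReal hMt, mul_comm]

/-! ### Bounded steps -/

/-- The sites whose coordinates are at most `R` in absolute value. -/
noncomputable def box (d R : ℕ) : Finset (Site d) := Finset.Icc (fun _ => -(R : ℤ)) fun _ => (R : ℤ)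

theorem mem_box {R : ℕ} {y : Site d} : y ∈ box d R ↔ ∀ i, |y i| ≤ R := by
  simp only [box, Finset.mem_Icc, Pi.le_def, abs_le, forall_and]

theorem zero_mem_box (R : ℕ) : (0 : Site d) ∈ box d R := mem_box.mpr fun i => by simp

theorem add_mem_box {R R' : ℕ} {y z : Site d} (hy : y ∈ box d R) (hz : z ∈ box d R') :
    y + z ∈ box d (R + R') := by
  rw [mem_box] at *
  intro i
  refine (abs_add_le (y i) (z i)).trans ?_
  push_cast
  exact add_le_add (hy i) (hz i)

theorem card_box (d R : ℕ) : (box d R).card = (2 * R + 1) ^ d := by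
  rw [box, Pi.card_Icc]
  simp only [Int.card_Icc, Finset.prod_const, Finset.card_univ, Fintype.card_fin]
  congr 1
  omega

theorem toE_sub (x y : Site d) : toE (x - y) = toE x - toE y := by
  ext i; simp [toE]

theorem toE_zero : toE (0 : Site d) = 0 := by
  ext i; simp [toE]

theorem norm_toE_le {R : ℕ} {y : Site d} (hy : y ∈ box d R) : ‖toE y‖ ≤ d * R := by
  rw [mem_box] at hy
  have h1 : ‖toE y‖ ^ 2 ≤ (d * R : ℝ) ^ 2 := by
    rw [EuclideanSpace.norm_sq_eq]
    calc ∑ i, ‖(toE y) i‖ ^ 2 ≤ ∑ _i : Fin d, (R : ℝ) ^ 2 := by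
          refine Finset.sum_le_sum fun i _ => ?_
          refine pow_le_pow_left₀ (norm_nonneg _) ?_ 2
          rw [Real.norm_eq_abs]
          simp only [toE]
          exact_mod_cast hy i
      _ = d * (R : ℝ) ^ 2 := by simp
      _ ≤ (d * R : ℝ) ^ 2 := by
          rw [mul_pow]
          refine mul_le_mul_of_nonneg_right ?_ (by positivity)
          have : (d : ℕ) ≤ d ^ 2 := Nat.le_self_pow (by norm_num) d
          exact_mod_cast this
  exact le_of_sq_le_sq h1 (by positivity)

/-- A bound for the change of level in direction `u` in one step of size at most `R`. -/
def levelBound {d : ℕ} (u : Site d) (R : ℕ) : ℕ := R * (∑ i, (u i).natAbs) + 1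

theorem abs_dotProduct_le (u : Site d) {R n : ℕ} {y : Site d} (hy : y ∈ box d (R * n)) :
    |y ⬝ᵥ u| ≤ levelBound u R * n := by
  rw [mem_box] at hy
  calc |y ⬝ᵥ u| ≤ ∑ i, |y i * u i| := Finset.abs_sum_le_sum_abs _ _
    _ ≤ ∑ i, ((R * n : ℕ) : ℤ) * |u i| := by
        refine Finset.sum_le_sum fun i _ => ?_
        rw [abs_mul]
        exact mul_le_mul_of_nonneg_right (hy i) (abs_nonneg _)
    _ = (R * ∑ i, |u i|) * n := by rw [← Finset.mul_sum]; push_cast; ring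
    _ ≤ levelBound u R * n := by
        refine mul_le_mul_of_nonneg_right ?_ (by positivity)
        simp [levelBound]

/-- All jumps of the environment lie in `box d R`. -/
def HasRange {d : ℕ} (R : ℕ) (ω : Env d) : Prop := ∀ x y, y ∉ box d R → (ω x).1 y = 0

/-- The hypothesis concerns the origin only; stationarity and countability extend it to all sites at
once. A site outside the box has a coordinate larger than the Euclidean bound. -/
theorem BoundedSteps.exists_hasRange (h : BoundedSteps (iidEnv μ)) :
    ∃ R : ℕ, ∀ᵐ ω ∂(iidEnv μ), HasRange R ω := by
  obtain ⟨M, hM, h⟩ := h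
  refine ⟨⌈M⌉₊, ?_⟩
  simp only [HasRange]
  rw [ae_all_iff]
  intro x
  rw [ae_all_iff]
  intro y
  by_cases hy : y ∈ box d ⌈M⌉₊
  · simp [hy]
  · have hn : M < ‖toE y‖ := by
      rw [mem_box] at hy
      push Not at hy
      obtain ⟨i, hi⟩ := hy
      have h1 : |(toE y) i| ≤ ‖toE y‖ := by
        rw [← Real.norm_eq_abs]; exact PiLp.norm_apply_le (toE y) i
      have h2 : ((⌈M⌉₊ : ℕ) : ℝ) < |(toE y) i| := by
        simp only [toE]
        exact_mod_cast hi
      exact (Nat.le_ceil M).trans_lt (h2.trans_le h1)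
    have := (measurePreserving_shift μ x).quasiMeasurePreserving.ae (h y hn)
    filter_upwards [this] with ω hω _
    simpa [transProb, shift] using hω

/-- The path starts at `z` and its steps lie in `box d R`. -/
def StepsIn {d : ℕ} (R : ℕ) (z : Site d) (x : Path d) : Prop :=
  x 0 = z ∧ ∀ n, x (n + 1) - x n ∈ box d R

theorem measurableSet_step (R n : ℕ) :
    MeasurableSet {x : Path d | x (n + 1) - x n ∈ box d R} := by
  have h : Measurable fun x : Path d => x (n + 1) - x n :=
    (measurable_pi_apply (n + 1)).sub (measurable_pi_apply n)
  exact MeasurableSet.preimage (MeasurableSet.of_discrete (s := (box d R : Set (Site d)))) h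

theorem measurableSet_stepsIn (R : ℕ) (z : Site d) : MeasurableSet {x : Path d | StepsIn R z x} := by
  have : {x : Path d | StepsIn R z x} = {x : Path d | x 0 = z} ∩
      ⋂ n, {x : Path d | x (n + 1) - x n ∈ box d R} := by
    ext x; simp [StepsIn]
  rw [this]
  refine (measurableSet_eq_fun (measurable_pi_apply 0) measurable_const).inter
    (MeasurableSet.iInter fun n => ?_)
  exact measurableSet_step R n

theorem quenched_stepsIn {R : ℕ} {ω : Env d} (hω : HasRange R ω) (z : Site d) :
    ∀ᵐ x ∂(quenched z ω), StepsIn R z x := by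
  classical
  have h : ∀ n, ∀ᵐ x ∂(quenched z ω), x 0 = z ∧ x (n + 1) - x n ∈ box d R := by
    intro n
    have hm : MeasurableSet {x : Path d | x 0 = z ∧ x (n + 1) - x n ∈ box d R}ᶜ := by
      refine ((measurableSet_eq_fun (measurable_pi_apply 0) measurable_const).inter ?_).compl
      exact measurableSet_step R n
    rw [ae_iff]
    change quenched z ω {x : Path d | x 0 = z ∧ x (n + 1) - x n ∈ box d R}ᶜ = 0
    rw [measure_eq_tsum_past _ (n + 1) hm, ENNReal.tsum_eq_zero]
    intro h
    rw [past_preimage_singleton]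
    set a := extend (n + 1) h
    by_cases ha : a 0 = z ∧ a (n + 1) - a n ∈ box d R
    · convert measure_empty (μ := quenched z ω)
      refine Set.eq_empty_of_forall_notMem fun x hx => hx.1 ?_
      change x 0 = z ∧ x (n + 1) - x n ∈ box d R
      rw [hx.2 0 (by omega), hx.2 (n + 1) le_rfl, hx.2 n (by omega)]
      exact ha
    · refine measure_mono_null Set.inter_subset_right ?_
      by_cases h0 : a 0 = z
      · rw [quenched_cyl_succ, jump, transProb, hω _ _ fun h' => ha ⟨h0, h'⟩]
        simp
      · rw [quenched_cyl, if_neg h0]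
  filter_upwards [ae_all_iff.mpr h] with x hx
  exact ⟨(hx 0).1, fun n => (hx n).2⟩

theorem annealed_stepsIn {R : ℕ} (hR : ∀ᵐ ω ∂(iidEnv μ), HasRange R ω) :
    ∀ᵐ x ∂(annealed μ), StepsIn R 0 x := by
  rw [ae_iff]
  change annealed μ {x : Path d | StepsIn R 0 x}ᶜ = 0
  rw [annealed_apply μ (measurableSet_stepsIn R 0).compl]
  refine lintegral_eq_zero_of_ae_eq_zero ?_
  filter_upwards [hR] with ω hω
  exact ae_iff.mp (quenched_stepsIn hω 0)

theorem StepsIn.sub_mem_box {R : ℕ} {z : Site d} {x : Path d} (hx : StepsIn R z x) (n k : ℕ) :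
    x (n + k) - x n ∈ box d (R * k) := by
  induction k with
  | zero => simpa using zero_mem_box _
  | succ k ih =>
    have := add_mem_box (hx.2 (n + k)) ih
    rw [show R * (k + 1) = R + R * k by ring]
    convert this using 1
    rw [← add_assoc]; abel

theorem StepsIn.norm_sub_le {R : ℕ} {z : Site d} {x : Path d} (hx : StepsIn R z x) (n k : ℕ) :
    ‖toE (x (n + k)) - toE (x n)‖ ≤ d * R * k := by
  rw [← toE_sub]
  refine (norm_toE_le (hx.sub_mem_box n k)).trans (le_of_eq ?_)
  push_cast; ring

theorem StepsIn.abs_level_sub_le (u : Site d) {R : ℕ} {z : Site d} {x : Path d}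
    (hx : StepsIn R z x) (n k : ℕ) :
    |x (n + k) ⬝ᵥ u - x n ⬝ᵥ u| ≤ levelBound u R * k := by
  rw [← sub_dotProduct]
  exact abs_dotProduct_le u (hx.sub_mem_box n k)

end RWRE

namespace RWRE

variable {d : ℕ} (μ : Measure (JumpLaw d)) [IsProbabilityMeasure μ]

/-! ### Approximate additivity of the averaged mean -/

theorem measurable_toE : Measurable (toE : Site d → EuclideanSpace ℝ (Fin d)) :=
  measurable_of_countable _

theorem measurable_toE_path (n : ℕ) : Measurable fun x : Path d => toE (x n) :=
  measurable_toE.comp (measurable_pi_apply n)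

theorem averagedMean_eq (n : ℕ) :
    averagedMean (iidEnv μ) n = ∫ x, toE (x n) ∂(annealed μ) := by
  rw [averagedMean, annealed, Measure.snd, integral_map measurable_snd.aemeasurable
    (measurable_toE_path n).aestronglyMeasurable]

theorem integrable_toE_path {R : ℕ} (hR : ∀ᵐ ω ∂(iidEnv μ), HasRange R ω) (n : ℕ) :
    Integrable (fun x : Path d => toE (x n)) (annealed μ) := by
  refine Integrable.of_bound (measurable_toE_path n).aestronglyMeasurable (d * R * n : ℝ) ?_
  filter_upwards [annealed_stepsIn μ hR] with x hx
  simpa [hx.1, toE_zero] using hx.norm_sub_le 0 n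

/-- The paths whose first regeneration time at or after time `n` is `l`. -/
def firstRegen {d : ℕ} (u : Site d) (n l : ℕ) : Set (Path d) :=
  {x | IsRegeneration u x l ∧ ∀ j, n ≤ j → j < l → ¬ IsRegeneration u x j}

/-- The part of the event `firstRegen u n l` that is determined by the path up to time `l`. -/
def firstRegenPast {d : ℕ} (u : Site d) (n l : ℕ) : Set (Path d) :=
  {x | IsRecord u l x ∧ ∀ j, n ≤ j → j < l →
    ¬ (IsRecord u j x ∧ ∀ i, j ≤ i → i ≤ l → x j ⬝ᵥ u ≤ x i ⬝ᵥ u)}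

theorem firstRegen_eq (u : Site d) (n l : ℕ) :
    firstRegen u n l = firstRegenPast u n l ∩ future l ⁻¹' stay (halfSpace u 0) := by
  ext x
  simp only [firstRegen, firstRegenPast, Set.mem_inter_iff, Set.mem_preimage, Set.mem_ofPred_eq,
    isRegeneration_iff u x l]
  constructor
  · rintro ⟨⟨h1, h2⟩, h3⟩
    refine ⟨⟨h1, fun j hj hjl hh => h3 j hj hjl ⟨hh.1, fun i hi => ?_⟩⟩, h2⟩
    rcases le_or_gt i l with h | h
    · exact hh.2 i hi h
    -- After the regeneration time `l` the path stays above its level at `l`, so whether an earlier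
    -- `j` is a regeneration is already decided at time `l`.
    · have := ((isRegeneration_iff u x l).mpr ⟨h1, h2⟩).2 i h.le
      exact (hh.2 l hjl.le le_rfl).trans this
  · rintro ⟨⟨h1, h3⟩, h2⟩
    exact ⟨⟨h1, h2⟩, fun j hj hjl hh => h3 j hj hjl ⟨hh.1, fun i hi _ => hh.2 i hi⟩⟩

theorem measurableSet_firstRegenPast (u : Site d) (n l : ℕ) :
    MeasurableSet (firstRegenPast u n l) := by
  have : firstRegenPast u n l = {x | IsRecord u l x} ∩ ⋂ j, ⋂ _ : n ≤ j, ⋂ _ : j < l,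
      ({x | IsRecord u j x} ∩ ⋂ i, ⋂ _ : j ≤ i, ⋂ _ : i ≤ l,
        {x : Path d | x j ⬝ᵥ u ≤ x i ⬝ᵥ u})ᶜ := by
    ext x; simp [firstRegenPast]
  rw [this]
  refine (measurableSet_isRecord u l).inter (MeasurableSet.iInter fun j => MeasurableSet.iInter
    fun _ => MeasurableSet.iInter fun _ => ((measurableSet_isRecord u j).inter ?_).compl)
  exact MeasurableSet.iInter fun i => MeasurableSet.iInter fun _ => MeasurableSet.iInter fun _ =>
    measurableSet_le (measurable_level u j) (measurable_level u i)

theorem measurableSet_firstRegen (u : Site d) (n l : ℕ) : MeasurableSet (firstRegen u n l) := by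
  rw [firstRegen_eq]
  exact (measurableSet_firstRegenPast u n l).inter
    (measurable_future l (measurableSet_stay _))

theorem annealed_firstRegenPast_inter (u : Site d) (n l : ℕ) {B : Set (Path d)}
    (hB : MeasurableSet B) (hs : B ⊆ stay (halfSpace u 0)) :
    annealed μ (firstRegenPast u n l ∩ future l ⁻¹' B)
      = annealed μ (firstRegenPast u n l) * annealed μ B := by
  refine annealed_inter_future μ u l (measurableSet_firstRegenPast u n l) hB ?_
    (fun x hx => hx.1) hs
  rintro x y hxy ⟨h1, h2⟩
  have hrec : ∀ j ≤ l, IsRecord u j y → IsRecord u j x := by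
    intro j hj h i hi
    rw [hxy i (by omega), hxy j hj]
    exact h i hi
  refine ⟨fun i hi => ?_, fun j hj hjl hh => h2 j hj hjl ⟨hrec j hjl.le hh.1, fun i hi hil => ?_⟩⟩
  · rw [← hxy i hi.le, ← hxy l le_rfl]; exact h1 i hi
  · rw [hxy i hil, hxy j hjl.le]; exact hh.2 i hi hil

theorem map_future_restrict_firstRegen (u : Site d) (n l : ℕ) :
    ((annealed μ).restrict (firstRegen u n l)).map (future l)
      = annealed μ (firstRegenPast u n l) • (annealed μ).restrict (stay (halfSpace u 0)) := by
  refine Measure.ext fun B hB => ?_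
  rw [Measure.map_apply (measurable_future l) hB,
    Measure.restrict_apply (measurable_future l hB), Measure.smul_apply,
    Measure.restrict_apply hB, smul_eq_mul, ← annealed_firstRegenPast_inter μ u n l
      (hB.inter (measurableSet_stay _)) Set.inter_subset_right, firstRegen_eq]
  congr 1
  ext x
  simp only [Set.mem_inter_iff, Set.mem_preimage]
  tauto

/-- From the regeneration at `l` on, the path is a walk restricted to the non-backtracking event, so
`n` and `l` enter only through a scalar weight. -/
theorem setIntegral_firstRegen (u : Site d) (n l k : ℕ) :
    ∫ x in firstRegen u n l, (toE (x (l + k)) - toE (x l)) ∂(annealed μ)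
      = (annealed μ (firstRegenPast u n l)).toReal •
        ∫ x in stay (halfSpace u 0), toE (x k) ∂(annealed μ) := by
  rw [← integral_smul_measure, ← map_future_restrict_firstRegen,
    integral_map (measurable_future l).aemeasurable (measurable_toE_path k).aestronglyMeasurable]
  simp only [future, toE_sub]

theorem firstRegen_disjoint (u : Site d) (n : ℕ) :
    Pairwise (Function.onFun Disjoint fun j => firstRegen u n (n + j)) := by
  intro i j hij
  refine Set.disjoint_left.mpr fun x hi hj => ?_
  rcases lt_or_gt_of_ne hij with h | h
  · exact hj.2 (n + i) (by omega) (by omega) hi.1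
  · exact hi.2 (n + j) (by omega) (by omega) hj.1

theorem annealed_firstRegen_le (u : Site d) (n j : ℕ) :
    annealed μ (firstRegen u n (n + (j + 1))) ≤ regenTailSum μ u j := by
  refine (measure_mono fun x hx => ?_).trans (annealed_noRegen_le μ u n j)
  exact fun k hk hkj => hx.2 k hk.le (by omega)

theorem regenTailSum_tendsto {u : Site d} {p : ℝ} (hp : 1 < p)
    (hmom : RegenerationMoment (iidEnv μ) u p) :
    Tendsto (fun s => regenTailSum μ u s) atTop (𝓝 0) := by
  obtain ⟨C, hC, h⟩ := regenTailSum_le μ hp hmom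
  have h1 : Tendsto (fun s : ℕ => C * (s : ℝ) ^ (1 - p)) atTop (𝓝 0) := by
    have := ((tendsto_rpow_neg_atTop (by linarith : 0 < p - 1)).comp
      tendsto_natCast_atTop_atTop).const_mul C
    simpa [neg_sub] using this
  have h2 := ENNReal.tendsto_ofReal h1
  rw [ENNReal.ofReal_zero] at h2
  refine tendsto_of_tendsto_of_tendsto_of_le_of_le' tendsto_const_nhds h2
    (Eventually.of_forall fun _ => zero_le) ?_
  filter_upwards [eventually_ge_atTop 1] with s hs using h s hs

theorem ae_exists_firstRegen {u : Site d} {p : ℝ} (hp : 1 < p)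
    (hmom : RegenerationMoment (iidEnv μ) u p) (n : ℕ) :
    ∀ᵐ x ∂(annealed μ), x ∈ ⋃ j, firstRegen u n (n + j) := by
  have h0 : annealed μ (⋂ s, noRegen u n (n + s)) = 0 := by
    refine le_antisymm (ge_of_tendsto' (regenTailSum_tendsto μ hp hmom) fun s => ?_) zero_le
    exact (measure_mono (Set.iInter_subset _ s)).trans (annealed_noRegen_le μ u n s)
  refine measure_mono_null (fun x hx => ?_) h0
  refine Set.mem_iInter.mpr fun s k hk _ hreg => hx ?_
  classical
  have hex : ∃ j, IsRegeneration u x (n + j) := ⟨k - n, by rwa [Nat.add_sub_cancel' hk.le]⟩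
  refine Set.mem_iUnion.mpr ⟨Nat.find hex, Nat.find_spec hex, fun j hj hjl hh => ?_⟩
  refine Nat.find_min hex (m := j - n) (by omega) ?_
  rwa [Nat.add_sub_cancel' hj]

/-- A summable bound for the mean waiting time for the next regeneration. -/
theorem exists_summable_bound_firstRegen {u : Site d} {p : ℝ} (hp : 3 < p)
    (hmom : RegenerationMoment (iidEnv μ) u p) :
    ∃ e : ℕ → ℝ, Summable e ∧
      ∀ n j : ℕ, (j : ℝ) * (annealed μ).real (firstRegen u n (n + j)) ≤ e j := by
  obtain ⟨C, hC, h⟩ := regenTailSum_le μ (by linarith) hmom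
  -- A first regeneration at `n + j` leaves a window of length `j - 1` empty, and the tail bound
  -- needs this length to be at least 1, so `j ≤ 1` is treated trivially. Multiplying the tail by
  -- `j` gives the exponent `2 - p`, summable because `p > 3`.
  refine ⟨fun j => (if j ≤ 1 then 1 else 0) + 2 * C * ((j - 1 : ℕ) : ℝ) ^ (2 - p), ?_, ?_⟩
  · refine Summable.add (summable_of_ne_finset_zero (s := Finset.range 2) fun j hj => ?_)
      (Summable.mul_left _ ?_)
    · rw [Finset.mem_range] at hj
      rw [if_neg (by omega)]
    · rw [← summable_nat_add_iff 1]
      simpa using Real.summable_nat_rpow.mpr (by linarith : 2 - p < -1)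
  · intro n j
    rcases le_or_gt j 1 with hj | hj
    · simp only [hj, if_true]
      have h1 : (annealed μ).real (firstRegen u n (n + j)) ≤ 1 := measureReal_le_one
      have h2 : (j : ℝ) ≤ 1 := by exact_mod_cast hj
      have h3 : (0 : ℝ) ≤ 2 * C * ((j - 1 : ℕ) : ℝ) ^ (2 - p) := by positivity
      have := mul_le_one₀ h2 measureReal_nonneg h1
      linarith
    · obtain ⟨i, rfl⟩ : ∃ i, j = i + 1 := ⟨j - 1, by omega⟩
      simp only [if_neg (not_le.mpr hj), zero_add, Nat.add_sub_cancel]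
      have hi : 1 ≤ i := by omega
      have hi0 : (0 : ℝ) < i := by exact_mod_cast hi
      have h1 : (annealed μ).real (firstRegen u n (n + (i + 1))) ≤ C * (i : ℝ) ^ (1 - p) := by
        refine ENNReal.toReal_le_of_le_ofReal (by positivity) ?_
        exact (annealed_firstRegen_le μ u n i).trans (h i hi)
      have h2 : ((i + 1 : ℕ) : ℝ) ≤ 2 * i := by
        have : (1 : ℝ) ≤ i := by exact_mod_cast hi
        push_cast; linarith
      calc ((i + 1 : ℕ) : ℝ) * (annealed μ).real (firstRegen u n (n + (i + 1)))
          ≤ (2 * i) * (C * (i : ℝ) ^ (1 - p)) :=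
            mul_le_mul h2 h1 measureReal_nonneg (by positivity)
        _ = 2 * C * ((i : ℝ) ^ (1 : ℝ) * (i : ℝ) ^ (1 - p)) := by rw [Real.rpow_one]; ring
        _ = 2 * C * (i : ℝ) ^ (2 - p) := by
            rw [← Real.rpow_add hi0]; congr 2; ring

/-- Up to a bounded error, the mean displacement over a time interval depends only on the length
of the interval. -/
theorem exists_mean_displacement_approx {R : ℕ} (hR : ∀ᵐ ω ∂(iidEnv μ), HasRange R ω)
    {u : Site d} {p : ℝ} (hp : 3 < p) (hmom : RegenerationMoment (iidEnv μ) u p) :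
    ∃ C : ℝ, ∀ k, ∃ W : EuclideanSpace ℝ (Fin d), ∀ n,
      ‖averagedMean (iidEnv μ) (n + k) - averagedMean (iidEnv μ) n - W‖ ≤ C := by
  obtain ⟨e, he, hbd⟩ := exists_summable_bound_firstRegen μ hp hmom
  refine ⟨∑' j, 2 * (d * R) * e j, fun k => ?_⟩
  set S : Set (Path d) := stay (halfSpace u 0)
  set w := ∫ x in S, toE (x k) ∂(annealed μ)
  set σ := (annealed μ S).toReal
  -- The mean of X_k for the walk conditioned never to fall below its starting level.
  refine ⟨σ⁻¹ • w, fun n => ?_⟩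
  set V := fun j => firstRegen u n (n + j)
  set a := fun j => (annealed μ (firstRegenPast u n (n + j))).toReal
  have hVm : ∀ j, MeasurableSet (V j) := fun j => measurableSet_firstRegen u n (n + j)
  have hVa : ∀ j, (annealed μ).real (V j) = a j * σ := by
    intro j
    have := annealed_firstRegenPast_inter μ u n (n + j) (measurableSet_stay (halfSpace u 0)) le_rfl
    rw [← firstRegen_eq] at this
    rw [measureReal_def, this, ENNReal.toReal_mul]
  have hae := ae_exists_firstRegen μ (by linarith) hmom n
  have hrestr : (annealed μ).restrict (⋃ j, V j) = annealed μ :=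
    Measure.restrict_eq_self_of_ae_mem hae
  have hsumV : ∀ h : Path d → EuclideanSpace ℝ (Fin d), Integrable h (annealed μ) →
      HasSum (fun j => ∫ x in V j, h x ∂(annealed μ)) (∫ x, h x ∂(annealed μ)) := by
    intro h hh
    have := hasSum_integral_iUnion hVm (firstRegen_disjoint u n) (hh.integrableOn (s := ⋃ j, V j))
    rwa [hrestr] at this
  have hsum1 : HasSum (fun j => a j * σ) 1 := by
    have := hasSum_integral_iUnion (f := fun _ => (1 : ℝ)) hVm (firstRegen_disjoint u n)
      ((integrable_const 1).integrableOn (μ := annealed μ) (s := ⋃ j, V j))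
    rw [hrestr] at this
    simp only [smul_eq_mul, mul_one, integral_const, probReal_univ,
      measureReal_restrict_apply_univ] at this
    simpa only [← hVa] using this
  -- The non-backtracking event has positive probability, since otherwise the probabilities of the
  -- events `V j` could not sum to 1.
  have hσ : σ ≠ 0 := by
    intro h
    simp only [h, mul_zero] at hsum1
    exact zero_ne_one (hasSum_zero.unique hsum1)
  have hsuma : HasSum (fun j => a j • w) (σ⁻¹ • w) := by
    have := (hsum1.mul_right σ⁻¹)
    simp only [mul_assoc, mul_inv_cancel₀ hσ, mul_one, one_mul] at this
    exact this.smul_const w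
  have hint : ∀ i, Integrable (fun x : Path d => toE (x i)) (annealed μ) :=
    integrable_toE_path μ hR
  have hmean : averagedMean (iidEnv μ) (n + k) - averagedMean (iidEnv μ) n
      = ∫ x, (toE (x (n + k)) - toE (x n)) ∂(annealed μ) := by
    rw [averagedMean_eq, averagedMean_eq, integral_sub (hint _) (hint _)]
  rw [hmean]
  have hdiff := (hsumV _ ((hint (n + k)).sub (hint n))).sub hsuma
  simp only [Pi.sub_apply] at hdiff
  rw [← hdiff.tsum_eq]
  refine tsum_of_norm_bounded (he.mul_left (2 * (d * R : ℝ))).hasSum fun j => ?_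
  rw [← setIntegral_firstRegen μ u n (n + j) k, ← integral_sub]
  · refine (norm_setIntegral_le_of_norm_le_const_ae (C := 2 * (d * R) * j)
      (measure_lt_top _ _) ?_).trans ?_
    · filter_upwards [ae_restrict_of_ae (annealed_stepsIn μ hR)] with x hx
      have h1 := hx.norm_sub_le n j
      have h2 := hx.norm_sub_le (n + k) j
      rw [show n + k + j = n + j + k by ring] at h2
      -- Delaying the window of length `k` by `j` changes the displacement by two displacements of
      -- `j` steps, one at each end.
      have : toE (x (n + k)) - toE (x n) - (toE (x (n + j + k)) - toE (x (n + j)))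
          = (toE (x (n + j)) - toE (x n)) - (toE (x (n + j + k)) - toE (x (n + k))) := by abel
      rw [this]
      refine (norm_sub_le _ _).trans ?_
      linarith
    · rw [mul_assoc (2 * (d * R : ℝ))]
      exact mul_le_mul_of_nonneg_left (hbd n j) (by positivity)
  · exact ((hint _).sub (hint _)).integrableOn
  · exact ((hint _).sub (hint _)).integrableOn

theorem averagedMean_zero {R : ℕ} (hR : ∀ᵐ ω ∂(iidEnv μ), HasRange R ω) :
    averagedMean (iidEnv μ) 0 = 0 := by
  rw [averagedMean_eq]
  refine integral_eq_zero_of_ae ?_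
  filter_upwards [annealed_stepsIn μ hR] with x hx
  simp [hx.1, toE_zero]

theorem exists_averagedMean_approx_additive {R : ℕ} (hR : ∀ᵐ ω ∂(iidEnv μ), HasRange R ω)
    {u : Site d} {p : ℝ} (hp : 3 < p) (hmom : RegenerationMoment (iidEnv μ) u p) :
    ∃ C : ℝ, ∀ n k, ‖averagedMean (iidEnv μ) (n + k) - averagedMean (iidEnv μ) n
      - averagedMean (iidEnv μ) k‖ ≤ C := by
  obtain ⟨C, h⟩ := exists_mean_displacement_approx μ hR hp hmom
  refine ⟨C + C, fun n k => ?_⟩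
  obtain ⟨W, hW⟩ := h k
  have h1 := hW n
  have h2 := hW 0
  rw [averagedMean_zero μ hR, Nat.zero_add, sub_zero] at h2
  have : averagedMean (iidEnv μ) (n + k) - averagedMean (iidEnv μ) n - averagedMean (iidEnv μ) k
    = (averagedMean (iidEnv μ) (n + k) - averagedMean (iidEnv μ) n - W)
      - (averagedMean (iidEnv μ) k - W) := by abel
  rw [this]
  exact (norm_sub_le _ _).trans (add_le_add h1 h2)

/-- An approximately additive sequence is within bounded distance of a linear one. -/
theorem norm_sub_smul_le_of_approx_additive {E : Type*} [NormedAddCommGroup E] [NormedSpace ℝ E]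
    {m : ℕ → E} {C : ℝ} (h : ∀ n k, ‖m (n + k) - m n - m k‖ ≤ C) {N : ℕ → ℕ}
    (hN : Tendsto N atTop atTop) {v : E}
    (hv : Tendsto (fun j => (N j : ℝ)⁻¹ • m (N j)) atTop (𝓝 v)) (n : ℕ) :
    ‖m n - (n : ℝ) • v‖ ≤ C := by
  have hmul : ∀ q n : ℕ, ‖m (q * n) - (q : ℝ) • m n‖ ≤ (q + 1) * C := by
    intro q n
    induction q with
    | zero =>
      have := h 0 0
      simp only [add_zero, sub_self, zero_sub, norm_neg] at this
      simpa using this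
    | succ q ih =>
      have h1 := h (q * n) n
      have : m ((q + 1) * n) - ((q + 1 : ℕ) : ℝ) • m n
          = (m (q * n + n) - m (q * n) - m n) + (m (q * n) - (q : ℝ) • m n) := by
        rw [add_mul, one_mul, Nat.cast_add, Nat.cast_one, add_smul, one_smul]
        abel
      rw [this]
      refine (norm_add_le _ _).trans ?_
      push_cast
      linarith
  -- Evaluate `m (M * n)` both as `M` blocks of length `n` and as `n` blocks of length `M`. After
  -- division by `M` the error tends to `C` as `M` grows.
  have hcomp : ∀ M : ℕ, 1 ≤ M →
      ‖m n - (n : ℝ) • ((M : ℝ)⁻¹ • m M)‖ ≤ (M : ℝ)⁻¹ * ((M + 1 + (n + 1)) * C) := by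
    intro M hM
    have hM0 : (M : ℝ) ≠ 0 := by exact_mod_cast (by omega : M ≠ 0)
    have h1 := hmul M n
    have h2 := hmul n M
    rw [mul_comm n M] at h2
    have : m n - (n : ℝ) • ((M : ℝ)⁻¹ • m M) = (M : ℝ)⁻¹ •
        ((m (M * n) - (n : ℝ) • m M) - (m (M * n) - (M : ℝ) • m n)) := by
      rw [sub_sub_sub_cancel_left, smul_sub, smul_smul, smul_smul, smul_smul,
        inv_mul_cancel₀ hM0, one_smul, mul_comm]
    rw [this, norm_smul, norm_inv, Real.norm_natCast]
    refine mul_le_mul_of_nonneg_left ((norm_sub_le _ _).trans ?_) (by positivity)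
    linarith
  have hlim1 : Tendsto (fun j => ‖m n - (n : ℝ) • ((N j : ℝ)⁻¹ • m (N j))‖) atTop
      (𝓝 ‖m n - (n : ℝ) • v‖) := (tendsto_const_nhds.sub (hv.const_smul _)).norm
  have hNr : Tendsto (fun j => (N j : ℝ)⁻¹) atTop (𝓝 0) :=
    tendsto_inv_atTop_zero.comp (tendsto_natCast_atTop_atTop.comp hN)
  have hlim2 : Tendsto (fun j => C + (N j : ℝ)⁻¹ * ((1 + (n + 1)) * C)) atTop (𝓝 C) := by
    simpa using (hNr.mul_const ((1 + (n + 1 : ℝ)) * C)).const_add C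
  refine le_of_tendsto_of_tendsto hlim1 hlim2 ?_
  filter_upwards [hN.eventually_ge_atTop 1] with j hj
  refine (hcomp (N j) hj).trans (le_of_eq ?_)
  have hM0 : (N j : ℝ) ≠ 0 := by exact_mod_cast (by omega : N j ≠ 0)
  field_simp
  ring

end RWRE

namespace RWRE

variable {d : ℕ} (μ : Measure (JumpLaw d)) [IsProbabilityMeasure μ]

/-! ### The environment seen from the walk, far ahead of the walk -/

theorem lintegral_past (ν : Measure (Path d)) (m : ℕ)
    (g : ((i : Finset.Iic m) → Site d) → ℝ≥0∞) :
    ∫⁻ x, g (past m x) ∂ν = ∑' h, g h * ν (cyl m (extend m h)) := by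
  rw [← lintegral_map (measurable_of_countable g) (measurable_past m), lintegral_countable']
  refine tsum_congr fun h => ?_
  rw [Measure.map_apply (measurable_past m) (measurableSet_singleton h), past_preimage_singleton]

theorem extend_past {m i : ℕ} (x : Path d) (hi : i ≤ m) : extend m (past m x) i = x i := by
  simp [extend, past, hi]

/-- The paths that at time `m` are at distance at least `Λ` below their maximal level. -/
def backtracked {d : ℕ} (u : Site d) (Λ : ℤ) (m : ℕ) : Set (Path d) :=
  {x | ∃ k ≤ m, x m ⬝ᵥ u + Λ ≤ x k ⬝ᵥ u}

theorem measurableSet_backtracked (u : Site d) (Λ : ℤ) (m : ℕ) :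
    MeasurableSet (backtracked u Λ m) := by
  have : backtracked u Λ m = ⋃ k, ⋃ _ : k ≤ m, {x : Path d | x m ⬝ᵥ u + Λ ≤ x k ⬝ᵥ u} := by
    ext x; simp [backtracked]
  rw [this]
  exact MeasurableSet.iUnion fun k => MeasurableSet.iUnion fun _ =>
    measurableSet_le ((measurable_level u m).add_const Λ) (measurable_level u k)

/-- A history that is less than Λ below its maximum at time `m` has read the environment only at
levels below `a m ⬝ᵥ u + Λ`, so what lies beyond is independent of it and still has law ℙ. -/
theorem lintegral_shift_mul_quenched_cyl (u : Site d) (Λ : ℤ) (m : ℕ) (a : Path d)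
    (ha : a ∉ backtracked u Λ m) {F : Env d → ℝ≥0∞} (hF : Measurable F)
    (hdep : DependsOn F (halfSpace u Λ)) :
    ∫⁻ ω, quenched 0 ω (cyl m a) * F (shift (a m) ω) ∂(iidEnv μ)
      = annealed μ (cyl m a) * ∫⁻ ω, F ω ∂(iidEnv μ) := by
  classical
  simp only [quenched_cyl, annealed_cyl]
  split_ifs with h0
  · refine (lintegral_mul_of_dependsOn μ (measurable_pathWeight m a)
      (hF.comp (measurable_shift (a m))) (S := {y | y ⬝ᵥ u < a m ⬝ᵥ u + Λ})
      (T := {y | a m ⬝ᵥ u + Λ ≤ y ⬝ᵥ u}) ?_ ?_ ?_).trans ?_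
    · refine (dependsOn_pathWeight m a).mono ?_
      rintro y ⟨i, hi, rfl⟩
      exact not_le.mp fun h => ha ⟨i, hi.le, h⟩
    · intro ω ω' h
      refine hdep fun y hy => h (y + a m) ?_
      simp only [halfSpace, Set.mem_ofPred_eq, add_dotProduct] at hy ⊢
      linarith
    · refine Set.disjoint_left.mpr fun y h1 h2 => ?_
      simp only [Set.mem_ofPred_eq] at h1 h2
      linarith
    · congr 1
      exact (measurePreserving_shift μ (a m)).lintegral_comp hF
  · simp

/-- Sum over histories: those that have not backtracked by Λ contribute the mean under ℙ, and on the
others `F` is bounded by `C`. -/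
theorem lintegral_envLaw_le (u : Site d) (Λ : ℤ) (m : ℕ) {F : Env d → ℝ≥0∞} (hF : Measurable F)
    (hdep : DependsOn F (halfSpace u Λ)) {C : ℝ≥0∞} (hC : ∀ ω, F ω ≤ C) :
    ∫⁻ ω, F ω ∂(envLaw (iidEnv μ) m)
      ≤ ∫⁻ ω, F ω ∂(iidEnv μ) + C * annealed μ (backtracked u Λ m) := by
  set I := ∫⁻ ω, F ω ∂(iidEnv μ)
  have hmF : ∀ z, Measurable fun ω => F (shift z ω) := fun z => hF.comp (measurable_shift z)
  have hmq : ∀ a : Path d, Measurable fun ω : Env d => quenched 0 ω (cyl m a) := fun a =>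
    Measure.measurable_measure.mp (measurable_quenched 0) _ (measurableSet_cyl m a)
  have hpt : ∀ h : (i : Finset.Iic m) → Site d,
      ∫⁻ ω, F (shift (extend m h m) ω) * quenched 0 ω (cyl m (extend m h)) ∂(iidEnv μ)
      ≤ (I + C * (backtracked u Λ m).indicator 1 (extend m h)) *
        annealed μ (cyl m (extend m h)) := by
    intro h
    set a := extend m h
    by_cases ha : a ∈ backtracked u Λ m
    · rw [Set.indicator_of_mem ha, Pi.one_apply, mul_one]
      calc ∫⁻ ω, F (shift (a m) ω) * quenched 0 ω (cyl m a) ∂(iidEnv μ)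
          ≤ ∫⁻ ω, C * quenched 0 ω (cyl m a) ∂(iidEnv μ) :=
            lintegral_mono fun ω => mul_le_mul' (hC _) le_rfl
        _ = C * annealed μ (cyl m a) := by
            rw [lintegral_const_mul _ (hmq a), annealed_apply μ (measurableSet_cyl m a)]
        _ ≤ _ := mul_le_mul' le_add_self le_rfl
    · rw [Set.indicator_of_notMem ha, mul_zero, add_zero, mul_comm I,
        ← lintegral_shift_mul_quenched_cyl μ u Λ m a ha hF hdep]
      simp only [mul_comm]
      exact le_rfl
  calc ∫⁻ ω, F ω ∂(envLaw (iidEnv μ) m)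
      = ∫⁻ ω, ∫⁻ x, F (shift (x m) ω) ∂(quenched 0 ω) ∂(iidEnv μ) := by
        rw [envLaw, lintegral_map hF (measurable_shift_path m), averaged]
        exact Measure.lintegral_compProd (hF.comp (measurable_shift_path m))
    _ = ∫⁻ ω, ∑' h, F (shift (extend m h m) ω) * quenched 0 ω (cyl m (extend m h))
          ∂(iidEnv μ) := by
        refine lintegral_congr fun ω => ?_
        rw [← lintegral_past (quenched 0 ω) m fun h => F (shift (extend m h m) ω)]
        simp only [extend_past _ le_rfl]
    _ = ∑' h, ∫⁻ ω, F (shift (extend m h m) ω) * quenched 0 ω (cyl m (extend m h))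
          ∂(iidEnv μ) := lintegral_tsum fun h => ((hmF _).mul (hmq _)).aemeasurable
    _ ≤ ∑' h, (I + C * (backtracked u Λ m).indicator 1 (extend m h)) *
          annealed μ (cyl m (extend m h)) := ENNReal.tsum_le_tsum hpt
    _ = ∫⁻ x, (I + C * (backtracked u Λ m).indicator 1 (extend m (past m x))) ∂(annealed μ) :=
        (lintegral_past (annealed μ) m
          fun h => I + C * (backtracked u Λ m).indicator 1 (extend m h)).symm
    _ = ∫⁻ x, (I + C * (backtracked u Λ m).indicator 1 x) ∂(annealed μ) := by
        refine lintegral_congr fun x => ?_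
        have : extend m (past m x) ∈ backtracked u Λ m ↔ x ∈ backtracked u Λ m := by
          simp only [backtracked, Set.mem_ofPred_eq, extend_past x le_rfl]
          refine exists_congr fun k => and_congr_right fun hk => ?_
          rw [extend_past x hk]
        by_cases hx : x ∈ backtracked u Λ m
        · rw [Set.indicator_of_mem hx, Set.indicator_of_mem (this.mpr hx), Pi.one_apply,
            Pi.one_apply]
        · rw [Set.indicator_of_notMem hx, Set.indicator_of_notMem fun h => hx (this.mp h)]
    _ = I + C * annealed μ (backtracked u Λ m) := by
        have hm := (measurable_one (α := ℝ≥0∞)).indicator (measurableSet_backtracked u Λ m)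
        rw [lintegral_add_left measurable_const, lintegral_const, measure_univ, mul_one,
          lintegral_const_mul _ hm, lintegral_indicator_one (measurableSet_backtracked u Λ m)]

instance (m : ℕ) : IsProbabilityMeasure (envLaw (iidEnv μ) m) :=
  Measure.isProbabilityMeasure_map (measurable_shift_path m).aemeasurable

theorem integral_envLaw_le (u : Site d) (Λ : ℤ) (m : ℕ) {F : Env d → ℝ} (hF : Measurable F)
    (hdep : DependsOn F (halfSpace u Λ)) {C : ℝ} (hF0 : ∀ ω, 0 ≤ F ω) (hC : ∀ ω, F ω ≤ C) :
    ∫ ω, F ω ∂(envLaw (iidEnv μ) m)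
      ≤ ∫ ω, F ω ∂(iidEnv μ) + C * (annealed μ).real (backtracked u Λ m) := by
  have hC0 : 0 ≤ C := (hF0 fun _ => stayLaw d).trans (hC _)
  have hle := lintegral_envLaw_le μ u Λ m (F := fun ω => ENNReal.ofReal (F ω))
    (ENNReal.measurable_ofReal.comp hF) (fun ω ω' h => by dsimp only; rw [hdep h])
    (C := ENNReal.ofReal C) fun ω => ENNReal.ofReal_le_ofReal (hC ω)
  have hfin : ∫⁻ ω, ENNReal.ofReal (F ω) ∂(iidEnv μ) ≠ ⊤ := by
    refine ne_of_lt (lt_of_le_of_lt (lintegral_mono fun ω =>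
      ENNReal.ofReal_le_ofReal (hC ω)) ?_)
    simp
  have hfin2 : ENNReal.ofReal C * annealed μ (backtracked u Λ m) ≠ ⊤ :=
    ENNReal.mul_ne_top ENNReal.ofReal_ne_top (measure_ne_top _ _)
  rw [integral_eq_lintegral_of_nonneg_ae (ae_of_all _ hF0) hF.aestronglyMeasurable,
    integral_eq_lintegral_of_nonneg_ae (ae_of_all _ hF0) hF.aestronglyMeasurable]
  refine (ENNReal.toReal_mono (ENNReal.add_ne_top.mpr ⟨hfin, hfin2⟩) hle).trans (le_of_eq ?_)
  rw [ENNReal.toReal_add hfin hfin2, ENNReal.toReal_mul, ENNReal.toReal_ofReal hC0]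
  rfl

/-! ### Consequences of a regeneration in a window: little backtracking, steady progress -/

theorem one_le_levelBound (u : Site d) (R : ℕ) : 1 ≤ levelBound u R := by
  simp [levelBound]

/-- A regeneration `r` in `(m - s, m]` excludes the event: levels before `r` are below the level at
`m`, and from `r` to `m` fewer than `s` steps are available to climb above it. -/
theorem annealed_backtracked_le {R : ℕ} (hR : ∀ᵐ ω ∂(iidEnv μ), HasRange R ω) (u : Site d)
    {s : ℕ} (hs : 1 ≤ s) (m : ℕ) :
    annealed μ (backtracked u (levelBound u R * s) m) ≤ regenTailSum μ u s := by
  have hK : (1 : ℤ) ≤ levelBound u R := by exact_mod_cast one_le_levelBound u R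
  have hss : (1 : ℤ) ≤ s := by exact_mod_cast hs
  refine (measure_mono_ae ?_).trans (annealed_noRegen_le μ u (m - s) s)
  filter_upwards [annealed_stepsIn μ hR] with x hx hb
  obtain ⟨k, hkm, hk⟩ := hb
  intro r hr hrm hreg
  -- For `m < s` the truncated subtraction makes the window `(0, s]`, which may extend past `m`; in
  -- that case the walk has made too few steps to have backtracked so far.
  have hrm' : r ≤ m ∨ m < s := by omega
  have hstep : ∀ i, i ≤ k → x k ⬝ᵥ u ≤ x i ⬝ᵥ u + levelBound u R * ((k - i : ℕ) : ℤ) := by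
    intro i hi
    have := (abs_le.mp (hx.abs_level_sub_le u i (k - i))).2
    rw [Nat.add_sub_cancel' hi] at this
    linarith
  have hstep' : x k ⬝ᵥ u - x m ⬝ᵥ u ≤ levelBound u R * ((m - k : ℕ) : ℤ) := by
    have := (abs_le.mp (hx.abs_level_sub_le u k (m - k))).1
    rw [Nat.add_sub_cancel' hkm] at this
    linarith
  rcases lt_or_ge m s with hms | hms
  · have h1 : ((m - k : ℕ) : ℤ) < s := by omega
    have := mul_lt_mul_of_pos_left h1 (by linarith : (0 : ℤ) < levelBound u R)
    linarith
  · have hrm : r ≤ m := by omega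
    have hxm := hreg.2 m hrm
    rcases lt_or_ge k r with h | h
    · have := hreg.1 k h
      have h3 : (0 : ℤ) < levelBound u R * s := by positivity
      linarith
    · have h1 : ((k - r : ℕ) : ℤ) < s := by omega
      have := mul_lt_mul_of_pos_left h1 (by linarith : (0 : ℤ) < levelBound u R)
      have := hstep r h
      linarith

/-- The walk gains a level in each window of length `s`, unless there is a window without
regeneration. -/
theorem annealed_displacement_lt_le (u : Site d) (m q s : ℕ) :
    annealed μ {x | x (m + q * s) ⬝ᵥ u - x m ⬝ᵥ u < q} ≤ q * regenTailSum μ u s := by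
  calc annealed μ {x | x (m + q * s) ⬝ᵥ u - x m ⬝ᵥ u < q}
      ≤ annealed μ (⋃ i ∈ Finset.range q, noRegen u (m + i * s) (m + i * s + s)) := by
        refine measure_mono fun x hx => ?_
        by_contra hcon
        simp only [Set.mem_iUnion, Finset.mem_range, not_exists] at hcon
        -- A regeneration inside a window lies strictly above the level at the start of the window
        -- and is never undercut; levels are integers, so the window gains at least 1.
        have hind : ∀ i ≤ q, (i : ℤ) ≤ x (m + i * s) ⬝ᵥ u - x m ⬝ᵥ u := by
          intro i
          induction i with
          | zero => simp
          | succ i ih =>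
            intro hi
            have h1 := ih (by omega)
            have h2 := hcon i (by omega)
            simp only [noRegen, Set.mem_ofPred_eq, not_forall, not_not] at h2
            obtain ⟨r, hr, hrs, hreg⟩ := h2
            have h3 := hreg.1 _ hr
            have h4 := hreg.2 _ hrs
            rw [show m + i * s + s = m + (i + 1) * s by ring] at h4
            push_cast
            linarith
        have := hind q le_rfl
        simp only [Set.mem_ofPred_eq] at hx
        linarith
    _ ≤ ∑ i ∈ Finset.range q, annealed μ (noRegen u (m + i * s) (m + i * s + s)) :=
        measure_biUnion_finset_le _ _
    _ ≤ ∑ i ∈ Finset.range q, regenTailSum μ u s :=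
        Finset.sum_le_sum fun i _ => annealed_noRegen_le μ u _ s
    _ = q * regenTailSum μ u s := by simp

/-- With a regeneration in `(0, s]`, the path before it has had at most `s` steps to descend, and
from it on the path stays above level 0. -/
theorem annealed_not_stay_le {R : ℕ} (hR : ∀ᵐ ω ∂(iidEnv μ), HasRange R ω) (u : Site d)
    (s n : ℕ) :
    annealed μ (stayUpTo (halfSpace u (-(levelBound u R * s))) n)ᶜ ≤ regenTailSum μ u s := by
  refine (measure_mono_ae ?_).trans (regenTail_le_regenTailSum μ u s)
  filter_upwards [annealed_stepsIn μ hR] with x hx hb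
  intro r hr hrs hreg
  refine hb fun i _ => ?_
  change -((levelBound u R : ℤ) * s) ≤ x i ⬝ᵥ u
  have h0 : x 0 ⬝ᵥ u = 0 := by rw [hx.1, zero_dotProduct]
  have hK : (0 : ℤ) ≤ levelBound u R * s := by positivity
  rcases lt_or_ge i r with h | h
  · have h1 := (abs_le.mp (hx.abs_level_sub_le u 0 i)).1
    rw [Nat.zero_add, h0, sub_zero] at h1
    have h2 : (levelBound u R : ℤ) * i ≤ levelBound u R * s :=
      mul_le_mul_of_nonneg_left (by omega) (by positivity)
    linarith
  · have h1 := hreg.1 0 hr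
    have h2 := hreg.2 i h
    linarith

end RWRE

namespace RWRE

variable {d : ℕ}

/-! ### The transition operators of the walk -/

theorem HasRange.sum_eq_one {R : ℕ} {ω : Env d} (hω : HasRange R ω) (x : Site d) :
    ∑ z ∈ box d R, (ω x).1 z = 1 :=
  (hasSum_sum_of_ne_finset_zero fun z hz => hω x z hz).unique (ω x).2.2

theorem sum_box_le_one (R : ℕ) (ω : Env d) (x : Site d) : ∑ z ∈ box d R, (ω x).1 z ≤ 1 :=
  sum_le_hasSum _ (fun z _ => (ω x).2.1 z) (ω x).2.2

theorem hasRange_of_sum_eq_one {R : ℕ} {ω : Env d} (h : ∀ x, ∑ z ∈ box d R, (ω x).1 z = 1) :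
    HasRange R ω := by
  classical
  intro x y hy
  have := sum_le_hasSum (insert y (box d R)) (fun z _ => (ω x).2.1 z) (ω x).2.2
  rw [Finset.sum_insert hy, h x] at this
  exact le_antisymm (by linarith) ((ω x).2.1 y)

theorem HasRange.shift {R : ℕ} {ω : Env d} (hω : HasRange R ω) (z : Site d) :
    HasRange R (shift z ω) := fun x y hy => hω (x + z) y hy

instance : SecondCountableTopology (JumpLaw d) :=
  TopologicalSpace.Subtype.secondCountableTopology _

theorem continuous_jumpLaw (x z : Site d) : Continuous fun ω : Env d => (ω x).1 z :=
  (continuous_apply z).comp (continuous_subtype_val.comp (continuous_apply x))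

section Operator

variable {E : Type*} [NormedAddCommGroup E] [NormedSpace ℝ E]

open Classical in
/-- The mean of `f (X_n)` for the walk in the environment `ω` started at `x`, with jumps in
`box d R`, and killed when it leaves `H`. -/
noncomputable def killedMean (R : ℕ) (H : Set (Site d)) (ω : Env d) (f : Site d → E) :
    ℕ → Site d → E
  | 0, x => if x ∈ H then f x else 0
  | n + 1, x => if x ∈ H then ∑ z ∈ box d R, (ω x).1 z • killedMean R H ω f n (x + z) else 0

/-- The mean of `f (X_n)` for the walk in the environment `ω` started at `x`, with jumps in
`box d R`. -/
noncomputable def walkMean (R : ℕ) (ω : Env d) (f : Site d → E) (n : ℕ) (x : Site d) : E :=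
  killedMean R Set.univ ω f n x

variable (R : ℕ) (H : Set (Site d)) (ω : Env d) (f g : Site d → E) (n : ℕ) (x : Site d)

@[simp] theorem walkMean_zero : walkMean R ω f 0 x = f x := by simp [walkMean, killedMean]

theorem walkMean_succ : walkMean R ω f (n + 1) x
    = ∑ z ∈ box d R, (ω x).1 z • walkMean R ω f n (x + z) := by
  simp [walkMean, killedMean]

variable {x} in
theorem killedMean_of_notMem (hx : x ∉ H) : killedMean R H ω f n x = 0 := by
  cases n <;> simp [killedMean, hx]

/-- Restricting jumps to a finite box makes this a polynomial in finitely many transition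
probabilities, hence a legitimate test function for weak limits. -/
theorem continuous_killedMean : Continuous fun ω : Env d => killedMean R H ω f n x := by
  induction n generalizing x with
  | zero => simp only [killedMean]; exact continuous_const
  | succ n ih =>
    simp only [killedMean]
    split_ifs
    · exact continuous_finsetSum _ fun z _ => (continuous_jumpLaw x z).smul (ih (x + z))
    · exact continuous_const

theorem dependsOn_killedMean : DependsOn (fun ω : Env d => killedMean R H ω f n x) H := by
  intro ω ω' h
  induction n generalizing x with
  | zero => rfl
  | succ n ih =>
    simp only [killedMean]
    split_ifs with hx
    · refine Finset.sum_congr rfl fun z _ => ?_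
      rw [h x hx]
      exact congrArg _ (ih (x + z))
    · rfl

variable {f g} in
theorem norm_killedMean_le {C : ℝ} (hf : ∀ y, ‖f y‖ ≤ C) : ‖killedMean R H ω f n x‖ ≤ C := by
  have hC : 0 ≤ C := (norm_nonneg _).trans (hf 0)
  induction n generalizing x with
  | zero =>
    simp only [killedMean]
    split_ifs
    · exact hf x
    · simpa using hC
  | succ n ih =>
    simp only [killedMean]
    split_ifs
    · calc ‖∑ z ∈ box d R, (ω x).1 z • killedMean R H ω f n (x + z)‖
          ≤ ∑ z ∈ box d R, (ω x).1 z * C := by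
            refine norm_sum_le_of_le _ fun z _ => ?_
            rw [norm_smul, Real.norm_of_nonneg ((ω x).2.1 z)]
            exact mul_le_mul_of_nonneg_left (ih _) ((ω x).2.1 z)
        _ = (∑ z ∈ box d R, (ω x).1 z) * C := (Finset.sum_mul ..).symm
        _ ≤ 1 * C := mul_le_mul_of_nonneg_right (sum_box_le_one R ω x) hC
        _ = C := one_mul C
    · simpa using hC

theorem killedMean_one_mem : killedMean R H ω (fun _ => (1 : ℝ)) n x ∈ Set.Icc 0 1 := by
  refine ⟨?_, (le_abs_self _).trans
    (norm_killedMean_le R H ω n x (f := fun _ => (1 : ℝ)) (C := 1) (by simp))⟩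
  induction n generalizing x with
  | zero => simp only [killedMean]; split_ifs <;> simp
  | succ n ih =>
    simp only [killedMean]
    split_ifs
    · exact Finset.sum_nonneg fun z _ => mul_nonneg ((ω x).2.1 z) (ih _)
    · exact le_rfl

-- The two means differ only if the walk leaves `H`, and the factor after `C` is the probability of
-- doing so within `n` steps.
variable {R ω f g} in
theorem norm_walkMean_sub_killedMean_le (hω : HasRange R ω) {C : ℝ} (hf : ∀ y, ‖f y‖ ≤ C) :
    ‖walkMean R ω f n x - killedMean R H ω f n x‖
      ≤ C * (1 - killedMean R H ω (fun _ => (1 : ℝ)) n x) := by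
  have hout : ∀ n x, x ∉ H → ‖walkMean R ω f n x - killedMean R H ω f n x‖
      ≤ C * (1 - killedMean R H ω (fun _ => (1 : ℝ)) n x) := by
    intro n x hx
    rw [killedMean_of_notMem R H ω f n hx, killedMean_of_notMem R H ω _ n hx, sub_zero, sub_zero,
      mul_one]
    exact norm_killedMean_le R Set.univ ω n x hf
  induction n generalizing x with
  | zero =>
    by_cases hx : x ∈ H
    · simp [walkMean, killedMean, hx]
    · exact hout 0 x hx
  | succ n ih =>
    by_cases hx : x ∈ H
    · rw [walkMean_succ]
      simp only [killedMean, hx, if_true]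
      rw [← Finset.sum_sub_distrib]
      calc ‖∑ z ∈ box d R, ((ω x).1 z • walkMean R ω f n (x + z)
              - (ω x).1 z • killedMean R H ω f n (x + z))‖
          ≤ ∑ z ∈ box d R, (ω x).1 z *
              (C * (1 - killedMean R H ω (fun _ => (1 : ℝ)) n (x + z))) := by
            refine norm_sum_le_of_le _ fun z _ => ?_
            rw [← smul_sub, norm_smul, Real.norm_of_nonneg ((ω x).2.1 z)]
            exact mul_le_mul_of_nonneg_left (ih _) ((ω x).2.1 z)
        _ = C * (∑ z ∈ box d R, (ω x).1 z - ∑ z ∈ box d R, (ω x).1 z •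
              killedMean R H ω (fun _ => (1 : ℝ)) n (x + z)) := by
            rw [← Finset.sum_sub_distrib, Finset.mul_sum]
            refine Finset.sum_congr rfl fun z _ => ?_
            rw [smul_eq_mul]; ring
        _ = _ := by rw [hω.sum_eq_one x]
    · exact hout (n + 1) x hx

theorem add_sub_mem_box {R n : ℕ} {x y z : Site d} (hz : z ∈ box d R)
    (hy : y - (x + z) ∈ box d (R * n)) : y - x ∈ box d (R * (n + 1)) := by
  have := add_mem_box hz hy
  rw [show R * (n + 1) = R + R * n by ring]
  convert this using 1
  abel

variable {f g} in
theorem walkMean_congr (h : ∀ y, y - x ∈ box d (R * n) → f y = g y) :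
    walkMean R ω f n x = walkMean R ω g n x := by
  induction n generalizing x with
  | zero => simpa using h x (by simpa using zero_mem_box _)
  | succ n ih =>
    rw [walkMean_succ, walkMean_succ]
    refine Finset.sum_congr rfl fun z hz => ?_
    rw [ih (x + z) fun y hy => h y (add_sub_mem_box hz hy)]

theorem walkMean_mono {f g : Site d → ℝ} (h : ∀ y, y - x ∈ box d (R * n) → f y ≤ g y) :
    walkMean R ω f n x ≤ walkMean R ω g n x := by
  induction n generalizing x with
  | zero => simpa using h x (by simpa using zero_mem_box _)
  | succ n ih =>
    rw [walkMean_succ, walkMean_succ]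
    refine Finset.sum_le_sum fun z hz => ?_
    exact mul_le_mul_of_nonneg_left (ih (x + z) fun y hy => h y (add_sub_mem_box hz hy))
      ((ω x).2.1 z)

theorem walkMean_sub : walkMean R ω (fun y => f y - g y) n x
    = walkMean R ω f n x - walkMean R ω g n x := by
  induction n generalizing x with
  | zero => simp
  | succ n ih =>
    simp only [walkMean_succ, ih, smul_sub, Finset.sum_sub_distrib]

theorem walkMean_add : walkMean R ω (fun y => f y + g y) n x
    = walkMean R ω f n x + walkMean R ω g n x := by
  induction n generalizing x with
  | zero => simp
  | succ n ih =>
    simp only [walkMean_succ, ih, smul_add, Finset.sum_add_distrib]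

theorem walkMean_const_mul (c : ℝ) (f : Site d → ℝ) : walkMean R ω (fun y => c * f y) n x
    = c * walkMean R ω f n x := by
  induction n generalizing x with
  | zero => simp
  | succ n ih =>
    simp only [walkMean_succ, ih, Finset.mul_sum, smul_eq_mul]
    exact Finset.sum_congr rfl fun z _ => by ring

variable {R ω} in
theorem walkMean_const (hω : HasRange R ω) (c : E) : walkMean R ω (fun _ => c) n x = c := by
  induction n generalizing x with
  | zero => simp
  | succ n ih => simp only [walkMean_succ, ih, ← Finset.sum_smul, hω.sum_eq_one x, one_smul]

theorem walkMean_add_time (m : ℕ) :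
    walkMean R ω f (n + m) x = walkMean R ω (walkMean R ω f m) n x := by
  induction n generalizing x with
  | zero => simp
  | succ n ih => rw [show n + 1 + m = (n + m) + 1 by ring, walkMean_succ, walkMean_succ]; simp [ih]

theorem killedMean_shift (z : Site d) : killedMean R H (shift z ω) f n x
    = killedMean R {y | y - z ∈ H} ω (fun y => f (y - z)) n (x + z) := by
  induction n generalizing x with
  | zero =>
    by_cases hx : x ∈ H
    · have hx' : x + z ∈ {y | y - z ∈ H} := by simpa using hx
      simp only [killedMean, if_pos hx, if_pos hx', add_sub_cancel_right]
    · have hx' : x + z ∉ {y | y - z ∈ H} := by simpa using hx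
      rw [killedMean_of_notMem _ _ _ _ _ hx, killedMean_of_notMem _ _ _ _ _ hx']
  | succ n ih =>
    by_cases hx : x ∈ H
    · have hx' : x + z ∈ {y | y - z ∈ H} := by simpa using hx
      simp only [killedMean, if_pos hx, if_pos hx']
      refine Finset.sum_congr rfl fun y _ => ?_
      rw [ih (x + y), show x + y + z = x + z + y by abel]
      rfl
    · have hx' : x + z ∉ {y | y - z ∈ H} := by simpa using hx
      rw [killedMean_of_notMem _ _ _ _ _ hx, killedMean_of_notMem _ _ _ _ _ hx']

theorem walkMean_shift (z : Site d) :
    walkMean R (shift z ω) f n x = walkMean R ω (fun y => f (y - z)) n (x + z) :=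
  killedMean_shift R Set.univ ω f n x z

variable {R ω} in
theorem norm_walkMean_le (hω : HasRange R ω) {C : ℝ}
    (h : ∀ y, y - x ∈ box d (R * n) → ‖f y‖ ≤ C) : ‖walkMean R ω f n x‖ ≤ C := by
  induction n generalizing x with
  | zero => simpa using h x (by simpa using zero_mem_box _)
  | succ n ih =>
    rw [walkMean_succ]
    calc ‖∑ z ∈ box d R, (ω x).1 z • walkMean R ω f n (x + z)‖
        ≤ ∑ z ∈ box d R, (ω x).1 z * C := by
          refine norm_sum_le_of_le _ fun z hz => ?_
          rw [norm_smul, Real.norm_of_nonneg ((ω x).2.1 z)]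
          exact mul_le_mul_of_nonneg_left
            (ih (x + z) fun y hy => h y (add_sub_mem_box hz hy)) ((ω x).2.1 z)
      _ = C := by rw [← Finset.sum_mul, hω.sum_eq_one x, one_mul]

variable {R ω} in
theorem norm_sq_walkMean_le (hω : HasRange R ω) :
    ‖walkMean R ω f n x‖ ^ 2 ≤ walkMean R ω (fun y => ‖f y‖ ^ 2) n x := by
  induction n generalizing x with
  | zero => simp
  | succ n ih =>
    rw [walkMean_succ, walkMean_succ]
    calc ‖∑ z ∈ box d R, (ω x).1 z • walkMean R ω f n (x + z)‖ ^ 2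
        ≤ (∑ z ∈ box d R, (ω x).1 z • ‖walkMean R ω f n (x + z)‖) ^ 2 := by
          refine pow_le_pow_left₀ (norm_nonneg _) (norm_sum_le_of_le _ fun z _ => ?_) 2
          rw [norm_smul, Real.norm_of_nonneg ((ω x).2.1 z), smul_eq_mul]
      _ ≤ ∑ z ∈ box d R, (ω x).1 z • ‖walkMean R ω f n (x + z)‖ ^ 2 :=
          (convexOn_pow 2).map_sum_le (fun z _ => (ω x).2.1 z) (hω.sum_eq_one x)
            fun z _ => norm_nonneg _
      _ ≤ _ := Finset.sum_le_sum fun z _ => mul_le_mul_of_nonneg_left (ih _) ((ω x).2.1 z)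

/-! ### The operators as expectations -/

theorem stronglyMeasurable_path {E : Type*} [TopologicalSpace E] (f : Site d → E) (n : ℕ) : StronglyMeasurable fun x : Path d => f (x n) := by
  have h : StronglyMeasurable f := StronglyMeasurable.of_discrete
  exact h.comp_measurable (measurable_pi_apply n)

variable {R ω} in
theorem integrable_path {E : Type*} [NormedAddCommGroup E] (f : Site d → E) (n : ℕ) (hω : HasRange R ω) (z : Site d) :
    Integrable (fun x : Path d => f (x n)) (quenched z ω) := by
  refine Integrable.of_bound (stronglyMeasurable_path f n).aestronglyMeasurable
    (∑ y ∈ box d (R * n), ‖f (z + y)‖) ?_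
  filter_upwards [quenched_stepsIn hω z] with x hx
  have h1 := hx.sub_mem_box 0 n
  rw [Nat.zero_add, hx.1] at h1
  have := Finset.single_le_sum (f := fun y => ‖f (z + y)‖) (fun y _ => norm_nonneg _) h1
  simpa using this

variable {R ω} in
theorem integral_first_step (hω : HasRange R ω) (z : Site d) {Φ : Path d → E}
    (hΦ : StronglyMeasurable Φ)
    (hint : ∀ y ∈ box d R, Integrable (fun x => Φ (cons z x)) (quenched (z + y) ω)) :
    ∫ x, Φ x ∂(quenched z ω)
      = ∑ y ∈ box d R, (ω z).1 y • ∫ x, Φ (cons z x) ∂(quenched (z + y) ω) := by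
  have hmap : ∀ y ∈ box d R, Integrable Φ ((quenched (z + y) ω).map (cons z)) := fun y hy =>
    (integrable_map_measure hΦ.aestronglyMeasurable (measurable_cons z).aemeasurable).mpr
      (hint y hy)
  conv_lhs => rw [quenched_first_step z ω (box d R) (hω z)]
  rw [integral_finsetSum_measure fun y hy => (hmap y hy).smul_measure ENNReal.ofReal_ne_top]
  refine Finset.sum_congr rfl fun y _ => ?_
  rw [integral_smul_measure, integral_map (measurable_cons z).aemeasurable
    hΦ.aestronglyMeasurable, ENNReal.toReal_ofReal ((ω z).2.1 y)]

-- Both sides satisfy the same first-step recursion; this identifies the recursively defined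
-- operator with a path-space expectation.
variable {R ω} in
theorem integral_stayUpTo [CompleteSpace E] (hω : HasRange R ω) (z : Site d) :
    ∫ x, (stayUpTo H n).indicator (fun x => f (x n)) x ∂(quenched z ω)
      = killedMean R H ω f n z := by
  induction n generalizing z with
  | zero =>
    have : ∀ᵐ x ∂(quenched z ω), (stayUpTo H 0).indicator (fun x => f (x 0)) x
        = killedMean R H ω f 0 z := by
      filter_upwards [quenched_stepsIn hω z] with x hx
      by_cases hz : z ∈ H
      · rw [Set.indicator_of_mem (fun i hi => by rw [Nat.le_zero.mp hi, hx.1]; exact hz), hx.1]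
        simp [killedMean, hz]
      · rw [Set.indicator_of_notMem (fun h : x ∈ stayUpTo H 0 => hz (hx.1 ▸ h 0 le_rfl))]
        simp [killedMean, hz]
    rw [integral_congr_ae this]
    simp
  | succ n ih =>
    have hmem : ∀ x, cons z x ∈ stayUpTo H (n + 1) ↔ z ∈ H ∧ x ∈ stayUpTo H n := by
      intro x
      constructor
      · exact fun h => ⟨h 0 (Nat.zero_le _), fun i hi => h (i + 1) (by omega)⟩
      · rintro ⟨h0, h⟩ (_ | i) hi
        · exact h0
        · exact h i (by omega)
    -- The condition on the starting site is folded into the set, so that one formula covers `z ∈ H`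
    -- and `z ∉ H` (where the set is empty).
    have hcons : ∀ x, (stayUpTo H (n + 1)).indicator (fun x => f (x (n + 1))) (cons z x)
        = (stayUpTo {y | z ∈ H ∧ y ∈ H} n).indicator (fun x => f (x n)) x := by
      intro x
      by_cases hz : z ∈ H
      · by_cases hx : x ∈ stayUpTo H n
        · rw [Set.indicator_of_mem ((hmem x).mpr ⟨hz, hx⟩),
            Set.indicator_of_mem (fun i hi => ⟨hz, hx i hi⟩)]
          rfl
        · rw [Set.indicator_of_notMem fun h => hx ((hmem x).mp h).2,
            Set.indicator_of_notMem fun h => hx fun i hi => (h i hi).2]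
      · rw [Set.indicator_of_notMem fun h => hz ((hmem x).mp h).1,
          Set.indicator_of_notMem fun h => hz (h 0 (Nat.zero_le _)).1]
    rw [integral_first_step hω z ((stronglyMeasurable_path f (n + 1)).indicator
      (measurableSet_stayUpTo H (n + 1)))]
    · simp only [hcons, killedMean]
      split_ifs with hz
      · simp only [hz, true_and]
        exact Finset.sum_congr rfl fun y _ => by rw [← ih (z + y)]; rfl
      · refine Finset.sum_eq_zero fun y _ => ?_
        have : stayUpTo {y | z ∈ H ∧ y ∈ H} n = ∅ :=
          Set.eq_empty_of_forall_notMem fun x h => hz (h 0 (Nat.zero_le _)).1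
        simp [this]
    · intro y _
      simp only [hcons]
      exact (integrable_path f n hω (z + y)).indicator (measurableSet_stayUpTo _ n)

variable {R ω} in
theorem integral_path [CompleteSpace E] (hω : HasRange R ω) (z : Site d) :
    ∫ x, f (x n) ∂(quenched z ω) = walkMean R ω f n z := by
  rw [walkMean, ← integral_stayUpTo Set.univ f n hω z]
  have : stayUpTo (Set.univ : Set (Site d)) n = Set.univ := by ext; simp [stayUpTo]
  simp [this]

variable {R ω} in
theorem quenchedMean_eq (hω : HasRange R ω) :
    quenchedMean ω n = walkMean R ω toE n 0 := integral_path toE n hω 0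

theorem stronglyMeasurable_increment {E : Type*} [TopologicalSpace E] {f : Site d → E} (m r : ℕ) :
    StronglyMeasurable fun x : Path d => f (x (m + r) - x m) := by
  have h : StronglyMeasurable fun q : Site d × Site d => f (q.1 - q.2) :=
    StronglyMeasurable.of_discrete
  have hm : Measurable fun x : Path d => (x (m + r), x m) :=
    (measurable_pi_apply (m + r)).prodMk (measurable_pi_apply m)
  exact h.comp_measurable hm

theorem stronglyMeasurable_walkMean_shift_path (ω : Env d) (m r : ℕ) :
    StronglyMeasurable fun x : Path d => walkMean R (shift (x m) ω) f r 0 := by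
  have h : StronglyMeasurable fun z : Site d => walkMean R (shift z ω) f r 0 :=
    StronglyMeasurable.of_discrete
  exact h.comp_measurable (measurable_pi_apply m)

variable {R ω f} in
/-- The Markov property at a fixed time. -/
theorem integral_walkMean_shift [CompleteSpace E] (hω : HasRange R ω) {C : ℝ} (hf : ∀ y, ‖f y‖ ≤ C) (m r : ℕ)
    (z : Site d) :
    ∫ x, walkMean R (shift (x m) ω) f r 0 ∂(quenched z ω)
      = ∫ x, f (x (m + r) - x m) ∂(quenched z ω) := by
  induction m generalizing z with
  | zero =>
    have h1 : ∀ᵐ x ∂(quenched z ω), walkMean R (shift (x 0) ω) f r 0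
        = walkMean R ω (fun y => f (y - z)) r z := by
      filter_upwards [quenched_stepsIn hω z] with x hx
      rw [hx.1, walkMean_shift, zero_add]
    have h2 : ∀ᵐ x ∂(quenched z ω), f (x (0 + r) - x 0) = (fun y => f (y - z)) (x r) := by
      filter_upwards [quenched_stepsIn hω z] with x hx
      rw [hx.1, Nat.zero_add]
    rw [integral_congr_ae h1, integral_congr_ae h2, integral_path (fun y => f (y - z)) r hω z]
    simp
  | succ m ih =>
    rw [integral_first_step hω z (stronglyMeasurable_walkMean_shift_path R f ω (m + 1) r),
      integral_first_step hω z (stronglyMeasurable_increment (m + 1) r)]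
    · refine Finset.sum_congr rfl fun y _ => ?_
      congr 1
      refine (ih (z + y)).trans (integral_congr_ae (ae_of_all _ fun x => ?_))
      simp only [show m + 1 + r = (m + r) + 1 by ring, cons]
    · intro y _
      refine Integrable.of_bound ?_ C (ae_of_all _ fun x => hf _)
      exact ((stronglyMeasurable_increment (m + 1) r).comp_measurable
        (measurable_cons z)).aestronglyMeasurable
    · intro y _
      refine Integrable.of_bound ?_ C (ae_of_all _ fun x => norm_killedMean_le _ _ _ _ _ hf)
      exact ((stronglyMeasurable_walkMean_shift_path R f ω (m + 1) r).comp_measurable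
        (measurable_cons z)).aestronglyMeasurable

theorem continuous_walkMean : Continuous fun ω : Env d => walkMean R ω f n x :=
  continuous_killedMean R Set.univ f n x

/-! ### Averaging the operators over the environment -/

variable (μ : Measure (JumpLaw d)) [IsProbabilityMeasure μ]

theorem integral_annealed {Φ : Path d → E} (hΦ : StronglyMeasurable Φ) {C : ℝ}
    (hC : ∀ x, ‖Φ x‖ ≤ C) :
    ∫ x, Φ x ∂(annealed μ) = ∫ ω, ∫ x, Φ x ∂(quenched 0 ω) ∂(iidEnv μ) := by
  rw [annealed, Measure.snd, integral_map measurable_snd.aemeasurable hΦ.aestronglyMeasurable,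
    averaged, Measure.integral_compProd]
  · rfl
  · exact Integrable.of_bound (hΦ.comp_measurable measurable_snd).aestronglyMeasurable C
      (ae_of_all _ fun q => hC _)

variable {R f} in
theorem integral_walkMean_envLaw_of_bounded [CompleteSpace E] (hR : ∀ᵐ ω ∂(iidEnv μ), HasRange R ω) {C : ℝ}
    (hf : ∀ y, ‖f y‖ ≤ C) (m r : ℕ) :
    ∫ ω, walkMean R ω f r 0 ∂(envLaw (iidEnv μ) m)
      = ∫ x, f (x (m + r) - x m) ∂(annealed μ) := by
  have hsm : StronglyMeasurable fun ω : Env d => walkMean R ω f r 0 :=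
    (continuous_walkMean R f r 0).stronglyMeasurable
  rw [envLaw, integral_map (measurable_shift_path m).aemeasurable hsm.aestronglyMeasurable,
    averaged, Measure.integral_compProd, integral_annealed μ (stronglyMeasurable_increment m r)
      fun x => hf _]
  · refine integral_congr_ae ?_
    filter_upwards [hR] with ω hω
    exact integral_walkMean_shift hω hf m r 0
  · exact Integrable.of_bound (hsm.comp_measurable (measurable_shift_path m)).aestronglyMeasurable C
      (ae_of_all _ fun q => norm_killedMean_le _ _ _ _ _ hf)

-- By the Markov property, a walk restarted in the environment seen at time `m` reproduces the
-- increments after `m`. Since `r` bounded steps reach finitely many sites, `f` can be cut off and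
-- need not be bounded.
variable {R} in
theorem integral_walkMean_envLaw [CompleteSpace E] (hR : ∀ᵐ ω ∂(iidEnv μ), HasRange R ω) (m r : ℕ) :
    ∫ ω, walkMean R ω f r 0 ∂(envLaw (iidEnv μ) m)
      = ∫ x, f (x (m + r) - x m) ∂(annealed μ) := by
  classical
  set f' : Site d → E := fun y => if y ∈ box d (R * r) then f y else 0
  have h1 : ∀ ω, walkMean R ω f r 0 = walkMean R ω f' r 0 := fun ω =>
    walkMean_congr R ω r 0 fun y hy => by simp only [f']; rw [if_pos (by simpa using hy)]
  have h2 : ∀ᵐ x ∂(annealed μ), f (x (m + r) - x m) = f' (x (m + r) - x m) := by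
    filter_upwards [annealed_stepsIn μ hR] with x hx
    simp only [f']; rw [if_pos (hx.sub_mem_box m r)]
  simp only [h1]
  rw [integral_congr_ae h2]
  refine integral_walkMean_envLaw_of_bounded μ hR (C := ∑ y ∈ box d (R * r), ‖f y‖) (fun y => ?_) m r
  simp only [f']
  split_ifs with hy
  · exact Finset.single_le_sum (f := fun y => ‖f y‖) (fun y _ => norm_nonneg _) hy
  · simpa using Finset.sum_nonneg fun y _ => norm_nonneg (f y)

end Operator

end RWRE

namespace RWRE

variable {d : ℕ} (μ : Measure (JumpLaw d)) [IsProbabilityMeasure μ]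

/-! ### Limits of Cesàro averages -/

/-- An estimate uniform in `m` survives both the averaging and the weak limit. The probability
estimates for the walk reach the limit law in this way. -/
theorem IsCesaroLimit.integral_le {P Q : Measure (Env d)} (h : IsCesaroLimit P Q)
    (F : Env d →ᵇ ℝ) {c : ℝ} (hF : ∀ m, ∫ ω, F ω ∂(envLaw P m) ≤ c) : ∫ ω, F ω ∂Q ≤ c := by
  obtain ⟨N, hN, hlim⟩ := h
  refine le_of_tendsto (hlim F) ?_
  filter_upwards [hN.tendsto_atTop.eventually_ge_atTop 1] with j hj
  have hj0 : (0 : ℝ) < N j := by exact_mod_cast hj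
  calc (N j : ℝ)⁻¹ * ∑ m ∈ Finset.Icc 1 (N j), ∫ ω, F ω ∂(envLaw P m)
      ≤ (N j : ℝ)⁻¹ * ∑ m ∈ Finset.Icc 1 (N j), c :=
        mul_le_mul_of_nonneg_left (Finset.sum_le_sum fun m _ => hF m) (by positivity)
    _ = c := by simp [hj0.ne']

theorem IsCesaroLimit.integral_eq {P Q : Measure (Env d)} (h : IsCesaroLimit P Q)
    (F : Env d →ᵇ ℝ) {c : ℝ} (hF : ∀ m, ∫ ω, F ω ∂(envLaw P m) = c) : ∫ ω, F ω ∂Q = c := by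
  refine le_antisymm (h.integral_le F fun m => (hF m).le) ?_
  have := h.integral_le (-F) (c := -c) fun m => by
    simp only [BoundedContinuousFunction.coe_neg, Pi.neg_apply, integral_neg, hF m]
    exact le_rfl
  simp only [BoundedContinuousFunction.coe_neg, Pi.neg_apply, integral_neg] at this
  linarith

theorem ae_envLaw_of_shift {p : Env d → Prop} {P : Measure (Env d)} [IsProbabilityMeasure P]
    (hp : MeasurableSet {ω | p ω}) (h : ∀ᵐ ω ∂P, ∀ z, p (shift z ω)) (m : ℕ) :
    ∀ᵐ ω ∂(envLaw P m), p ω := by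
  rw [envLaw, ae_map_iff (measurable_shift_path m).aemeasurable hp]
  have h1 : ∀ᵐ q ∂(averaged P 0), ∀ z, p (shift z q.1) := by
    have : (averaged P 0).map Prod.fst = P := by
      rw [← Measure.fst, averaged, Measure.fst_compProd]
    rw [← this] at h
    exact ae_of_ae_map measurable_fst.aemeasurable h
  filter_upwards [h1] with q hq using hq _

theorem integrable_of_continuous {E : Type*} [NormedAddCommGroup E] {Q : Measure (Env d)}
    [IsFiniteMeasure Q] {F : Env d → E} (hF : Continuous F) {C : ℝ} (hC : ∀ ω, ‖F ω‖ ≤ C) :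
    Integrable F Q :=
  Integrable.of_bound hF.stronglyMeasurable.aestronglyMeasurable C (ae_of_all _ hC)

/-- If a continuous function into `[0, 1]` equals `1` along the environment process, then it
equals `1` under the limiting law. -/
theorem IsCesaroLimit.ae_eq_one {P Q : Measure (Env d)} [IsProbabilityMeasure P]
    [IsProbabilityMeasure Q] (h : IsCesaroLimit P Q) {F : Env d → ℝ} (hF : Continuous F)
    (hF0 : ∀ ω, 0 ≤ F ω) (hF1 : ∀ ω, F ω ≤ 1) (hP : ∀ᵐ ω ∂P, ∀ z, F (shift z ω) = 1) :
    ∀ᵐ ω ∂Q, F ω = 1 := by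
  have hb : ∀ ω, ‖F ω‖ ≤ 1 := fun ω => by rw [Real.norm_of_nonneg (hF0 ω)]; exact hF1 ω
  have hP' : IsProbabilityMeasure (averaged P 0) := inferInstance
  have hint : ∫ ω, F ω ∂Q = 1 := by
    refine h.integral_eq (BoundedContinuousFunction.ofNormedAddCommGroup F hF 1 hb) fun m => ?_
    have := ae_envLaw_of_shift (p := fun ω => F ω = 1)
      (measurableSet_eq_fun hF.measurable measurable_const) hP m
    have hpm : IsProbabilityMeasure (envLaw P m) :=
      Measure.isProbabilityMeasure_map (measurable_shift_path m).aemeasurable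
    simp only [BoundedContinuousFunction.coe_ofNormedAddCommGroup]
    rw [integral_congr_ae this]
    simp
  have hi := integrable_of_continuous (Q := Q) hF hb
  have h0 : ∫ ω, (1 - F ω) ∂Q = 0 := by
    rw [integral_sub (integrable_const 1) hi, hint]; simp
  have := (integral_eq_zero_iff_of_nonneg (fun ω => sub_nonneg.mpr (hF1 ω))
    ((integrable_const 1).sub hi)).mp h0
  filter_upwards [this] with ω hω
  simp only [Pi.zero_apply] at hω
  linarith

theorem IsCesaroLimit.hasRange {Q : Measure (Env d)} [IsProbabilityMeasure Q]
    (h : IsCesaroLimit (iidEnv μ) Q) {R : ℕ} (hR : ∀ᵐ ω ∂(iidEnv μ), HasRange R ω) :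
    ∀ᵐ ω ∂Q, HasRange R ω := by
  have : ∀ x, ∀ᵐ ω ∂Q, ∑ z ∈ box d R, (ω x).1 z = 1 := by
    intro x
    refine h.ae_eq_one (F := fun ω => ∑ z ∈ box d R, (ω x).1 z)
      (continuous_finsetSum _ fun z _ => continuous_jumpLaw x z)
      (fun ω => Finset.sum_nonneg fun z _ => (ω x).2.1 z) (fun ω => sum_box_le_one R ω x) ?_
    filter_upwards [hR] with ω hω z using (hω.shift z).sum_eq_one x
  filter_upwards [ae_all_iff.mpr this] with ω hω using hasRange_of_sum_eq_one hω

/-- Functions of the environment far ahead have nearly the same mean in the stationary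
environment. -/
theorem IsCesaroLimit.integral_le_of_dependsOn {Q : Measure (Env d)}
    (h : IsCesaroLimit (iidEnv μ) Q) {R : ℕ} (hR : ∀ᵐ ω ∂(iidEnv μ), HasRange R ω)
    {u : Site d} {s : ℕ} (hs : 1 ≤ s) {b : ℝ} (hb0 : 0 ≤ b)
    (hb : regenTailSum μ u s ≤ ENNReal.ofReal b) {F : Env d → ℝ} (hF : Continuous F)
    (hdep : DependsOn F (halfSpace u (levelBound u R * s))) {C : ℝ} (hF0 : ∀ ω, 0 ≤ F ω)
    (hC : ∀ ω, F ω ≤ C) :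
    ∫ ω, F ω ∂Q ≤ ∫ ω, F ω ∂(iidEnv μ) + C * b := by
  have hC0 : 0 ≤ C := (hF0 fun _ => stayLaw d).trans (hC _)
  refine h.integral_le (BoundedContinuousFunction.ofNormedAddCommGroup F hF C fun ω => by
    rw [Real.norm_of_nonneg (hF0 ω)]; exact hC ω) fun m => ?_
  refine (integral_envLaw_le μ u _ m hF.measurable hdep hF0 hC).trans ?_
  gcongr
  exact ENNReal.toReal_le_of_le_ofReal hb0 ((annealed_backtracked_le μ hR u hs m).trans hb)

/-! ### The velocity -/

theorem integral_increment {R : ℕ} (hR : ∀ᵐ ω ∂(iidEnv μ), HasRange R ω) (m k : ℕ) :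
    ∫ x, toE (x (m + k) - x m) ∂(annealed μ)
      = averagedMean (iidEnv μ) (m + k) - averagedMean (iidEnv μ) m := by
  simp only [toE_sub]
  rw [integral_sub (integrable_toE_path μ hR _) (integrable_toE_path μ hR _), averagedMean_eq,
    averagedMean_eq]

/-- The mean drift under ℙ_m is E_0(X_{m+1}) - E_0(X_m), so the Cesàro sum telescopes. -/
theorem tendsto_averagedMean {Q : Measure (Env d)} [IsProbabilityMeasure Q]
    {R : ℕ} (hR : ∀ᵐ ω ∂(iidEnv μ), HasRange R ω) {N : ℕ → ℕ}
    (hQ : ∀ᵐ ω ∂Q, HasRange R ω)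
    (hlim : ∀ F : Env d →ᵇ ℝ,
      Tendsto (fun j => (N j : ℝ)⁻¹ * ∑ m ∈ Finset.Icc 1 (N j), ∫ ω, F ω ∂(envLaw (iidEnv μ) m))
        atTop (𝓝 (∫ ω, F ω ∂Q))) :
    Tendsto (fun j => (N j : ℝ)⁻¹ •
      (averagedMean (iidEnv μ) (N j + 1) - averagedMean (iidEnv μ) 1)) atTop
      (𝓝 (∫ ω, drift ω ∂Q)) := by
  set D : Env d → EuclideanSpace ℝ (Fin d) := fun ω => walkMean R ω toE 1 0
  have hDc : Continuous D := continuous_walkMean R toE 1 0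
  have hDb : ∀ ω, ‖D ω‖ ≤ d * R := by
    intro ω
    simp only [D, walkMean_succ, walkMean_zero, zero_add]
    calc ‖∑ z ∈ box d R, (ω 0).1 z • toE z‖ ≤ ∑ z ∈ box d R, (ω 0).1 z * (d * R) := by
          refine norm_sum_le_of_le _ fun z hz => ?_
          rw [norm_smul, Real.norm_of_nonneg ((ω 0).2.1 z)]
          exact mul_le_mul_of_nonneg_left (norm_toE_le hz) ((ω 0).2.1 z)
      _ = (∑ z ∈ box d R, (ω 0).1 z) * (d * R) := (Finset.sum_mul ..).symm
      _ ≤ 1 * (d * R) := mul_le_mul_of_nonneg_right (sum_box_le_one R ω 0) (by positivity)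
      _ = d * R := one_mul _
  have hDm : ∀ m, ∫ ω, D ω ∂(envLaw (iidEnv μ) m)
      = averagedMean (iidEnv μ) (m + 1) - averagedMean (iidEnv μ) m := fun m => by
    rw [← integral_increment μ hR m 1]
    exact integral_walkMean_envLaw toE μ hR m 1
  have hdrift : ∫ ω, drift ω ∂Q = ∫ ω, D ω ∂Q := by
    refine integral_congr_ae ?_
    filter_upwards [hQ] with ω hω using quenchedMean_eq 1 hω
  have hcoord : ∀ (Q : Measure (Env d)) [IsProbabilityMeasure Q] (i : Fin d),
      (∫ ω, D ω ∂Q) i = ∫ ω, D ω i ∂Q := by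
    intro Q _ i
    exact ((EuclideanSpace.proj (𝕜 := ℝ) i).integral_comp_comm
      (integrable_of_continuous (Q := Q) hDc hDb)).symm
  rw [hdrift]
  have hsum : ∀ n, averagedMean (iidEnv μ) (n + 1) - averagedMean (iidEnv μ) 1
      = ∑ m ∈ Finset.Icc 1 n, ∫ ω, D ω ∂(envLaw (iidEnv μ) m) := by
    intro n
    simp only [hDm]
    induction n with
    | zero => simp
    | succ n ih =>
      rw [Finset.sum_Icc_succ_top (by omega), ← ih]
      abel
  simp only [hsum]
  -- The weak limit is formulated with real test functions, so the vector drift is treated by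
  -- coordinates.
  have hpi : Tendsto (fun j => WithLp.ofLp ((N j : ℝ)⁻¹ • ∑ m ∈ Finset.Icc 1 (N j),
      ∫ ω, D ω ∂(envLaw (iidEnv μ) m))) atTop (𝓝 (WithLp.ofLp (∫ ω, D ω ∂Q))) := by
    rw [tendsto_pi_nhds]
    intro i
    have hb : ∀ ω, ‖D ω i‖ ≤ d * R := fun ω => (PiLp.norm_apply_le (D ω) i).trans (hDb ω)
    have hc : Continuous fun ω => D ω i := (EuclideanSpace.proj (𝕜 := ℝ) i).continuous.comp hDc
    have := hlim (BoundedContinuousFunction.ofNormedAddCommGroup (fun ω => D ω i) hc (d * R) hb)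
    simp only [BoundedContinuousFunction.coe_ofNormedAddCommGroup] at this
    rw [hcoord Q i]
    refine this.congr fun j => ?_
    simp only [PiLp.smul_apply, WithLp.ofLp_sum, Finset.sum_apply, smul_eq_mul, hcoord]
  exact (PiLp.continuous_toLp 2 _).tendsto _ |>.comp hpi

theorem exists_norm_averagedMean_sub_le {Q : Measure (Env d)} [IsProbabilityMeasure Q]
    (h : IsCesaroLimit (iidEnv μ) Q) {R : ℕ} (hR : ∀ᵐ ω ∂(iidEnv μ), HasRange R ω)
    {u : Site d} {p : ℝ} (hp : 3 < p) (hmom : RegenerationMoment (iidEnv μ) u p) :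
    ∃ C : ℝ, ∀ n : ℕ, ‖averagedMean (iidEnv μ) n - (n : ℝ) • ∫ ω, drift ω ∂Q‖ ≤ C := by
  obtain ⟨C, hC⟩ := exists_averagedMean_approx_additive μ hR hp hmom
  have hQ := h.hasRange μ hR
  obtain ⟨N, hN, hlim⟩ := h
  refine ⟨C, norm_sub_smul_le_of_approx_additive hC hN.tendsto_atTop ?_⟩
  have h1 := tendsto_averagedMean μ hR hQ hlim
  have hNr : Tendsto (fun j => (N j : ℝ)⁻¹ * C) atTop (𝓝 0) := by
    simpa using (tendsto_inv_atTop_zero.comp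
      (tendsto_natCast_atTop_atTop.comp hN.tendsto_atTop)).mul_const C
  -- Approximate additivity replaces the telescoped difference by the mean at `N j`, at a cost that
  -- vanishes after division by `N j`.
  have h2 : Tendsto (fun j => (N j : ℝ)⁻¹ • (averagedMean (iidEnv μ) (N j + 1)
      - averagedMean (iidEnv μ) (N j) - averagedMean (iidEnv μ) 1)) atTop (𝓝 0) := by
    refine squeeze_zero_norm (fun j => ?_) hNr
    rw [norm_smul, norm_inv, Real.norm_natCast]
    exact mul_le_mul_of_nonneg_left (hC _ _) (by positivity)
  have h3 := h1.sub h2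
  rw [sub_zero] at h3
  refine h3.congr fun j => ?_
  rw [← smul_sub]
  congr 1
  abel

end RWRE

namespace RWRE

variable {d : ℕ}

/-! ### The main estimate -/

section Deviation

variable (R : ℕ) (v : EuclideanSpace ℝ (Fin d)) (n : ℕ)

/-- The deviation of the mean displacement in `n` steps from `n v`, for the walk started at `x`. -/
noncomputable def deviation (ω : Env d) (x : Site d) : EuclideanSpace ℝ (Fin d) :=
  walkMean R ω (fun y => toE y - toE x - (n : ℝ) • v) n x

open Classical in
/-- The displacement from `x` minus `n v`, cut off outside the range of `n` steps. -/
noncomputable def cutDisplacement (x y : Site d) : EuclideanSpace ℝ (Fin d) :=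
  if y - x ∈ box d (R * n) then toE y - toE x - (n : ℝ) • v else 0

/-- A bound for the deviation that depends only on the environment in `H`. -/
noncomputable def localBound (H : Set (Site d)) (x : Site d) (ω : Env d) : ℝ :=
  2 * ‖killedMean R H ω (cutDisplacement R v n x) n x‖ ^ 2
    + 2 * ((d * R + ‖v‖) * n) ^ 2 * (1 - killedMean R H ω (fun _ => (1 : ℝ)) n x)

theorem norm_displacement_le {x y : Site d} (h : y - x ∈ box d (R * n)) :
    ‖toE y - toE x - (n : ℝ) • v‖ ≤ (d * R + ‖v‖) * n := by
  rw [← toE_sub]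
  refine (norm_sub_le _ _).trans ?_
  rw [norm_smul, Real.norm_natCast]
  have := norm_toE_le h
  push_cast at this
  linarith

theorem norm_cutDisplacement_le (x y : Site d) :
    ‖cutDisplacement R v n x y‖ ≤ (d * R + ‖v‖) * n := by
  rw [cutDisplacement]
  split_ifs with h
  · exact norm_displacement_le R v n h
  · rw [norm_zero]; positivity

/-- `n` steps cannot see the cut-off, and the cut displacement is bounded on all of ℤ^d, as the
comparison with the killed walk requires. -/
theorem deviation_eq (ω : Env d) (x : Site d) :
    deviation R v n ω x = walkMean R ω (cutDisplacement R v n x) n x :=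
  walkMean_congr R ω n x fun y hy => by rw [cutDisplacement, if_pos hy]

theorem norm_deviation_le (ω : Env d) (x : Site d) :
    ‖deviation R v n ω x‖ ≤ (d * R + ‖v‖) * n := by
  rw [deviation_eq]
  exact norm_killedMean_le _ _ _ _ _ (norm_cutDisplacement_le R v n x)

theorem continuous_deviation (x : Site d) : Continuous fun ω => deviation R v n ω x :=
  continuous_walkMean _ _ _ _

theorem deviation_shift (ω : Env d) (x : Site d) :
    deviation R v n ω x = deviation R v n (shift x ω) 0 := by
  rw [deviation, deviation, walkMean_shift, zero_add]
  simp only [toE_sub, toE_zero, sub_zero]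

variable {R} in
theorem deviation_zero {ω : Env d} (hω : HasRange R ω) :
    deviation R v n ω 0 = quenchedMean ω n - (n : ℝ) • v := by
  rw [deviation, quenchedMean_eq n hω]
  simp only [toE_zero, sub_zero]
  rw [walkMean_sub, walkMean_const _ _ hω]

variable {R} in
theorem walkMean_toE {ω : Env d} (hω : HasRange R ω) (x : Site d) :
    walkMean R ω toE n x = deviation R v n ω x + (toE x + (n : ℝ) • v) := by
  rw [deviation, walkMean_sub, walkMean_sub, walkMean_const _ _ hω, walkMean_const _ _ hω]
  abel

variable {R} in
theorem norm_walkMean_toE_sub_le {ω : Env d} (hω : HasRange R ω) (x : Site d) :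
    ‖walkMean R ω toE n x - toE x‖ ≤ d * R * n := by
  have := norm_walkMean_le (f := fun y => toE y - toE x) n x hω (C := d * R * n) fun y hy => by
    rw [← toE_sub]
    refine (norm_toE_le hy).trans (le_of_eq ?_)
    push_cast; ring
  rwa [walkMean_sub, walkMean_const _ _ hω] at this

variable {R} in
/-- Let the walk run for `r` steps before measuring its deviation. -/
theorem norm_sq_deviation_zero_le {ω : Env d} (hω : HasRange R ω) (r : ℕ) :
    ‖deviation R v n ω 0‖ ^ 2
      ≤ 8 * (d * R * r) ^ 2 + 2 * walkMean R ω (fun x => ‖deviation R v n ω x‖ ^ 2) r 0 := by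
  set b := deviation R v n ω
  have h1 : walkMean R ω toE (r + n) 0
      = walkMean R ω b r 0 + (walkMean R ω toE r 0 + (n : ℝ) • v) := by
    rw [walkMean_add_time]
    have : walkMean R ω toE n = fun x => b x + (toE x + (n : ℝ) • v) :=
      funext fun x => walkMean_toE v n hω x
    rw [this, walkMean_add, walkMean_add, walkMean_const _ _ hω]
  have h2 : ‖walkMean R ω toE (n + r) 0 - walkMean R ω toE n 0‖ ≤ d * R * r := by
    rw [walkMean_add_time, ← walkMean_sub]
    exact norm_walkMean_le _ n 0 hω fun y _ => norm_walkMean_toE_sub_le r hω y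
  have h3 : ‖walkMean R ω toE r 0‖ ≤ d * R * r := by
    have := norm_walkMean_toE_sub_le r hω (0 : Site d)
    rwa [toE_zero, sub_zero] at this
  -- The mean of X_{n+r} is computed twice: by conditioning on X_r, and by adding the last `r` steps
  -- to the mean of X_n. Both corrections are at most `d * R * r`.
  have h4 : b 0 = walkMean R ω b r 0 + walkMean R ω toE r 0
      - (walkMean R ω toE (n + r) 0 - walkMean R ω toE n 0) := by
    have := walkMean_toE v n hω (0 : Site d)
    rw [toE_zero, zero_add] at this
    rw [add_comm n r, h1, this]
    abel
  have h5 : ‖b 0‖ ≤ ‖walkMean R ω b r 0‖ + 2 * (d * R * r) := by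
    rw [h4]
    refine (norm_sub_le _ _).trans ?_
    have := norm_add_le (walkMean R ω b r 0) (walkMean R ω toE r 0)
    linarith
  have h6 := norm_sq_walkMean_le b r 0 hω
  have h7 : ‖b 0‖ ^ 2 ≤ (‖walkMean R ω b r 0‖ + 2 * (d * R * r)) ^ 2 :=
    pow_le_pow_left₀ (norm_nonneg _) h5 2
  have h8 := add_sq_le (a := ‖walkMean R ω b r 0‖) (b := 2 * (d * R * r : ℝ))
  linarith

theorem continuous_localBound (H : Set (Site d)) (x : Site d) :
    Continuous (localBound R v n H x) := by
  have h1 := continuous_killedMean R H (cutDisplacement R v n x) n x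
  have h2 := continuous_killedMean R H (fun _ => (1 : ℝ)) n x
  exact ((h1.norm.pow 2).const_mul 2).add ((continuous_const.sub h2).const_mul _)

theorem dependsOn_localBound (H : Set (Site d)) (x : Site d) :
    DependsOn (localBound R v n H x) H := by
  intro ω ω' h
  have h1 : killedMean R H ω (cutDisplacement R v n x) n x
      = killedMean R H ω' (cutDisplacement R v n x) n x := dependsOn_killedMean R H _ n x h
  have h2 : killedMean R H ω (fun _ => (1 : ℝ)) n x = killedMean R H ω' (fun _ => (1 : ℝ)) n x :=
    dependsOn_killedMean R H _ n x h
  rw [localBound, localBound, h1, h2]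

theorem localBound_nonneg (H : Set (Site d)) (x : Site d) (ω : Env d) :
    0 ≤ localBound R v n H x ω := by
  have := sub_nonneg.mpr (killedMean_one_mem R H ω n x).2
  rw [localBound]
  positivity

theorem localBound_le (H : Set (Site d)) (x : Site d) (ω : Env d) :
    localBound R v n H x ω ≤ 4 * ((d * R + ‖v‖) * n) ^ 2 := by
  have h1 := norm_killedMean_le R H ω n x (norm_cutDisplacement_le R v n x)
  have h2 := pow_le_pow_left₀ (norm_nonneg _) h1 2
  have h3 := (killedMean_one_mem R H ω n x).1
  have h4 : 0 ≤ 2 * ((d * R + ‖v‖) * n : ℝ) ^ 2 *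
    killedMean R H ω (fun _ => (1 : ℝ)) n x := by positivity
  rw [localBound]
  linarith

-- The true mean exceeds the killed one by at most L(1 - κ), where L bounds the displacement and κ
-- is the survival probability. Squaring gives the factors 2, and (1 - κ)² ≤ 1 - κ.
variable {R} in
theorem norm_sq_deviation_le_localBound {ω : Env d} (hω : HasRange R ω) (H : Set (Site d))
    (x : Site d) : ‖deviation R v n ω x‖ ^ 2 ≤ localBound R v n H x ω := by
  rw [deviation_eq, localBound]
  set L : ℝ := (d * R + ‖v‖) * n
  set κ := killedMean R H ω (fun _ => (1 : ℝ)) n x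
  set g := cutDisplacement R v n x
  have h1 : ‖walkMean R ω g n x - killedMean R H ω g n x‖ ≤ L * (1 - κ) :=
    norm_walkMean_sub_killedMean_le H n x hω (norm_cutDisplacement_le R v n x)
  have hκ := killedMean_one_mem R H ω n x
  have h2 : ‖walkMean R ω g n x‖ ≤ ‖killedMean R H ω g n x‖ + L * (1 - κ) := by
    have := norm_le_norm_add_norm_sub' (walkMean R ω g n x) (killedMean R H ω g n x)
    linarith
  have h3 := pow_le_pow_left₀ (norm_nonneg _) h2 2
  have h4 := add_sq_le (a := ‖killedMean R H ω g n x‖) (b := L * (1 - κ))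
  have h5 : (1 - κ) ^ 2 ≤ 1 - κ := by
    have := mul_le_mul_of_nonneg_left (by linarith [hκ.1] : 1 - κ ≤ 1) (sub_nonneg.mpr hκ.2)
    nlinarith
  have h6 := mul_le_mul_of_nonneg_left h5 (sq_nonneg L)
  rw [mul_pow] at h4
  linarith

-- The reverse comparison costs another factor 2: the doubled bound 2|dev|² + 2L²(1 - κ), plus the
-- term 2L²(1 - κ) already present, gives 4 and 6.
variable {R} in
theorem localBound_le_norm_sq_deviation {ω : Env d} (hω : HasRange R ω) (H : Set (Site d))
    (x : Site d) : localBound R v n H x ω ≤ 4 * ‖deviation R v n ω x‖ ^ 2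
      + 6 * ((d * R + ‖v‖) * n) ^ 2 * (1 - killedMean R H ω (fun _ => (1 : ℝ)) n x) := by
  rw [deviation_eq, localBound]
  set L : ℝ := (d * R + ‖v‖) * n
  set κ := killedMean R H ω (fun _ => (1 : ℝ)) n x
  set g := cutDisplacement R v n x
  have h1 : ‖walkMean R ω g n x - killedMean R H ω g n x‖ ≤ L * (1 - κ) :=
    norm_walkMean_sub_killedMean_le H n x hω (norm_cutDisplacement_le R v n x)
  have hκ := killedMean_one_mem R H ω n x
  have h2 : ‖killedMean R H ω g n x‖ ≤ ‖walkMean R ω g n x‖ + L * (1 - κ) := by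
    have := norm_le_norm_add_norm_sub (walkMean R ω g n x) (killedMean R H ω g n x)
    linarith
  have h3 := pow_le_pow_left₀ (norm_nonneg _) h2 2
  have h4 := add_sq_le (a := ‖walkMean R ω g n x‖) (b := L * (1 - κ))
  have h5 : (1 - κ) ^ 2 ≤ 1 - κ := by
    have := mul_le_mul_of_nonneg_left (by linarith [hκ.1] : 1 - κ ≤ 1) (sub_nonneg.mpr hκ.2)
    nlinarith
  have h6 := mul_le_mul_of_nonneg_left h5 (sq_nonneg L)
  rw [mul_pow] at h4
  linarith

open Classical in
/-- Split the walk after `r` steps according to whether it has reached level `q`. -/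
theorem walkMean_norm_sq_deviation_le {ω : Env d} (hω : HasRange R ω) (H : Set (Site d))
    (u : Site d) (r q : ℕ) :
    walkMean R ω (fun x => ‖deviation R v n ω x‖ ^ 2) r 0
      ≤ ∑ x ∈ (box d (R * r)).filter (fun x => (q : ℤ) ≤ x ⬝ᵥ u), localBound R v n H x ω
        + ((d * R + ‖v‖) * n) ^ 2 *
          walkMean R ω (fun x => if x ⬝ᵥ u < q then (1 : ℝ) else 0) r 0 := by
  set S := ∑ x ∈ (box d (R * r)).filter (fun x => (q : ℤ) ≤ x ⬝ᵥ u), localBound R v n H x ω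
  have hS : 0 ≤ S := Finset.sum_nonneg fun x _ => localBound_nonneg R v n H x ω
  rw [← walkMean_const_mul]
  have : S = walkMean R ω (fun _ => S) r 0 := (walkMean_const r 0 hω S).symm
  rw [this, ← walkMean_add]
  refine walkMean_mono R ω r 0 fun x hx => ?_
  rw [sub_zero] at hx
  by_cases hq : x ⬝ᵥ u < q
  · rw [if_pos hq, mul_one]
    have := pow_le_pow_left₀ (norm_nonneg _) (norm_deviation_le R v n ω x) 2
    linarith
  · rw [if_neg hq, mul_zero, add_zero]
    refine (norm_sq_deviation_le_localBound v n hω H x).trans ?_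
    -- The law of X_r depends on the same environment as the deviation there, so the weights are
    -- discarded in favour of a sum over the whole box. This produces the factor r^d.
    exact Finset.single_le_sum (f := fun x => localBound R v n H x ω)
      (fun x _ => localBound_nonneg R v n H x ω)
      (Finset.mem_filter.mpr ⟨hx, not_lt.mp hq⟩)

end Deviation

/-! ### Means of the deviation bounds under ℙ and under the limit law -/

variable (μ : Measure (JumpLaw d)) [IsProbabilityMeasure μ]

theorem integral_comp_shift {F : Env d → ℝ} (hF : Continuous F) (x : Site d) :
    ∫ ω, F (shift x ω) ∂(iidEnv μ) = ∫ ω, F ω ∂(iidEnv μ) := by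
  conv_rhs => rw [← (measurePreserving_shift μ x).map_eq]
  rw [integral_map (measurable_shift x).aemeasurable hF.stronglyMeasurable.aestronglyMeasurable]

/-- To leave the half-space from `x` the walk must descend more than `levelBound u R * s` below its
start; stationarity moves the start to the origin. -/
theorem integral_exit_le {R : ℕ} (hR : ∀ᵐ ω ∂(iidEnv μ), HasRange R ω) {u : Site d} {s n : ℕ}
    {b : ℝ} (hb0 : 0 ≤ b) (hb : regenTailSum μ u s ≤ ENNReal.ofReal b) {x : Site d}
    (hx : 2 * (levelBound u R * s : ℤ) ≤ x ⬝ᵥ u) :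
    ∫ ω, (1 - killedMean R (halfSpace u (levelBound u R * s)) ω (fun _ => (1 : ℝ)) n x) ∂(iidEnv μ)
      ≤ b := by
  set H := halfSpace u (levelBound u R * s)
  set H' : Set (Site d) := {y | y + x ∈ H}
  have hshift : ∀ ω, killedMean R H ω (fun _ => (1 : ℝ)) n x
      = killedMean R H' (shift x ω) (fun _ => (1 : ℝ)) n 0 := by
    intro ω
    rw [killedMean_shift, zero_add]
    have : {y | y - x ∈ H'} = H := by
      ext y
      simp [H']
    rw [this]
  have hc : Continuous fun ω => 1 - killedMean R H' ω (fun _ => (1 : ℝ)) n 0 :=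
    continuous_const.sub (continuous_killedMean R H' _ n 0)
  have h1 : ∫ ω, (1 - killedMean R H ω (fun _ => (1 : ℝ)) n x) ∂(iidEnv μ)
      = ∫ ω, (1 - killedMean R H' ω (fun _ => (1 : ℝ)) n 0) ∂(iidEnv μ) := by
    simp only [hshift]
    exact integral_comp_shift μ hc x
  have h2 : ∫ ω, (1 - killedMean R H' ω (fun _ => (1 : ℝ)) n 0) ∂(iidEnv μ)
      = ∫ ω, ∫ y, (stayUpTo H' n)ᶜ.indicator (fun _ => (1 : ℝ)) y ∂(quenched 0 ω) ∂(iidEnv μ) := by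
    refine integral_congr_ae ?_
    filter_upwards [hR] with ω hω
    rw [← integral_stayUpTo H' (fun _ => (1 : ℝ)) n hω 0,
      integral_indicator (measurableSet_stayUpTo H' n),
      integral_indicator (measurableSet_stayUpTo H' n).compl]
    simp only [setIntegral_const, smul_eq_mul, mul_one]
    rw [measureReal_compl (measurableSet_stayUpTo H' n), probReal_univ]
  have h3 : StronglyMeasurable ((stayUpTo H' n)ᶜ.indicator (fun _ : Path d => (1 : ℝ))) :=
    stronglyMeasurable_const.indicator (measurableSet_stayUpTo H' n).compl
  rw [h1, h2, ← integral_annealed μ h3 (C := 1) fun y => by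
    simp only [Set.indicator]; split_ifs <;> simp]
  rw [integral_indicator (measurableSet_stayUpTo H' n).compl]
  simp only [setIntegral_const, smul_eq_mul, mul_one]
  refine ENNReal.toReal_le_of_le_ofReal hb0 (le_trans (measure_mono ?_)
    ((annealed_not_stay_le μ hR u s n).trans hb))
  refine Set.compl_subset_compl.mpr fun y hy i hi => ?_
  have := hy i hi
  simp only [halfSpace, H', H, Set.mem_ofPred_eq, add_dotProduct] at this ⊢
  linarith

theorem integral_norm_sq_deviation {R : ℕ} (hR : ∀ᵐ ω ∂(iidEnv μ), HasRange R ω)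
    (v : EuclideanSpace ℝ (Fin d)) (n : ℕ) (x : Site d) :
    ∫ ω, ‖deviation R v n ω x‖ ^ 2 ∂(iidEnv μ)
      = ∫ ω, ‖quenchedMean ω n - (n : ℝ) • v‖ ^ 2 ∂(iidEnv μ) := by
  have hc : Continuous fun ω => ‖deviation R v n ω 0‖ ^ 2 := (continuous_deviation R v n 0).norm.pow 2
  have h1 : ∫ ω, ‖deviation R v n ω x‖ ^ 2 ∂(iidEnv μ)
      = ∫ ω, ‖deviation R v n ω 0‖ ^ 2 ∂(iidEnv μ) := by
    simp only [deviation_shift R v n _ x]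
    exact integral_comp_shift μ hc x
  rw [h1]
  refine integral_congr_ae ?_
  filter_upwards [hR] with ω hω
  rw [deviation_zero v n hω]

theorem integral_localBound_le {R : ℕ} (hR : ∀ᵐ ω ∂(iidEnv μ), HasRange R ω) {u : Site d}
    {s n : ℕ} {b : ℝ} (hb0 : 0 ≤ b) (hb : regenTailSum μ u s ≤ ENNReal.ofReal b)
    (v : EuclideanSpace ℝ (Fin d)) {x : Site d} (hx : 2 * (levelBound u R * s : ℤ) ≤ x ⬝ᵥ u) :
    ∫ ω, localBound R v n (halfSpace u (levelBound u R * s)) x ω ∂(iidEnv μ)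
      ≤ 4 * ∫ ω, ‖quenchedMean ω n - (n : ℝ) • v‖ ^ 2 ∂(iidEnv μ)
        + 6 * ((d * R + ‖v‖) * n) ^ 2 * b := by
  set H := halfSpace u (levelBound u R * s)
  set L : ℝ := (d * R + ‖v‖) * n
  have hi1 : Integrable (fun ω => ‖deviation R v n ω x‖ ^ 2) (iidEnv μ) := by
    refine integrable_of_continuous ((continuous_deviation R v n x).norm.pow 2) (C := L ^ 2)
      fun ω => ?_
    rw [norm_pow, norm_norm]
    exact pow_le_pow_left₀ (norm_nonneg _) (norm_deviation_le R v n ω x) 2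
  have hi2 : Integrable (fun ω => 1 - killedMean R H ω (fun _ => (1 : ℝ)) n x) (iidEnv μ) := by
    refine integrable_of_continuous (continuous_const.sub (continuous_killedMean R H _ n x))
      (C := 1) fun ω => ?_
    have := killedMean_one_mem R H ω n x
    rw [Real.norm_of_nonneg (sub_nonneg.mpr this.2)]
    linarith [this.1]
  calc ∫ ω, localBound R v n H x ω ∂(iidEnv μ)
      ≤ ∫ ω, (4 * ‖deviation R v n ω x‖ ^ 2
          + 6 * L ^ 2 * (1 - killedMean R H ω (fun _ => (1 : ℝ)) n x)) ∂(iidEnv μ) := by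
        refine integral_mono_of_nonneg (ae_of_all _ fun ω => localBound_nonneg R v n H x ω)
          ((hi1.const_mul 4).add (hi2.const_mul (6 * L ^ 2))) ?_
        filter_upwards [hR] with ω hω using localBound_le_norm_sq_deviation v n hω H x
    _ = 4 * ∫ ω, ‖deviation R v n ω x‖ ^ 2 ∂(iidEnv μ) + 6 * L ^ 2 *
          ∫ ω, (1 - killedMean R H ω (fun _ => (1 : ℝ)) n x) ∂(iidEnv μ) := by
        rw [integral_add (hi1.const_mul 4) (hi2.const_mul (6 * L ^ 2)), integral_const_mul,
          integral_const_mul]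
    _ ≤ _ := by
        rw [integral_norm_sq_deviation μ hR v n x]
        gcongr
        exact integral_exit_le μ hR hb0 hb hx

-- Under each ℙ_m this is the probability that the averaged walk gains fewer than `q` levels in the
-- `q * s` steps after time `m`; the bound is uniform in `m`, so it passes to the limit.
open Classical in
theorem integral_walkMean_lt_le {Q : Measure (Env d)} (h : IsCesaroLimit (iidEnv μ) Q) {R : ℕ}
    (hR : ∀ᵐ ω ∂(iidEnv μ), HasRange R ω) {u : Site d} {s : ℕ} {b : ℝ} (hb0 : 0 ≤ b)
    (hb : regenTailSum μ u s ≤ ENNReal.ofReal b) (q : ℕ) :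
    ∫ ω, walkMean R ω (fun x => if x ⬝ᵥ u < q then (1 : ℝ) else 0) (q * s) 0 ∂Q ≤ q * b := by
  set f : Site d → ℝ := fun x => if x ⬝ᵥ u < q then (1 : ℝ) else 0 with hf
  have hf1 : ∀ y, ‖f y‖ ≤ 1 := fun y => by simp only [hf]; split_ifs <;> simp
  have hw : ∀ ω : Env d, ‖walkMean R ω f (q * s) 0‖ ≤ 1 := fun ω =>
    norm_killedMean_le _ _ _ _ _ hf1
  refine h.integral_le (BoundedContinuousFunction.ofNormedAddCommGroup _
    (continuous_walkMean R f (q * s) 0) 1 hw) fun m => ?_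
  simp only [BoundedContinuousFunction.coe_ofNormedAddCommGroup]
  rw [integral_walkMean_envLaw f μ hR m (q * s)]
  have hm : MeasurableSet {x : Path d | x (m + q * s) ⬝ᵥ u - x m ⬝ᵥ u < q} :=
    measurableSet_lt ((measurable_level u _).sub (measurable_level u m)) measurable_const
  have : ∀ x : Path d, f (x (m + q * s) - x m)
      = {x : Path d | x (m + q * s) ⬝ᵥ u - x m ⬝ᵥ u < q}.indicator (fun _ => (1 : ℝ)) x := by
    intro x
    simp only [hf, Set.indicator, Set.mem_ofPred_eq, sub_dotProduct]
  simp only [this]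
  rw [integral_indicator hm]
  simp only [setIntegral_const, smul_eq_mul, mul_one]
  refine ENNReal.toReal_le_of_le_ofReal (by positivity) ?_
  refine (annealed_displacement_lt_le μ u m q s).trans ?_
  rw [ENNReal.ofReal_mul (by positivity), ENNReal.ofReal_natCast]
  gcongr

/-- The level `q` is twice the buffer `levelBound u R * s`. One buffer separates the origin from the
half-space where the environment is nearly i.i.d.; the other separates the new starting sites from
the boundary of that half-space, so that exits are rare. -/
theorem integral_norm_sq_sub_le {Q : Measure (Env d)} [IsProbabilityMeasure Q]
    (h : IsCesaroLimit (iidEnv μ) Q) {R : ℕ} (hR : ∀ᵐ ω ∂(iidEnv μ), HasRange R ω) {u : Site d}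
    {s : ℕ} (hs : 1 ≤ s) {b : ℝ} (hb0 : 0 ≤ b) (hb : regenTailSum μ u s ≤ ENNReal.ofReal b)
    (v : EuclideanSpace ℝ (Fin d)) (n : ℕ) {q r : ℕ} (hq : q = 2 * (levelBound u R * s))
    (hr : r = q * s) :
    ∫ ω, ‖quenchedMean ω n - (n : ℝ) • v‖ ^ 2 ∂Q
      ≤ 8 * (d * R * r) ^ 2 + 2 * ((2 * (R * r) + 1 : ℕ) ^ d *
          (4 * ∫ ω, ‖quenchedMean ω n - (n : ℝ) • v‖ ^ 2 ∂(iidEnv μ)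
            + 10 * ((d * R + ‖v‖) * n) ^ 2 * b) + ((d * R + ‖v‖) * n) ^ 2 * (q * b)) := by
  classical
  set H := halfSpace u (levelBound u R * s)
  set L : ℝ := (d * R + ‖v‖) * n
  set V := ∫ ω, ‖quenchedMean ω n - (n : ℝ) • v‖ ^ 2 ∂(iidEnv μ)
  have hV : 0 ≤ V := integral_nonneg fun ω => by positivity
  set X := (box d (R * r)).filter (fun x => (q : ℤ) ≤ x ⬝ᵥ u)
  set f : Site d → ℝ := fun x => if x ⬝ᵥ u < q then (1 : ℝ) else 0 with hf
  have hf1 : ∀ y, ‖f y‖ ≤ 1 := fun y => by simp only [hf]; split_ifs <;> simp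
  have hi1 : ∀ x ∈ X, Integrable (localBound R v n H x) Q := fun x _ =>
    integrable_of_continuous (continuous_localBound R v n H x) (C := 4 * L ^ 2) fun ω => by
      rw [Real.norm_of_nonneg (localBound_nonneg R v n H x ω)]
      exact localBound_le R v n H x ω
  have hi2 : Integrable (fun ω => walkMean R ω f r 0) Q :=
    integrable_of_continuous (continuous_walkMean R f r 0) (C := 1) fun ω =>
      norm_killedMean_le _ _ _ _ _ hf1
  have hi3 : Integrable (fun ω => ∑ x ∈ X, localBound R v n H x ω) Q := integrable_finsetSum X hi1
  have hi4 : Integrable (fun ω => ∑ x ∈ X, localBound R v n H x ω + L ^ 2 * walkMean R ω f r 0) Q :=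
    hi3.add (hi2.const_mul _)
  have hcard : (X.card : ℝ) ≤ (2 * (R * r) + 1 : ℕ) ^ d := by
    have : X.card ≤ (2 * (R * r) + 1) ^ d := by
      rw [← card_box]; exact Finset.card_filter_le _ _
    exact_mod_cast this
  calc ∫ ω, ‖quenchedMean ω n - (n : ℝ) • v‖ ^ 2 ∂Q
      ≤ ∫ ω, (8 * (d * R * r) ^ 2 + 2 * (∑ x ∈ X, localBound R v n H x ω
          + L ^ 2 * walkMean R ω f r 0)) ∂Q := by
        refine integral_mono_of_nonneg (ae_of_all _ fun ω => by positivity)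
          ((integrable_const _).add (hi4.const_mul 2)) ?_
        filter_upwards [h.hasRange μ hR] with ω hω
        rw [← deviation_zero v n hω]
        have h1 := norm_sq_deviation_zero_le v n hω r
        have h2 := walkMean_norm_sq_deviation_le R v n hω H u r q
        linarith
    _ = 8 * (d * R * r) ^ 2 + 2 * (∑ x ∈ X, ∫ ω, localBound R v n H x ω ∂Q
          + L ^ 2 * ∫ ω, walkMean R ω f r 0 ∂Q) := by
        rw [integral_add (integrable_const _) (hi4.const_mul 2), integral_const, probReal_univ,
          one_smul, integral_const_mul, integral_add hi3 (hi2.const_mul _), integral_const_mul,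
          integral_finsetSum X hi1]
    _ ≤ 8 * (d * R * r) ^ 2 + 2 * (∑ x ∈ X, (4 * V + 10 * L ^ 2 * b) + L ^ 2 * (q * b)) := by
        gcongr with x hx
        -- The 10 is 4 + 6: passing from the limit law to ℙ costs `4 * L ^ 2 * b`, and exits under ℙ
        -- cost `6 * L ^ 2 * b`.
        · have h1 := h.integral_le_of_dependsOn μ hR hs hb0 hb (continuous_localBound R v n H x)
            (dependsOn_localBound R v n H x) (localBound_nonneg R v n H x)
            (localBound_le R v n H x)
          have h2 := integral_localBound_le μ hR (n := n) hb0 hb v (x := x) (by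
            have := (Finset.mem_filter.mp hx).2
            rw [hq] at this
            push_cast at this
            exact this)
          linarith
        · rw [hr]
          exact integral_walkMean_lt_le μ h hR hb0 hb q
    _ ≤ _ := by
        rw [Finset.sum_const, nsmul_eq_mul]
        gcongr

end RWRE

namespace RWRE

variable {d : ℕ} (μ : Measure (JumpLaw d)) [IsProbabilityMeasure μ]

/-! ### Vanishing variance of the quenched mean forces a constant drift -/

theorem sq_integral_le {Ω : Type*} [MeasurableSpace Ω] {P : Measure Ω} [IsProbabilityMeasure P]
    {f : Ω → ℝ} (hf : Integrable f P) (hf2 : Integrable (fun ω => f ω ^ 2) P) :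
    (∫ ω, f ω ∂P) ^ 2 ≤ ∫ ω, f ω ^ 2 ∂P :=
  (even_two.convexOn_pow (𝕜 := ℝ)).map_integral_le (by fun_prop) isClosed_univ
    (ae_of_all _ fun _ => Set.mem_univ _) hf hf2

/-- Replacing an arbitrary centre `c` by the mean costs at most a constant factor, so that a centre
depending on `n` can be exchanged for a fixed one. -/
theorem integral_norm_sq_sub_integral_le {Ω E : Type*} [MeasurableSpace Ω] {P : Measure Ω}
    [IsProbabilityMeasure P] [NormedAddCommGroup E] [NormedSpace ℝ E] [CompleteSpace E]
    {f : Ω → E} {C : ℝ} (hf : AEStronglyMeasurable f P) (hC : ∀ ω, ‖f ω‖ ≤ C) (c : E) :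
    ∫ ω, ‖f ω - ∫ ω', f ω' ∂P‖ ^ 2 ∂P ≤ 4 * ∫ ω, ‖f ω - c‖ ^ 2 ∂P := by
  set w := ∫ ω', f ω' ∂P
  have hi : Integrable f P := Integrable.of_bound hf C (ae_of_all _ hC)
  have hi1 : Integrable (fun ω => f ω - c) P := hi.sub (integrable_const c)
  have hi2 : Integrable (fun ω => ‖f ω - c‖ ^ 2) P := by
    refine Integrable.of_bound (hi1.aestronglyMeasurable.norm.pow 2) ((C + ‖c‖) ^ 2)
      (ae_of_all _ fun ω => ?_)
    rw [norm_pow, norm_norm]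
    exact pow_le_pow_left₀ (norm_nonneg _) ((norm_sub_le _ _).trans (by linarith [hC ω])) 2
  have h1 : ‖w - c‖ ^ 2 ≤ ∫ ω, ‖f ω - c‖ ^ 2 ∂P := by
    have : w - c = ∫ ω, (f ω - c) ∂P := by
      rw [integral_sub hi (integrable_const c)]; simp [w]
    rw [this]
    exact (pow_le_pow_left₀ (norm_nonneg _) (norm_integral_le_integral_norm _) 2).trans
      (sq_integral_le hi1.norm hi2)
  calc ∫ ω, ‖f ω - w‖ ^ 2 ∂P ≤ ∫ ω, (2 * ‖f ω - c‖ ^ 2 + 2 * ‖w - c‖ ^ 2) ∂P := by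
        refine integral_mono_of_nonneg (ae_of_all _ fun ω => by positivity)
          ((hi2.const_mul 2).add (integrable_const _)) (ae_of_all _ fun ω => ?_)
        have h2 : ‖f ω - w‖ ≤ ‖f ω - c‖ + ‖w - c‖ := by
          rw [← sub_sub_sub_cancel_right (f ω) w c]; exact norm_sub_le _ _
        have h3 := pow_le_pow_left₀ (norm_nonneg _) h2 2
        have h4 := add_sq_le (a := ‖f ω - c‖) (b := ‖w - c‖)
        dsimp only
        linarith
    _ = 2 * ∫ ω, ‖f ω - c‖ ^ 2 ∂P + 2 * ‖w - c‖ ^ 2 := by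
        rw [integral_add (hi2.const_mul 2) (integrable_const _), integral_const_mul]; simp
    _ ≤ _ := by linarith

/-- The local drift is `deviation R 0 1`; it is nearly constant if the quenched means are. -/
theorem norm_sq_drift_sub_le {R : ℕ} {ω : Env d} (hω : HasRange R ω) (n : ℕ)
    (m m' : EuclideanSpace ℝ (Fin d)) :
    ‖deviation R 0 1 ω 0 - (m' - m)‖ ^ 2 ≤ 2 * ‖deviation R 0 (n + 1) ω 0 - m'‖ ^ 2
      + 2 * ∑ z ∈ box d R, ‖deviation R 0 n ω z - m‖ ^ 2 := by
  have hA : ∀ n x, walkMean R ω toE n x = deviation R 0 n ω x + toE x := fun n x => by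
    rw [walkMean_toE 0 n hω, smul_zero, add_zero]
  -- Decomposition at the first step: the quenched mean after `n + 1` steps is the local drift plus
  -- the average of the `n`-step deviations at the neighbours, so near-constancy of the other terms
  -- forces that of the drift.
  have h1 : deviation R 0 (n + 1) ω 0
      = walkMean R ω (fun z => deviation R 0 n ω z - m) 1 0 + m + deviation R 0 1 ω 0 := by
    have h2 : walkMean R ω toE (n + 1) 0 = deviation R 0 (n + 1) ω 0 := by
      rw [hA, toE_zero, add_zero]
    have h3 : walkMean R ω toE 1 0 = deviation R 0 1 ω 0 := by rw [hA, toE_zero, add_zero]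
    rw [← h2, ← h3, add_comm n 1, walkMean_add_time, walkMean_sub, walkMean_const _ _ hω,
      sub_add_cancel, ← walkMean_add]
    congr 1
    funext x
    exact hA n x
  have h4 : deviation R 0 1 ω 0 - (m' - m) = (deviation R 0 (n + 1) ω 0 - m')
      - walkMean R ω (fun z => deviation R 0 n ω z - m) 1 0 := by
    rw [h1]; abel
  have h5 : walkMean R ω (fun z => ‖deviation R 0 n ω z - m‖ ^ 2) 1 0
      ≤ ∑ z ∈ box d R, ‖deviation R 0 n ω z - m‖ ^ 2 := by
    simp only [walkMean_succ, walkMean_zero, zero_add, smul_eq_mul]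
    refine Finset.sum_le_sum fun z hz => mul_le_of_le_one_left (by positivity) ?_
    exact (Finset.single_le_sum (fun y _ => (ω 0).2.1 y) hz).trans (sum_box_le_one R ω 0)
  have h6 := norm_sq_walkMean_le (fun z => deviation R 0 n ω z - m) 1 0 hω
  rw [h4]
  have h7 := pow_le_pow_left₀ (norm_nonneg _) (norm_sub_le (deviation R 0 (n + 1) ω 0 - m')
    (walkMean R ω (fun z => deviation R 0 n ω z - m) 1 0)) 2
  have h8 := add_sq_le (a := ‖deviation R 0 (n + 1) ω 0 - m'‖)
    (b := ‖walkMean R ω (fun z => deviation R 0 n ω z - m) 1 0‖)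
  linarith

theorem integrable_norm_sq_deviation_sub (R n : ℕ) (x : Site d)
    (v m : EuclideanSpace ℝ (Fin d)) {P : Measure (Env d)} [IsFiniteMeasure P] :
    Integrable (fun ω => ‖deviation R v n ω x - m‖ ^ 2) P := by
  refine integrable_of_continuous (((continuous_deviation R v n x).sub continuous_const).norm.pow 2)
    (C := ((d * R + ‖v‖) * n + ‖m‖) ^ 2) fun ω => ?_
  rw [norm_pow, norm_norm]
  refine pow_le_pow_left₀ (norm_nonneg _) ((norm_sub_le _ _).trans ?_) 2
  linarith [norm_deviation_le R v n ω x]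

theorem integral_norm_sq_drift_sub_le {R : ℕ} (hR : ∀ᵐ ω ∂(iidEnv μ), HasRange R ω) (n : ℕ)
    (m m' : EuclideanSpace ℝ (Fin d)) :
    ∫ ω, ‖deviation R 0 1 ω 0 - (m' - m)‖ ^ 2 ∂(iidEnv μ)
      ≤ 2 * ∫ ω, ‖quenchedMean ω (n + 1) - m'‖ ^ 2 ∂(iidEnv μ)
        + 2 * ((box d R).card * ∫ ω, ‖quenchedMean ω n - m‖ ^ 2 ∂(iidEnv μ)) := by
  have hi := fun (n : ℕ) (x : Site d) (m : EuclideanSpace ℝ (Fin d)) =>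
    integrable_norm_sq_deviation_sub R n x 0 m (P := iidEnv μ)
  have heq : ∀ (n : ℕ) (x : Site d) (m : EuclideanSpace ℝ (Fin d)),
      ∫ ω, ‖deviation R 0 n ω x - m‖ ^ 2 ∂(iidEnv μ)
        = ∫ ω, ‖quenchedMean ω n - m‖ ^ 2 ∂(iidEnv μ) := by
    intro n x m
    have h1 : ∫ ω, ‖deviation R 0 n ω x - m‖ ^ 2 ∂(iidEnv μ)
        = ∫ ω, ‖deviation R 0 n ω 0 - m‖ ^ 2 ∂(iidEnv μ) := by
      simp only [deviation_shift R 0 n _ x]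
      exact integral_comp_shift μ (((continuous_deviation R 0 n 0).sub
        continuous_const).norm.pow 2) x
    rw [h1]
    refine integral_congr_ae ?_
    filter_upwards [hR] with ω hω
    rw [deviation_zero 0 n hω, smul_zero, sub_zero]
  have hi2 : Integrable (fun ω => ∑ z ∈ box d R, ‖deviation R 0 n ω z - m‖ ^ 2) (iidEnv μ) :=
    integrable_finsetSum _ fun z _ => hi n z m
  calc ∫ ω, ‖deviation R 0 1 ω 0 - (m' - m)‖ ^ 2 ∂(iidEnv μ)
      ≤ ∫ ω, (2 * ‖deviation R 0 (n + 1) ω 0 - m'‖ ^ 2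
          + 2 * ∑ z ∈ box d R, ‖deviation R 0 n ω z - m‖ ^ 2) ∂(iidEnv μ) := by
        refine integral_mono_of_nonneg (ae_of_all _ fun ω => by positivity)
          (((hi (n + 1) 0 m').const_mul 2).add (hi2.const_mul 2)) ?_
        filter_upwards [hR] with ω hω using norm_sq_drift_sub_le hω n m m'
    _ = _ := by
        rw [integral_add ((hi (n + 1) 0 m').const_mul 2) (hi2.const_mul 2), integral_const_mul,
          integral_const_mul, integral_finsetSum _ fun z _ => hi n z m]
        simp only [heq, Finset.sum_const, nsmul_eq_mul]

theorem ae_drift_eq_of_tendsto {R : ℕ} (hR : ∀ᵐ ω ∂(iidEnv μ), HasRange R ω)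
    (hvar : Tendsto (fun n : ℕ => ∫ ω, ‖quenchedMean ω n - averagedMean (iidEnv μ) n‖ ^ 2
      ∂(iidEnv μ)) atTop (𝓝 0)) :
    ∃ w : EuclideanSpace ℝ (Fin d), ∀ᵐ ω ∂(iidEnv μ), deviation R 0 1 ω 0 = w := by
  set w := ∫ ω, deviation R 0 1 ω 0 ∂(iidEnv μ)
  refine ⟨w, ?_⟩
  have hle : ∀ n : ℕ, ∫ ω, ‖deviation R 0 1 ω 0 - w‖ ^ 2 ∂(iidEnv μ)
      ≤ 4 * (2 * ∫ ω, ‖quenchedMean ω (n + 1) - averagedMean (iidEnv μ) (n + 1)‖ ^ 2 ∂(iidEnv μ)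
        + 2 * ((box d R).card *
          ∫ ω, ‖quenchedMean ω n - averagedMean (iidEnv μ) n‖ ^ 2 ∂(iidEnv μ))) := by
    intro n
    refine (integral_norm_sq_sub_integral_le
      (continuous_deviation R 0 1 0).stronglyMeasurable.aestronglyMeasurable
      (fun ω => norm_deviation_le R 0 1 ω 0)
      (averagedMean (iidEnv μ) (n + 1) - averagedMean (iidEnv μ) n)).trans ?_
    exact mul_le_mul_of_nonneg_left (integral_norm_sq_drift_sub_le μ hR n _ _) (by norm_num)
  have hlim := (((hvar.comp (tendsto_add_atTop_nat 1)).const_mul 2).add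
    ((hvar.const_mul ((box d R).card : ℝ)).const_mul 2)).const_mul 4
  simp only [mul_zero, add_zero] at hlim
  have h0 : ∫ ω, ‖deviation R 0 1 ω 0 - w‖ ^ 2 ∂(iidEnv μ) = 0 :=
    le_antisymm (ge_of_tendsto' hlim hle) (integral_nonneg fun ω => by positivity)
  have := (integral_eq_zero_iff_of_nonneg (fun ω => by positivity)
    (integrable_norm_sq_deviation_sub R 1 0 0 w)).mp h0
  filter_upwards [this] with ω hω
  simpa [sub_eq_zero] using hω

/-- The drift is constant at every site under ℙ, hence under the limit law, and then every quenched
mean is exactly linear in `n`. -/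
theorem integral_eq_zero_of_tendsto {Q : Measure (Env d)} [IsProbabilityMeasure Q]
    (h : IsCesaroLimit (iidEnv μ) Q) {R : ℕ} (hR : ∀ᵐ ω ∂(iidEnv μ), HasRange R ω)
    (hvar : Tendsto (fun n : ℕ => ∫ ω, ‖quenchedMean ω n - averagedMean (iidEnv μ) n‖ ^ 2
      ∂(iidEnv μ)) atTop (𝓝 0)) (n : ℕ) :
    ∫ ω, ‖quenchedMean ω n - (n : ℝ) • ∫ ω', drift ω' ∂Q‖ ^ 2 ∂Q = 0 := by
  obtain ⟨w, hw⟩ := ae_drift_eq_of_tendsto μ hR hvar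
  have hall : ∀ᵐ ω ∂(iidEnv μ), ∀ x, deviation R 0 1 ω x = w := by
    refine ae_all_iff.mpr fun x => ?_
    filter_upwards [(measurePreserving_shift μ x).quasiMeasurePreserving.ae hw] with ω hω
    rw [deviation_shift]; exact hω
  have hQ : ∀ᵐ ω ∂Q, ∀ x, deviation R 0 1 ω x = w := by
    refine ae_all_iff.mpr fun x => ?_
    -- A continuous [0, 1]-valued function that equals 1 exactly where the drift is `w`.
    have hF : Continuous fun ω => max 0 (1 - ‖deviation R 0 1 ω x - w‖) :=
      continuous_const.max (continuous_const.sub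
        ((continuous_deviation R 0 1 x).sub continuous_const).norm)
    have := h.ae_eq_one hF (fun ω => le_max_left _ _)
      (fun ω => max_le zero_le_one (by linarith [norm_nonneg (deviation R 0 1 ω x - w)])) ?_
    · filter_upwards [this] with ω hω
      by_contra hne
      have hpos := norm_pos_iff.mpr (sub_ne_zero.mpr hne)
      have : max 0 (1 - ‖deviation R 0 1 ω x - w‖) < 1 := max_lt zero_lt_one (by linarith)
      linarith
    · filter_upwards [hall] with ω hω z
      have hz : deviation R 0 1 (shift z ω) x = w := by
        rw [deviation_shift, ← hω (x + z), deviation_shift R 0 1 ω (x + z)]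
        congr 1
        funext y
        simp only [shift, add_assoc]
      simp [hz]
  have hmean : ∀ᵐ ω ∂Q, ∀ n, quenchedMean ω n = (n : ℝ) • w := by
    filter_upwards [hQ, h.hasRange μ hR] with ω hω hωR n
    rw [quenchedMean_eq n hωR]
    induction n with
    | zero => simp [toE_zero]
    | succ n ih =>
      have : walkMean R ω toE 1 = fun x => toE x + w := by
        funext x
        rw [walkMean_toE 0 1 hωR, hω x, smul_zero, add_zero, add_comm]
      rw [walkMean_add_time, this, walkMean_add, walkMean_const _ _ hωR, ih]
      push_cast
      rw [add_smul, one_smul]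
  have hdrift : ∫ ω, drift ω ∂Q = w := by
    have : ∀ᵐ ω ∂Q, drift ω = w := by
      filter_upwards [hmean] with ω hω
      rw [drift, hω 1]; simp
    rw [integral_congr_ae this]; simp
  rw [hdrift]
  refine integral_eq_zero_of_ae ?_
  filter_upwards [hmean] with ω hω
  simp [hω n]

end RWRE

namespace RWRE

variable {d : ℕ} (μ : Measure (JumpLaw d)) [IsProbabilityMeasure μ]

/-! ### Rates -/

theorem integral_norm_sq_quenchedMean_sub_le {R : ℕ} (hR : ∀ᵐ ω ∂(iidEnv μ), HasRange R ω)
    (n : ℕ) (m w : EuclideanSpace ℝ (Fin d)) :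
    ∫ ω, ‖quenchedMean ω n - w‖ ^ 2 ∂(iidEnv μ)
      ≤ 2 * ∫ ω, ‖quenchedMean ω n - m‖ ^ 2 ∂(iidEnv μ) + 2 * ‖m - w‖ ^ 2 := by
  have hi : Integrable (fun ω => ‖quenchedMean ω n - m‖ ^ 2) (iidEnv μ) := by
    refine (integrable_norm_sq_deviation_sub R n 0 0 m (P := iidEnv μ)).congr ?_
    filter_upwards [hR] with ω hω
    rw [deviation_zero 0 n hω, smul_zero, sub_zero]
  calc ∫ ω, ‖quenchedMean ω n - w‖ ^ 2 ∂(iidEnv μ)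
      ≤ ∫ ω, (2 * ‖quenchedMean ω n - m‖ ^ 2 + 2 * ‖m - w‖ ^ 2) ∂(iidEnv μ) := by
        refine integral_mono_of_nonneg (ae_of_all _ fun ω => by positivity)
          ((hi.const_mul 2).add (integrable_const _)) (ae_of_all _ fun ω => ?_)
        have h2 : ‖quenchedMean ω n - w‖ ≤ ‖quenchedMean ω n - m‖ + ‖m - w‖ :=
          norm_sub_le_norm_sub_add_norm_sub _ _ _
        have h3 := pow_le_pow_left₀ (norm_nonneg _) h2 2
        have h4 := add_sq_le (a := ‖quenchedMean ω n - m‖) (b := ‖m - w‖)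
        dsimp only
        linarith
    _ = _ := by
        rw [integral_add (hi.const_mul 2) (integrable_const _), integral_const_mul]; simp

/-- With b = T s^(1-p), both b and qb are at most a constant times s^(2-p), while r is a constant
times s². -/
theorem exists_integral_norm_sq_sub_le {Q : Measure (Env d)} [IsProbabilityMeasure Q]
    (h : IsCesaroLimit (iidEnv μ) Q) {R : ℕ} (hR : ∀ᵐ ω ∂(iidEnv μ), HasRange R ω) {u : Site d}
    {p : ℝ} (hp : 1 < p) (hmom : RegenerationMoment (iidEnv μ) u p)
    (v : EuclideanSpace ℝ (Fin d)) :
    ∃ C : ℝ, 0 ≤ C ∧ ∀ n s : ℕ, 1 ≤ s →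
      ∫ ω, ‖quenchedMean ω n - (n : ℝ) • v‖ ^ 2 ∂Q
        ≤ C * (((s : ℝ) ^ 2) ^ 2 + ((s : ℝ) ^ 2) ^ d *
          (∫ ω, ‖quenchedMean ω n - (n : ℝ) • v‖ ^ 2 ∂(iidEnv μ)
            + (n : ℝ) ^ 2 * (s : ℝ) ^ (2 - p))) := by
  obtain ⟨T, hT0, hT⟩ := regenTailSum_le μ hp hmom
  set K : ℝ := ((levelBound u R : ℕ) : ℝ) with hK
  have hK0 : 0 ≤ K := by positivity
  set L : ℝ := d * R + ‖v‖ with hL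
  have hL0 : 0 ≤ L := by positivity
  set c : ℝ := (4 * R * K + 1) ^ d with hc
  have hc0 : 0 ≤ c := by positivity
  refine ⟨8 * (d * R * (2 * K)) ^ 2 + 2 * (c * (4 + 10 * L ^ 2 * T) + L ^ 2 * (2 * K * T)),
    by positivity, fun n s hs => ?_⟩
  have hs1 : (1 : ℝ) ≤ s := by exact_mod_cast hs
  have hs0 : (0 : ℝ) < s := by linarith
  set V := ∫ ω, ‖quenchedMean ω n - (n : ℝ) • v‖ ^ 2 ∂(iidEnv μ)
  have hV : 0 ≤ V := integral_nonneg fun ω => by positivity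
  set b : ℝ := T * (s : ℝ) ^ (1 - p) with hb
  have hb0 : 0 ≤ b := by positivity
  set q : ℕ := 2 * (levelBound u R * s) with hq
  have hqr : (q : ℝ) = 2 * K * s := by rw [hq]; push_cast; ring
  have hrr : ((q * s : ℕ) : ℝ) = 2 * K * (s : ℝ) ^ 2 := by push_cast; rw [hqr]; ring
  set e : ℝ := (s : ℝ) ^ (2 - p) with he
  have he0 : 0 ≤ e := by positivity
  have hsb : (s : ℝ) * b = T * e := by
    have : (s : ℝ) ^ (2 - p) = (s : ℝ) ^ (1 : ℝ) * (s : ℝ) ^ (1 - p) := by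
      rw [← Real.rpow_add hs0]; congr 1; ring
    rw [he, this, Real.rpow_one, hb]; ring
  have hbe : b ≤ T * e := by rw [← hsb]; exact le_mul_of_one_le_left hb0 hs1
  have hqb : (q : ℝ) * b = 2 * K * T * e := by rw [hqr, mul_assoc, hsb]; ring
  set t : ℝ := (s : ℝ) ^ 2 with ht
  have ht1 : 1 ≤ t := one_le_pow₀ hs1
  have htd : 1 ≤ t ^ d := one_le_pow₀ ht1
  have hbox : ((2 * (R * (q * s)) + 1 : ℕ) : ℝ) ^ d ≤ c * t ^ d := by
    rw [hc, ← mul_pow]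
    refine pow_le_pow_left₀ (by positivity) ?_ d
    have : ((2 * (R * (q * s)) + 1 : ℕ) : ℝ) = 4 * R * K * t + 1 := by
      have := hrr
      push_cast at this ⊢
      rw [this]; ring
    rw [this, add_mul, one_mul]
    linarith
  refine (integral_norm_sq_sub_le μ h hR hs hb0 (hT s hs) v n hq rfl).trans ?_
  rw [hrr, hqb]
  have h1 : ((2 * (R * (q * s)) + 1 : ℕ) : ℝ) ^ d * (4 * V + 10 * (L * n) ^ 2 * b)
      ≤ c * t ^ d * (4 * V + 10 * (L * n) ^ 2 * (T * e)) := by gcongr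
  have h2 : (L * n) ^ 2 * (2 * K * T * e) ≤ L ^ 2 * (2 * K * T) * (t ^ d * (V + n ^ 2 * e)) := by
    have : (n : ℝ) ^ 2 * e ≤ t ^ d * (V + n ^ 2 * e) := by
      refine le_trans ?_ (le_mul_of_one_le_left (by positivity) htd)
      linarith
    calc (L * n) ^ 2 * (2 * K * T * e) = L ^ 2 * (2 * K * T) * (n ^ 2 * e) := by ring
      _ ≤ _ := mul_le_mul_of_nonneg_left this (by positivity)
  have h3 : c * t ^ d * (4 * V + 10 * (L * n) ^ 2 * (T * e))
      ≤ c * (4 + 10 * L ^ 2 * T) * (t ^ d * (V + n ^ 2 * e)) := by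
    have : 4 * V + 10 * (L * n) ^ 2 * (T * e) ≤ (4 + 10 * L ^ 2 * T) * (V + n ^ 2 * e) := by
      have h5 : 0 ≤ 10 * L ^ 2 * T * V := by positivity
      have h6 : 0 ≤ 4 * (n ^ 2 * e) := by positivity
      calc 4 * V + 10 * (L * n) ^ 2 * (T * e)
          ≤ 4 * V + 10 * (L * n) ^ 2 * (T * e) + 10 * L ^ 2 * T * V + 4 * (n ^ 2 * e) := by linarith
        _ = _ := by ring
    calc c * t ^ d * (4 * V + 10 * (L * n) ^ 2 * (T * e))
        ≤ c * t ^ d * ((4 + 10 * L ^ 2 * T) * (V + n ^ 2 * e)) :=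
          mul_le_mul_of_nonneg_left this (by positivity)
      _ = _ := by ring
  have h4 : 8 * (d * R * (2 * K * t)) ^ 2 = 8 * (d * R * (2 * K)) ^ 2 * t ^ 2 := by ring
  set A := t ^ d * (V + n ^ 2 * e)
  have hA : 0 ≤ A := by positivity
  have h7 : 0 ≤ 8 * (d * R * (2 * K)) ^ 2 * A := by positivity
  have h8 : 0 ≤ 2 * (c * (4 + 10 * L ^ 2 * T) + L ^ 2 * (2 * K * T)) * t ^ 2 := by positivity
  rw [h4]
  linarith

/-- Take s ≈ n^(ε/2) with ε = δ/d and δ = α - ᾱ, so that the box factor s^(2d) is about n^δ. Then s⁴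
≈ n^(2ε) with ε ≤ δ ≤ α, which uses ᾱ ≥ 0. -/
theorem rate_bound {d : ℕ} (hd : 1 ≤ d) {αbar α p : ℝ} (hαbar : 0 ≤ αbar) (h1 : αbar < α)
    (h2 : α < 1) (hp : 5 * (d : ℝ) / (α - αbar) < p) {n : ℕ} (hn : 1 ≤ n) :
    ∃ s : ℕ, 1 ≤ s ∧ ((s : ℝ) ^ 2) ^ 2 ≤ 16 * (n : ℝ) ^ (2 * α) ∧
      ((s : ℝ) ^ 2) ^ d * (n : ℝ) ^ (2 * αbar) ≤ 4 ^ d * (n : ℝ) ^ (2 * α) ∧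
      ((s : ℝ) ^ 2) ^ d * ((n : ℝ) ^ 2 * (s : ℝ) ^ (2 - p)) ≤ 4 ^ d * (n : ℝ) ^ (2 * α) := by
  have hd0 : (0 : ℝ) < d := by exact_mod_cast hd
  have hd1 : (1 : ℝ) ≤ d := by exact_mod_cast hd
  have hn1 : (1 : ℝ) ≤ n := by exact_mod_cast hn
  have hn0 : (0 : ℝ) < n := by linarith
  set δ := α - αbar with hδ
  have hδ0 : 0 < δ := by linarith
  set ε := δ / d with hε
  have hε0 : 0 < ε := by positivity
  have hεδ : ε * d = δ := div_mul_cancel₀ δ hd0.ne'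
  have hεδ' : ε ≤ δ := div_le_self hδ0.le hd1
  have hεp : 5 < ε * p := by
    have : 5 * (d : ℝ) < p * δ := (div_lt_iff₀ hδ0).mp hp
    have h5 : ε * p = p * δ / d := by rw [hε]; ring
    rw [h5, lt_div_iff₀ hd0]
    exact this
  -- The exponent `2 - p` must be nonpositive for the lower bound `y ≤ s` to bound the power from
  -- above.
  have hp2 : 2 ≤ p := by
    by_contra hlt
    have : ε * p ≤ 1 * 2 := mul_le_mul_of_nonneg' (by linarith) (by linarith)
      (by
        rcases le_or_gt 0 p with h | h
        · exact h
        · exact absurd hεp (by nlinarith)) zero_le_one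
    linarith
  set y : ℝ := (n : ℝ) ^ (ε / 2) with hy
  have hy1 : 1 ≤ y := Real.one_le_rpow hn1 (by positivity)
  have hyy : y ^ 2 = (n : ℝ) ^ ε := by
    rw [hy, ← Real.rpow_natCast, ← Real.rpow_mul hn0.le]; congr 1; push_cast; ring
  refine ⟨⌈y⌉₊, Nat.one_le_ceil_iff.mpr (by linarith), ?_⟩
  set s : ℝ := ((⌈y⌉₊ : ℕ) : ℝ)
  have hs1 : y ≤ s := Nat.le_ceil y
  have hs2 : s ≤ 2 * y := by linarith [Nat.ceil_lt_add_one (by linarith : 0 ≤ y)]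
  have hs0 : 0 < s := by linarith
  have ht : s ^ 2 ≤ 4 * (n : ℝ) ^ ε := by
    rw [← hyy]
    calc s ^ 2 ≤ (2 * y) ^ 2 := pow_le_pow_left₀ hs0.le hs2 2
      _ = 4 * y ^ 2 := by ring
  have htd : (s ^ 2) ^ d ≤ 4 ^ d * (n : ℝ) ^ δ := by
    calc (s ^ 2) ^ d ≤ (4 * (n : ℝ) ^ ε) ^ d := pow_le_pow_left₀ (by positivity) ht d
      _ = 4 ^ d * (n : ℝ) ^ δ := by
          rw [mul_pow, ← Real.rpow_natCast ((n : ℝ) ^ ε), ← Real.rpow_mul hn0.le, hεδ]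
  have hmono : ∀ {a b : ℝ}, a ≤ b → (n : ℝ) ^ a ≤ (n : ℝ) ^ b := fun h =>
    Real.rpow_le_rpow_of_exponent_le hn1 h
  refine ⟨?_, ?_, ?_⟩
  · calc (s ^ 2) ^ 2 ≤ (4 * (n : ℝ) ^ ε) ^ 2 := pow_le_pow_left₀ (by positivity) ht 2
      _ = 16 * (n : ℝ) ^ (2 * ε) := by
          rw [mul_pow, ← Real.rpow_natCast ((n : ℝ) ^ ε), ← Real.rpow_mul hn0.le]
          norm_num [mul_comm]
      _ ≤ 16 * (n : ℝ) ^ (2 * α) :=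
          mul_le_mul_of_nonneg_left (hmono (by linarith)) (by norm_num)
  · calc (s ^ 2) ^ d * (n : ℝ) ^ (2 * αbar)
        ≤ (4 ^ d * (n : ℝ) ^ δ) * (n : ℝ) ^ (2 * αbar) :=
          mul_le_mul_of_nonneg_right htd (by positivity)
      _ = 4 ^ d * (n : ℝ) ^ (δ + 2 * αbar) := by rw [mul_assoc, ← Real.rpow_add hn0]
      _ ≤ 4 ^ d * (n : ℝ) ^ (2 * α) :=
          mul_le_mul_of_nonneg_left (hmono (by linarith)) (by positivity)
  · have he : s ^ (2 - p) ≤ (n : ℝ) ^ (ε / 2 * (2 - p)) := by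
      rw [Real.rpow_mul hn0.le]
      exact Real.rpow_le_rpow_of_nonpos (by linarith) hs1 (by linarith)
    calc (s ^ 2) ^ d * ((n : ℝ) ^ 2 * s ^ (2 - p))
        ≤ (4 ^ d * (n : ℝ) ^ δ) * ((n : ℝ) ^ 2 * (n : ℝ) ^ (ε / 2 * (2 - p))) := by gcongr
      _ = 4 ^ d * (n : ℝ) ^ (δ + (2 + ε / 2 * (2 - p))) := by
          rw [mul_assoc, Real.rpow_add hn0, Real.rpow_add hn0]; norm_num
      -- Since εp > 5, the exponent δ + 2 + ε - εp/2 is less than 2δ - 1/2, hence less than 2α.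
      _ ≤ 4 ^ d * (n : ℝ) ^ (2 * α) :=
          mul_le_mul_of_nonneg_left (hmono (by nlinarith)) (by positivity)

end RWRE

/-! ### Conclusion -/

theorem proposition5p2 {d : ℕ} (hd : 1 ≤ d)
    -- the i.i.d. environment measure `ℙ`
    (μ : Measure (JumpLaw d)) [IsProbabilityMeasure μ]
    -- standing assumptions on the walk
    (u : Site d) (htrans : Transient (iidEnv μ) u)
    (hstep : BoundedSteps (iidEnv μ))
    (p₀ : ℝ) (hmom : RegenerationMoment (iidEnv μ) u p₀)
    -- the invariant measure `ℙ_∞` of the environment process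
    (Pinf : Measure (Env d)) [IsProbabilityMeasure Pinf]
    (hPinf : IsCesaroLimit (iidEnv μ) Pinf)
    -- the variance of the quenched mean under `ℙ`
    (αbar : ℝ) (hαbar : αbar < 1 / 2)
    (hvar : (fun n : ℕ => ∫ ω, ‖quenchedMean ω n - averagedMean (iidEnv μ) n‖ ^ 2 ∂(iidEnv μ))
      =O[atTop] fun n : ℕ => (n : ℝ) ^ (2 * αbar))
    (α : ℝ) (hα : α ∈ Set.Ioo αbar 1)
    (hp₀ : 5 * (d : ℝ) / (α - αbar) < p₀) :
    (fun n : ℕ => ∫ ω, ‖quenchedMean ω n - (n : ℝ) • ∫ ω', drift ω' ∂Pinf‖ ^ 2 ∂Pinf)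
      =O[atTop] fun n : ℕ => (n : ℝ) ^ (2 * α) := by
  obtain ⟨R, hR⟩ := hstep.exists_hasRange
  -- Bounded errors, such as that of the averaged mean, are absorbed in n^(2ᾱ) only if ᾱ ≥ 0; for ᾱ
  -- < 0 the vanishing variance makes the left side zero.
  rcases lt_or_ge αbar 0 with hneg | hnonneg
  · have hlim : Tendsto (fun n : ℕ =>
        ∫ ω, ‖quenchedMean ω n - averagedMean (iidEnv μ) n‖ ^ 2 ∂(iidEnv μ)) atTop (𝓝 0) := by
      refine hvar.trans_tendsto ?_
      have := (tendsto_rpow_neg_atTop (by linarith : 0 < -(2 * αbar))).comp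
        (tendsto_natCast_atTop_atTop (R := ℝ))
      simpa [Function.comp_def] using this
    have := fun n => integral_eq_zero_of_tendsto μ hPinf hR hlim n
    simp only [this]
    exact Asymptotics.isBigO_zero _ _
  · have hδ : 0 < α - αbar := by linarith [hα.1]
    have hd1 : (1 : ℝ) ≤ d := by exact_mod_cast hd
    -- Here α - ᾱ ≤ 1 because ᾱ ≥ 0, and d ≥ 1; the bound covers the requirements p₀ > 1 and p₀ > 3
    -- below.
    have hp5 : 5 < p₀ := by
      refine lt_of_le_of_lt ?_ hp₀
      rw [le_div_iff₀ hδ]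
      linarith [hα.2]
    obtain ⟨Cv, hCv⟩ := exists_norm_averagedMean_sub_le μ hPinf hR (by linarith) hmom
    set v := ∫ ω', drift ω' ∂Pinf
    obtain ⟨C, hC0, hC⟩ := exists_integral_norm_sq_sub_le μ hPinf hR (by linarith) hmom v
    obtain ⟨B, hB⟩ := hvar.bound
    refine Asymptotics.IsBigO.of_bound
      (C * (16 + ((2 * |B| + 2 * Cv ^ 2) * 4 ^ d + 4 ^ d))) ?_
    filter_upwards [hB, eventually_ge_atTop 1] with n hBn hn
    obtain ⟨s, hs, h1, h2, h3⟩ := rate_bound hd hnonneg hα.1 hα.2 hp₀ hn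
    have hn1 : (1 : ℝ) ≤ n := by exact_mod_cast hn
    have hn2 : (1 : ℝ) ≤ (n : ℝ) ^ (2 * αbar) := Real.one_le_rpow hn1 (by linarith)
    rw [Real.norm_of_nonneg (integral_nonneg fun ω => by positivity),
      Real.norm_of_nonneg (by positivity)] at hBn ⊢
    have hV : ∫ ω, ‖quenchedMean ω n - (n : ℝ) • v‖ ^ 2 ∂(iidEnv μ)
        ≤ (2 * |B| + 2 * Cv ^ 2) * (n : ℝ) ^ (2 * αbar) := by
      refine (integral_norm_sq_quenchedMean_sub_le μ hR n
        (averagedMean (iidEnv μ) n) ((n : ℝ) • v)).trans ?_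
      have h4 := pow_le_pow_left₀ (norm_nonneg _) (hCv n) 2
      have h5 : B * (n : ℝ) ^ (2 * αbar) ≤ |B| * (n : ℝ) ^ (2 * αbar) :=
        mul_le_mul_of_nonneg_right (le_abs_self B) (by positivity)
      have h6 : Cv ^ 2 ≤ Cv ^ 2 * (n : ℝ) ^ (2 * αbar) := le_mul_of_one_le_right (sq_nonneg _) hn2
      linarith
    refine (hC n s hs).trans ?_
    rw [mul_assoc]
    refine mul_le_mul_of_nonneg_left ?_ hC0
    have h7 : ((s : ℝ) ^ 2) ^ d * ∫ ω, ‖quenchedMean ω n - (n : ℝ) • v‖ ^ 2 ∂(iidEnv μ)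
        ≤ (2 * |B| + 2 * Cv ^ 2) * (4 ^ d * (n : ℝ) ^ (2 * α)) := by
      refine (mul_le_mul_of_nonneg_left hV (by positivity)).trans ?_
      calc ((s : ℝ) ^ 2) ^ d * ((2 * |B| + 2 * Cv ^ 2) * (n : ℝ) ^ (2 * αbar))
          = (2 * |B| + 2 * Cv ^ 2) * (((s : ℝ) ^ 2) ^ d * (n : ℝ) ^ (2 * αbar)) := by ring
        _ ≤ _ := mul_le_mul_of_nonneg_left h2 (by positivity)
    linarith
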